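/- Conventions. "Small" is relative to a fixed universe of sets; $V$ is a locally small category, and coproducts, sets of objects of graphs, and indexing categories are small. $MV$ is the free strict monoidal category on $V$: objects are finite sequences $(Z_1,\dots,Z_n)$, $n\ge 0$, of objects of $V$, morphisms are sequences of morphisms, and there are none between sequences of different lengths. A multitensor $(E,u,\sigma)$ on $V$ is a functor $E:MV\to V$ with natural maps $u_Z:Z\to E(Z)$ and $\sigma:E_iE_j Z_{ij}\to E_{ij}Z_{ij}$ (where $E_iZ_i$ denotes $E(Z_1,\dots,Z_n)$, and $E_{ij}Z_{ij}$ is $E$ of the concatenated sequence), satisfying the unit laws $\sigma\circ u_{E_iZ_i}=1=\sigma\circ E_i u_{Z_i}$ and the associative law $\sigma\circ(\sigma E_k)=\sigma\circ(E_i\sigma):E_iE_jE_kZ_{ijk}\to E_{ijk}Z_{ijk}$. It is distributive if each $E_n:V^n\to V$, $(Z_1,\dots,Z_n)\mapsto E(Z_1,\dots,Z_n)$, preserves coproducts in each variable. A $V$-graph $X$ is a set $X_0$ with objects $X(a,b)\in V$ for $a,b\in X_0$; a morphism $f:X\to Y$ is a function $f:X_0\to Y_0$ with maps $X(a,b)\to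 Y(fa,fb)$. These form the category $\mathcal GV$. If $V$ has coproducts and $E$ is distributive, the induced monad $(\Gamma E,\eta,\mu)$ on $\mathcal GV$ is as follows. $\Gamma E(X)$ has the objects of $X$ and homs $$\Gamma E(X)(a,b)=\coprod_{a=x_0,\dots,x_n=b}E(X(x_0,x_1),\dots,X(x_{n-1},x_n)),$$ the coproduct being over all finite sequences ($n\ge 0$) of objects of $X$ from $a$ to $b$. The maps $\eta$ and $\mu$ are identities on objects; on homs $\eta$ is $u$ followed by the coproduct inclusion at $(a,b)$, and $\mu$ is determined by the $\sigma$'s and concatenation of doubly nested sequences, since by distributivity $(\Gamma E)^2(X)(a,b)$ is the coproduct of the objects $E_iE_jX(x_{ij-1},x_{ij})$ over all doubly nested sequences of objects of $X$ from $a$ to $b$. Let $\lambda$ be a regular cardinal. A functor is $\lambda$-accessible if it preserves $\lambda$-filtered colimits; a multitensor is $\lambda$-accessible if $E:MV\to V$ is, and a monad if its underlying functor is. An object $C$ is connected if $V(C,-)$ preserves coproducts, and $\lambda$-presentable if $V(C,-)$ is $\lambda$-accessible. A transformation is cartesian if its naturality squares are pullbacks. A monad (resp. multitensor) is cartesian if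 its underlying functor (resp. $E:MV\to V$) preserves pullbacks and $\eta,\mu$ (resp. $u,\sigma$) are cartesian. A functor $F:A\to B$ is a local right adjoint (l.r.a.) if $A/X\to B/FX$ is a right adjoint for every $X\in A$. A monad (resp. multitensor) is l.r.a. if its underlying functor (resp. $E:MV\to V$) is l.r.a. and $\eta,\mu$ (resp. $u,\sigma$) are cartesian. $V$ is locally $\lambda$-c-presentable if it is cocomplete and has a set $S$ of connected $\lambda$-presentable objects such that every object of $V$ is a colimit of a diagram of objects of $S$ indexed by a small $\lambda$-c-filtered category, that is, one in which every functor into it from a $\lambda$-small connected category admits a cocone. Theorem. Let $V$ be a category with coproducts, $(E,u,\sigma)$ a distributive multitensor on $V$, $(\Gamma E,\eta,\mu)$ the induced monad on $\mathcal GV$, and $\lambda$ a regular cardinal. 1. $\Gamma E$ preserves coproducts. 2. If $V$ has $\lambda$-filtered colimits, then $E$ is $\lambda$-accessible iff $\Gamma E$ is. 3. If $V$ has pullbacks and every object of $V$ is a coproduct of connected objects, then $(E,u,\sigma)$ is a cartesian multitensor iff $(\Gamma E,\eta,\mu)$ is a cartesian monad. 4. If $V$ is locally $\lambda$-c-presentable,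 then $(E,u,\sigma)$ is an l.r.a. multitensor iff $(\Gamma E,\eta,\mu)$ is an l.r.a. monad. -/

import Mathlib

open CategoryTheory Limits Opposite

universe v u

namespace EnrichedGraphMonad

/-- The objects of the free strict monoidal category `MV` on `V`: finite sequences of objects. -/
def FreeMon (V : Type u) : Type u := List V

namespace FreeMon

section Basic

variable {V : Type u} [Category.{v} V]

/-- A morphism of finite sequences is a sequence of morphisms; there are no morphisms between
sequences of different lengths. -/
def Hom : List V → List V → Type v
  | [], [] => PUnit
  | [], _ :: _ => PEmpty
  | _ :: _, [] => PEmpty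
  | X :: l, Y :: m => (X ⟶ Y) × Hom l m

/-- The identity morphism of a sequence. -/
def Hom.id : ∀ l : List V, Hom l l
  | [] => PUnit.unit
  | X :: l => (𝟙 X, Hom.id l)

/-- Termwise composition. -/
def Hom.comp : ∀ {l m n : List V}, Hom l m → Hom m n → Hom l n
  | [], [], [], _, _ => PUnit.unit
  | [], [], _ :: _, _, g => g.elim
  | [], _ :: _, _, f, _ => f.elim
  | _ :: _, [], _, f, _ => f.elim
  | _ :: _, _ :: _, [], _, g => g.elim
  | _ :: _, _ :: _, _ :: _, f, g => (f.1 ≫ g.1, Hom.comp f.2 g.2)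

theorem Hom.id_comp : ∀ {l m : List V} (f : Hom l m), Hom.comp (Hom.id l) f = f
  | [], [], _ => rfl
  | [], _ :: _, f => f.elim
  | _ :: _, [], f => f.elim
  | _ :: _, _ :: _, f => Prod.ext (Category.id_comp f.1) (Hom.id_comp f.2)

theorem Hom.comp_id : ∀ {l m : List V} (f : Hom l m), Hom.comp f (Hom.id m) = f
  | [], [], _ => rfl
  | [], _ :: _, f => f.elim
  | _ :: _, [], f => f.elim
  | _ :: _, _ :: _, f => Prod.ext (Category.comp_id f.1) (Hom.comp_id f.2)

theorem Hom.assoc : ∀ {l m n k : List V} (f : Hom l m) (g : Hom m n) (h : Hom n k),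
    Hom.comp (Hom.comp f g) h = Hom.comp f (Hom.comp g h)
  | [], [], [], [], _, _, _ => rfl
  | [], [], [], _ :: _, _, _, h => h.elim
  | [], [], _ :: _, _, _, g, _ => g.elim
  | [], _ :: _, _, _, f, _, _ => f.elim
  | _ :: _, [], _, _, f, _, _ => f.elim
  | _ :: _, _ :: _, [], _, _, g, _ => g.elim
  | _ :: _, _ :: _, _ :: _, [], _, _, h => h.elim
  | _ :: _, _ :: _, _ :: _, _ :: _, f, g, h =>
      Prod.ext (Category.assoc f.1 g.1 h.1) (Hom.assoc f.2 g.2 h.2)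

instance category : Category.{v} (FreeMon V) where
  Hom l m := Hom l m
  id l := Hom.id l
  comp f g := Hom.comp f g
  id_comp f := Hom.id_comp f
  comp_id f := Hom.comp_id f
  assoc f g h := Hom.assoc f g h

/-- The empty sequence. -/
def nil : FreeMon V := ([] : List V)

/-- The sequence `(X, l₁, …, lₙ)`. -/
def cons (X : V) (l : FreeMon V) : FreeMon V := List.cons X l

/-- Concatenation of two sequences. -/
def append (l m : FreeMon V) : FreeMon V := List.append l m

/-- Prepend a morphism to a sequence of morphisms. -/
def consHom {X Y : V} {l m : FreeMon V} (f : X ⟶ Y) (g : l ⟶ m) : cons X l ⟶ cons Y m :=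
  (⟨f, g⟩ : (X ⟶ Y) × Hom l m)

theorem consHom_id (X : V) (l : FreeMon V) : consHom (𝟙 X) (𝟙 l) = 𝟙 (cons X l) := rfl

theorem consHom_comp {X Y Z : V} {l m n : FreeMon V} (f : X ⟶ Y) (g : l ⟶ m) (f' : Y ⟶ Z)
    (g' : m ⟶ n) : consHom f g ≫ consHom f' g' = consHom (f ≫ f') (g ≫ g') := rfl

theorem consHom_eqToHom {X Y : V} {l m : FreeMon V} (h : X = Y) (h' : l = m) :
    consHom (eqToHom h) (eqToHom h') = eqToHom (by rw [h, h']) := by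
  subst h h'; rfl

/-- Concatenation of sequences of morphisms. -/
def appendHom : ∀ {l l' m m' : List V}, Hom l l' → Hom m m' → Hom (l ++ m) (l' ++ m')
  | [], [], _, _, _, g => g
  | [], _ :: _, _, _, f, _ => f.elim
  | _ :: _, [], _, _, f, _ => f.elim
  | _ :: _, _ :: _, _, _, f, g => (f.1, appendHom f.2 g)

theorem appendHom_id : ∀ l m : List V, appendHom (Hom.id l) (Hom.id m) = Hom.id (l ++ m)
  | [], _ => rfl
  | X :: l, m => Prod.ext (rfl : 𝟙 X = 𝟙 X) (appendHom_id l m)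

theorem appendHom_comp : ∀ {l l' l'' m m' m'' : List V} (f : Hom l l') (f' : Hom l' l'')
    (g : Hom m m') (g' : Hom m' m''),
    appendHom (Hom.comp f f') (Hom.comp g g') = Hom.comp (appendHom f g) (appendHom f' g')
  | [], [], [], _, _, _, _, _, _, _ => rfl
  | [], [], _ :: _, _, _, _, _, f', _, _ => f'.elim
  | [], _ :: _, _, _, _, _, f, _, _, _ => f.elim
  | _ :: _, [], _, _, _, _, f, _, _, _ => f.elim
  | _ :: _, _ :: _, [], _, _, _, _, f', _, _ => f'.elim
  | _ :: _, _ :: _, _ :: _, _, _, _, f, f', g, g' =>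
      Prod.ext (rfl : f.1 ≫ f'.1 = f.1 ≫ f'.1) (appendHom_comp f.2 f'.2 g g')

/-- Concatenation of a sequence of sequences of morphisms. -/
def joinHom : ∀ {l m : List (FreeMon V)}, Hom l m →
    Hom (V := V) (List.flatten (α := V) l) (List.flatten (α := V) m)
  | [], [], _ => PUnit.unit
  | [], _ :: _, f => f.elim
  | _ :: _, [], f => f.elim
  | _ :: _, _ :: _, f => appendHom f.1 (joinHom f.2)

theorem joinHom_id : ∀ l : List (FreeMon V), joinHom (Hom.id l) = Hom.id _
  | [] => rfl
  | X :: l => (congrArg (appendHom (Hom.id X)) (joinHom_id l)).trans (appendHom_id _ _)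

theorem joinHom_comp : ∀ {l m n : List (FreeMon V)} (f : Hom l m) (g : Hom m n),
    joinHom (Hom.comp f g) = Hom.comp (joinHom f) (joinHom g)
  | [], [], [], _, _ => rfl
  | [], [], _ :: _, _, g => g.elim
  | [], _ :: _, _, f, _ => f.elim
  | _ :: _, [], _, f, _ => f.elim
  | _ :: _, _ :: _, [], _, g => g.elim
  | _ :: _, _ :: _, _ :: _, f, g =>
      (congrArg (appendHom _) (joinHom_comp f.2 g.2)).trans (appendHom_comp _ _ _ _)

/-- The concatenation functor `M²V ⥤ MV`, the multiplication of the 2-monad `M`. -/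
def join : FreeMon (FreeMon V) ⥤ FreeMon V where
  obj l := List.flatten (α := V) l
  map f := joinHom f
  map_id l := joinHom_id l
  map_comp f g := joinHom_comp f g

/-- The functor `V ⥤ MV` sending an object to a sequence of length one, the unit of `M`. -/
def single : V ⥤ FreeMon V where
  obj X := cons X nil
  map f := consHom f (𝟙 _)
  map_id _ := rfl
  map_comp f g := by rw [consHom_comp, Category.comp_id]

/-- The functor `Z ↦ (l₁, …, lₘ, Z, r₁, …, rₙ)`. -/
def insertAt (l r : FreeMon V) : V ⥤ FreeMon V where
  obj Z := append l (cons Z r)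
  map f := appendHom (Hom.id l) (consHom f (𝟙 r))
  map_id Z := appendHom_id l (cons Z r)
  map_comp f g :=
    (congrArg₂ appendHom (Hom.id_comp (Hom.id l)).symm
      (Prod.ext rfl (Hom.id_comp (Hom.id r)).symm :
        consHom (f ≫ g) (𝟙 r) = consHom f (𝟙 r) ≫ consHom g (𝟙 r))).trans
    (appendHom_comp (Hom.id l) (Hom.id l) (consHom f (𝟙 r)) (consHom g (𝟙 r)))

end Basic

section Functoriality

variable {V W : Type*} [Category* V] [Category* W]

/-- The action of `M` on the morphisms: apply a functor termwise. -/
def mapHom (F : V ⥤ W) : ∀ {l m : List V}, Hom l m → Hom (l.map F.obj) (m.map F.obj)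
  | [], [], _ => PUnit.unit
  | [], _ :: _, f => f.elim
  | _ :: _, [], f => f.elim
  | _ :: _, _ :: _, f => (F.map f.1, mapHom F f.2)

theorem mapHom_id (F : V ⥤ W) : ∀ l : List V, mapHom F (Hom.id l) = Hom.id (l.map F.obj)
  | [] => rfl
  | X :: l => Prod.ext (F.map_id X) (mapHom_id F l)

theorem mapHom_comp (F : V ⥤ W) : ∀ {l m n : List V} (f : Hom l m) (g : Hom m n),
    mapHom F (Hom.comp f g) = Hom.comp (mapHom F f) (mapHom F g)
  | [], [], [], _, _ => rfl
  | [], [], _ :: _, _, g => g.elim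
  | [], _ :: _, _, f, _ => f.elim
  | _ :: _, [], _, f, _ => f.elim
  | _ :: _, _ :: _, [], _, g => g.elim
  | _ :: _, _ :: _, _ :: _, f, g => Prod.ext (F.map_comp f.1 g.1) (mapHom_comp F f.2 g.2)

/-- `MF : MV ⥤ MW` applies `F` termwise. -/
def mapSeq (F : V ⥤ W) : FreeMon V ⥤ FreeMon W where
  obj l := List.map F.obj l
  map f := mapHom F f
  map_id l := mapHom_id F l
  map_comp f g := mapHom_comp F f g

/-- Termwise components of a natural transformation. -/
def mapNatHom {F G : V ⥤ W} (α : F ⟶ G) : ∀ l : List V, Hom (l.map F.obj) (l.map G.obj)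
  | [] => PUnit.unit
  | X :: l => (α.app X, mapNatHom α l)

theorem mapNatHom_naturality {F G : V ⥤ W} (α : F ⟶ G) : ∀ {l m : List V} (f : Hom l m),
    Hom.comp (mapHom F f) (mapNatHom α m) = Hom.comp (mapNatHom α l) (mapHom G f)
  | [], [], _ => rfl
  | [], _ :: _, f => f.elim
  | _ :: _, [], f => f.elim
  | _ :: _, _ :: _, f => Prod.ext (α.naturality f.1) (mapNatHom_naturality α f.2)

/-- `Mα : MF ⟶ MG` has the components of `α` termwise. -/
def mapNat {F G : V ⥤ W} (α : F ⟶ G) : mapSeq F ⟶ mapSeq G where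
  app l := mapNatHom α l
  naturality _ _ f := mapNatHom_naturality α f

end Functoriality

section Strictness

variable {U V W : Type*} [Category* U] [Category* V] [Category* W]

theorem map_id_obj (l : FreeMon V) : (mapSeq (𝟭 V)).obj l = l := List.map_id l

theorem map_map_obj (F : U ⥤ V) (G : V ⥤ W) (l : FreeMon U) :
    (mapSeq (F ⋙ G)).obj l = (mapSeq G).obj ((mapSeq F).obj l) :=
  (List.map_map (g := G.obj) (f := F.obj) (l := l)).symm

theorem join_single (l : FreeMon V) : join.obj (single.obj l) = l := List.append_nil l

theorem join_map_single : ∀ l : List V, join.obj ((mapSeq single).obj l) = l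
  | [] => rfl
  | X :: l => congrArg (List.cons X) (join_map_single l)

theorem join_map_map (F : V ⥤ W) (l : FreeMon (FreeMon V)) :
    join.obj ((mapSeq (mapSeq F)).obj l) = (mapSeq F).obj (join.obj l) :=
  (List.map_flatten (f := F.obj) (L := l)).symm

theorem join_join (l : FreeMon (FreeMon (FreeMon V))) :
    join.obj ((mapSeq join).obj l) = join.obj (join.obj l) :=
  (List.flatten_flatten (L := l)).symm

end Strictness

end FreeMon

open FreeMon

/-- A multitensor `(E, u, σ)` on `V`, that is, the structure of a lax algebra for the
2-monad `M`. The morphisms `eqToHom _` only identify equal finite sequences. -/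
structure Multitensor (V : Type u) [Category.{v} V] where
  tensor : FreeMon V ⥤ V
  unit : 𝟭 V ⟶ single ⋙ tensor
  subst : mapSeq tensor ⋙ tensor ⟶ join ⋙ tensor
  unit_subst : ∀ Z : FreeMon V,
    unit.app (tensor.obj Z) ≫ subst.app (single.obj Z) ≫ tensor.map (eqToHom (join_single Z)) = 𝟙 _
  map_unit_subst : ∀ Z : FreeMon V,
    tensor.map (eqToHom (map_id_obj Z).symm ≫ (mapNat unit).app Z ≫
        eqToHom (map_map_obj single tensor Z)) ≫
      subst.app ((mapSeq single).obj Z) ≫ tensor.map (eqToHom (join_map_single Z)) = 𝟙 _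
  assoc : ∀ Z : FreeMon (FreeMon (FreeMon V)),
    subst.app ((mapSeq (mapSeq tensor)).obj Z) ≫ tensor.map (eqToHom (join_map_map tensor Z)) ≫
      subst.app (join.obj Z) =
    tensor.map (eqToHom (map_map_obj (mapSeq tensor) tensor Z).symm ≫ (mapNat subst).app Z ≫
        eqToHom (map_map_obj join tensor Z)) ≫
      subst.app ((mapSeq join).obj Z) ≫ tensor.map (eqToHom (join_join Z))

/-- For all `n`, the functor of `n` variables `(Z₁, …, Zₙ) ↦ E(Z₁, …, Zₙ)` preserves coproducts in
each variable. -/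
def PreservesCoproductsInEachVariable {V : Type u} [Category.{v} V] (E : FreeMon V ⥤ V) : Prop :=
  ∀ (l r : FreeMon V) (J : Type v), PreservesColimitsOfShape (Discrete J) (insertAt l r ⋙ E)

/-- A multitensor is distributive when each `Eₙ : Vⁿ ⥤ V` preserves coproducts in each variable. -/
def Multitensor.IsDistributive {V : Type u} [Category.{v} V] (E : Multitensor V) : Prop :=
  PreservesCoproductsInEachVariable E.tensor

/-- A graph enriched in `V`: a set of objects, and a hom in `V` for each ordered pair of objects. -/
structure EnrichedGraph (V : Type u) [Category.{v} V] where
  obj : Type v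
  hom : obj → obj → V

namespace EnrichedGraph

variable {V : Type u} [Category.{v} V]

/-- A morphism of enriched graphs. -/
structure Hom (X Y : EnrichedGraph V) where
  onObj : X.obj → Y.obj
  onHom : ∀ a b : X.obj, X.hom a b ⟶ Y.hom (onObj a) (onObj b)

theorem Hom.congr {X Y : EnrichedGraph V} {o : X.obj → Y.obj}
    {φ ψ : ∀ a b : X.obj, X.hom a b ⟶ Y.hom (o a) (o b)} (h : ∀ a b, φ a b = ψ a b) :
    (⟨o, φ⟩ : Hom X Y) = ⟨o, ψ⟩ := by
  have : φ = ψ := funext fun a => funext fun b => h a b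
  rw [this]

/-- The category `GV` of graphs enriched in `V`. -/
instance category : Category.{v} (EnrichedGraph V) where
  Hom X Y := Hom X Y
  id _ := ⟨fun a => a, fun _ _ => 𝟙 _⟩
  comp f g := ⟨fun a => g.onObj (f.onObj a), fun a b => f.onHom a b ≫ g.onHom _ _⟩
  id_comp _ := Hom.congr fun _ _ => Category.id_comp _
  comp_id _ := Hom.congr fun _ _ => Category.comp_id _
  assoc _ _ _ := Hom.congr fun _ _ => Category.assoc _ _ _

end EnrichedGraph

/-- Finite composable strings of edges: a string from `a` to `b` consists of a sequence
`a = x₀, …, xₙ = b` (with `n ≥ 0`) and an element of `A xᵢ₋₁ xᵢ` for each `1 ≤ i ≤ n`. -/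
inductive Walk {S : Type v} (A : S → S → Type v) : S → S → Type v
  | nil (a : S) : Walk A a a
  | cons {a b c : S} (e : A a b) (p : Walk A b c) : Walk A a c

/-- Finite sequences `a = x₀, …, xₙ = b` of elements of `S`. -/
abbrev ObjSeq {S : Type v} (a b : S) : Type v := Walk (fun _ _ : S => PUnit.{v + 1}) a b

namespace Walk

section

variable {S T : Type v} {A : S → S → Type v} {B : T → T → Type v}

/-- Apply a map of graphs to a string. -/
def map (f : S → T) (c : ∀ a b, A a b → B (f a) (f b)) :
    ∀ {a b : S}, Walk A a b → Walk B (f a) (f b)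
  | _, _, nil a => nil (f a)
  | _, _, cons e p => cons (c _ _ e) (map f c p)

/-- Juxtaposition of strings. -/
def append : ∀ {a b c : S}, Walk A a b → Walk A b c → Walk A a c
  | _, _, _, nil _, q => q
  | _, _, _, cons e p, q => cons e (append p q)

/-- Concatenation of a doubly nested string. -/
def concat : ∀ {a b : S}, Walk (fun a b => Walk A a b) a b → Walk A a b
  | _, _, nil a => nil a
  | _, _, cons p P => append p (concat P)

/-- The sequence of labels of a string. -/
def labels {C : Type*} (h : ∀ a b, A a b → C) : ∀ {a b : S}, Walk A a b → FreeMon C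
  | _, _, nil _ => FreeMon.nil
  | _, _, cons e p => FreeMon.cons (h _ _ e) (labels h p)

theorem labels_append {C : Type*} [Category* C] (h : ∀ a b, A a b → C) : ∀ {a b c : S} (p : Walk A a b)
    (q : Walk A b c), labels h (append p q) = FreeMon.append (labels h p) (labels h q)
  | _, _, _, nil _, _ => rfl
  | _, _, _, cons e p, q => congrArg (FreeMon.cons (h _ _ e)) (labels_append h p q)

theorem append_nil : ∀ {a b : S} (p : Walk A a b), append p (nil b) = p
  | _, _, nil _ => rfl
  | _, _, cons e p => congrArg (cons e) (append_nil p)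

theorem append_assoc : ∀ {a b c d : S} (p : Walk A a b) (q : Walk A b c) (r : Walk A c d),
    append (append p q) r = append p (append q r)
  | _, _, _, _, nil _, _, _ => rfl
  | _, _, _, _, cons e p, q, r => congrArg (cons e) (append_assoc p q r)

theorem concat_append : ∀ {a b c : S} (P : Walk (fun a b => Walk A a b) a b)
    (Q : Walk (fun a b => Walk A a b) b c), concat (append P Q) = append (concat P) (concat Q)
  | _, _, _, nil _, _ => rfl
  | _, _, _, cons p P, Q =>
      (congrArg (append p) (concat_append P Q)).trans (append_assoc p _ _).symm

theorem concat_concat : ∀ {a b : S} (P : Walk (fun a b => Walk (fun a b => Walk A a b) a b) a b),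
    concat (P.map (fun a => a) (fun _ _ p => concat p)) = concat (concat P)
  | _, _, nil _ => rfl
  | _, _, cons p P => (congrArg (append (concat p)) (concat_concat P)).trans
      (concat_append p (concat P)).symm

theorem map_append (f : S → T) (c : ∀ a b, A a b → B (f a) (f b)) : ∀ {a b d : S}
    (p : Walk A a b) (q : Walk A b d), (append p q).map f c = append (p.map f c) (q.map f c)
  | _, _, _, nil _, _ => rfl
  | _, _, _, cons e p, q => congrArg (cons (c _ _ e)) (map_append f c p q)

theorem map_concat (f : S → T) (c : ∀ a b, A a b → B (f a) (f b)) : ∀ {a b : S}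
    (P : Walk (fun a b => Walk A a b) a b),
    concat (P.map f (fun _ _ p => p.map f c)) = (concat P).map f c
  | _, _, nil _ => rfl
  | _, _, cons p P => (congrArg (append (p.map f c)) (map_concat f c P)).trans
      (map_append f c p (concat P)).symm

theorem concat_map_single : ∀ {a b : S} (p : Walk A a b),
    concat (p.map (B := fun a b => Walk A a b) (fun a => a) (fun _ b e => cons e (nil b))) = p
  | _, _, nil _ => rfl
  | _, _, cons e p => congrArg (cons e) (concat_map_single p)

theorem labels_labels {C D : Type*} (h : ∀ a b, A a b → C) (F : C → D) :
    ∀ {a b : S} (P : Walk A a b),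
    labels (fun a b e => F (h a b e)) P = List.map F (labels h P)
  | _, _, nil _ => rfl
  | _, _, cons e p => congrArg (List.cons (F (h _ _ e))) (labels_labels h F p)

theorem labels_concat {C : Type*} [Category* C] (h : ∀ a b, A a b → C) : ∀ {a b : S}
    (P : Walk (fun a b => Walk A a b) a b),
    join.obj (labels (fun _ _ p => labels h p) P) = labels h (concat P)
  | _, _, nil _ => rfl
  | _, _, cons p P => (congrArg (FreeMon.append (labels h p)) (labels_concat h P)).trans
      (labels_append h p (concat P)).symm

end

section

variable {S T U : Type v} {A : S → S → Type v} {B : T → T → Type v} {D : U → U → Type v}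
variable {C : Type*} [Category* C]

/-- The morphism of label sequences induced by morphisms between labels. -/
def labelsHom (f : S → T) (c : ∀ a b, A a b → B (f a) (f b)) {h : ∀ a b, A a b → C}
    {h' : ∀ a b, B a b → C} (φ : ∀ a b e, h a b e ⟶ h' _ _ (c a b e)) :
    ∀ {a b : S} (P : Walk A a b), labels h P ⟶ labels h' (P.map f c)
  | _, _, nil _ => 𝟙 _
  | _, _, cons e p => consHom (φ _ _ e) (labelsHom f c φ p)

/-- The functor prepending a fixed object. -/
abbrev consFunctor (X : C) : FreeMon C ⥤ FreeMon C where
  obj l := FreeMon.cons X l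
  map g := consHom (𝟙 X) g
  map_id l := consHom_id X l
  map_comp f g := by rw [consHom_comp, Category.comp_id]

theorem consHom_comp_aux {W : Type*} [Category* W] (G : FreeMon C ⥤ W) {X Y Z : C}
    {l m n n' : FreeMon C} (φ : X ⟶ Y) (ψ : Y ⟶ Z) (f : l ⟶ m) (g : m ⟶ n) (k : l ⟶ n') {Q : W}
    (i : G.obj (FreeMon.cons Z n) ⟶ Q) (i' : G.obj (FreeMon.cons Z n') ⟶ Q)
    (H : (consFunctor X ⋙ G).map f ≫ (consFunctor X ⋙ G).map g ≫
        G.map (consHom (φ ≫ ψ) (𝟙 n)) ≫ i =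
      (consFunctor X ⋙ G).map k ≫ G.map (consHom (φ ≫ ψ) (𝟙 n')) ≫ i') :
    G.map (consHom φ f) ≫ G.map (consHom ψ g) ≫ i = G.map (consHom (φ ≫ ψ) k) ≫ i' := by
  simpa only [Functor.comp_map, ← Category.assoc, ← G.map_comp, consHom_comp, Category.id_comp,
    Category.comp_id] using H

theorem labelsHom_id {W : Type*} [Category* W] {h : ∀ a b, A a b → C} {a b : S} (P : Walk A a b) :
    ∀ (G : FreeMon C ⥤ W) {Z : W} (ι : ∀ R : Walk A a b, G.obj (labels h R) ⟶ Z),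
    G.map (labelsHom (fun a => a) (fun _ _ e => e) (h' := h) (fun _ _ _ => 𝟙 _) P) ≫ ι _ = ι P := by
  induction P with
  | nil a => intro G Z ι; exact (congrArg (· ≫ _) (G.map_id _)).trans (Category.id_comp _)
  | cons e p ih =>
    intro G Z ι
    exact ih (consFunctor _ ⋙ G) (fun R => ι (cons e R))

theorem labelsHom_comp {W : Type*} [Category* W] {h : ∀ a b, A a b → C} {h' : ∀ a b, B a b → C}
    {h'' : ∀ a b, D a b → C} (f : S → T) (c : ∀ a b, A a b → B (f a) (f b))
    (φ : ∀ a b e, h a b e ⟶ h' _ _ (c a b e)) (g : T → U) (d : ∀ a b, B a b → D (g a) (g b))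
    (ψ : ∀ a b e, h' a b e ⟶ h'' _ _ (d a b e)) {a b : S} (P : Walk A a b) :
    ∀ (G : FreeMon C ⥤ W) {Z : W} (ι : ∀ R : Walk D (g (f a)) (g (f b)), G.obj (labels h'' R) ⟶ Z),
    G.map (labelsHom f c φ P) ≫ G.map (labelsHom g d ψ (P.map f c)) ≫ ι _ =
    G.map (labelsHom (fun a => g (f a)) (fun a b e => d _ _ (c a b e))
      (fun a b e => φ a b e ≫ ψ _ _ (c a b e)) P) ≫ ι _ := by
  induction P with
  | nil a =>
    intro G Z ι
    exact (congrArg (· ≫ _) (G.map_id _)).trans (Category.id_comp _)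
  | cons e p ih =>
    intro G Z ι
    exact consHom_comp_aux G _ _ _ _ _ _ _ (ih (consFunctor _ ⋙ G)
      (fun R => G.map (consHom (φ _ _ e ≫ ψ _ _ (c _ _ e)) (𝟙 _)) ≫ ι (cons (d _ _ (c _ _ e)) R)))

end

end Walk

namespace Walk

variable {S T : Type v} {A : S → S → Type v} {B : T → T → Type v}

section

variable {C : Type*} [Category* C]

/-- The sequence of objects visited by a string. -/
def shape {a b : S} (P : Walk A a b) : ObjSeq a b :=
  P.map (fun a => a) (fun _ _ _ => PUnit.unit)

theorem eqToHom_aux {X Y : C} (φ : X ⟶ Y) {l l' m m' : FreeMon C} (f : l ⟶ m) (h : m = m')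
    (h' : l = l') (g : l' ⟶ m') (H : f ≫ eqToHom h = eqToHom h' ≫ g) :
    consHom φ f ≫ eqToHom (congrArg (FreeMon.cons Y) h) =
      eqToHom (congrArg (FreeMon.cons X) h') ≫ consHom φ g := by
  subst h h'
  simp only [eqToHom_refl, Category.comp_id, Category.id_comp] at H ⊢
  rw [H]

theorem labelsHom_labels {D : Type*} [Category* D] (F : C ⥤ D) (f : S → T)
    (c : ∀ a b, A a b → B (f a) (f b)) {h : ∀ a b, A a b → C} {h' : ∀ a b, B a b → C}
    (φ : ∀ a b e, h a b e ⟶ h' _ _ (c a b e)) {a b : S} (P : Walk A a b) :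
    labelsHom f c (h := fun a b e => F.obj (h a b e)) (h' := fun a b e => F.obj (h' a b e))
        (fun a b e => F.map (φ a b e)) P ≫ eqToHom (labels_labels h' F.obj _) =
      eqToHom (labels_labels h F.obj P) ≫ (mapSeq F).map (labelsHom f c φ P) := by
  induction P with
  | nil a => rfl
  | cons e p ih => exact eqToHom_aux _ _ _ _ _ ih

/-- Concatenation of morphisms of sequences. -/
def appendMap {l l' m m' : FreeMon C} (f : l ⟶ l') (g : m ⟶ m') :
    FreeMon.append l m ⟶ FreeMon.append l' m' :=
  appendHom f g

theorem labelsHom_append (f : S → T)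
    (c : ∀ a b, A a b → B (f a) (f b)) {h : ∀ a b, A a b → C} {h' : ∀ a b, B a b → C}
    (φ : ∀ a b e, h a b e ⟶ h' _ _ (c a b e)) {a b d : S} (p : Walk A a b) (q : Walk A b d) :
    appendMap (labelsHom f c φ p) (labelsHom f c φ q) ≫
      eqToHom ((labels_append h' _ _).symm.trans (congrArg _ (map_append f c p q).symm)) =
    eqToHom (labels_append h p q).symm ≫ labelsHom f c φ (p.append q) := by
  induction p with
  | nil a => exact (Category.comp_id _).trans (Category.id_comp _).symm
  | cons e p ih => exact eqToHom_aux _ _ _ _ _ (ih q)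

theorem append_aux {l l' m m' n n' k k' : FreeMon C} (f : l ⟶ l') (g : m ⟶ m') (e : m' = n')
    (e' : m = n) (g' : n ⟶ n') (H : g ≫ eqToHom e = eqToHom e' ≫ g')
    (d' : FreeMon.append l n = k)
    (d : FreeMon.append l' n' = k')
    (x : k ⟶ k') (H' : appendMap f g' ≫ eqToHom d = eqToHom d' ≫ x) :
    appendMap f g ≫ eqToHom ((congrArg (FreeMon.append l') e).trans d) =
      eqToHom ((congrArg (FreeMon.append l) e').trans d') ≫ x := by
  subst e e'
  simp only [eqToHom_refl, Category.comp_id, Category.id_comp] at H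
  subst H
  exact H'

theorem labelsHom_concat (f : S → T)
    (c : ∀ a b, A a b → B (f a) (f b)) {h : ∀ a b, A a b → C} {h' : ∀ a b, B a b → C}
    (φ : ∀ a b e, h a b e ⟶ h' _ _ (c a b e)) {a b : S} (P : Walk (fun a b => Walk A a b) a b) :
    join.map (labelsHom f (fun _ _ p => p.map f c) (h := fun _ _ p => labels h p)
        (h' := fun _ _ p => labels h' p) (fun _ _ p => labelsHom f c φ p) P) ≫
      eqToHom ((labels_concat h' _).trans (congrArg _ (map_concat f c P))) =
    eqToHom (labels_concat h P) ≫ labelsHom f c φ P.concat := by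
  induction P with
  | nil a => rfl
  | cons p P ih => exact append_aux _ _ _ _ _ ih _ _ _ (labelsHom_append f c φ p P.concat)

end

variable {V : Type u} [Category.{v} V]

theorem preserves_cons {G : FreeMon V ⥤ V} (hG : PreservesCoproductsInEachVariable G) (X : V) :
    PreservesCoproductsInEachVariable (consFunctor X ⋙ G) :=
  fun l r J => hG (FreeMon.cons X l) r J

theorem exists_desc_cons {G : FreeMon V ⥤ V} (hG : PreservesCoproductsInEachVariable G)
    (r : FreeMon V) {J : Type v} {h : J → V} {Y : V} (ι : ∀ e, h e ⟶ Y)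
    (hι : Nonempty (IsColimit (Cofan.mk Y ι))) {Z : V} (f : ∀ e, G.obj (FreeMon.cons (h e) r) ⟶ Z) :
    ∃ g : G.obj (FreeMon.cons Y r) ⟶ Z, ∀ e, G.map (consHom (ι e) (𝟙 r)) ≫ g = f e := by
  obtain ⟨hι⟩ := hι
  have := hG FreeMon.nil r J
  have hc := isColimitCofanMkObjOfIsColimit (insertAt FreeMon.nil r ⋙ G) _ _ hι
  exact ⟨Cofan.IsColimit.desc hc f, fun e => Cofan.IsColimit.fac hc f e⟩

theorem ext_cons {G : FreeMon V ⥤ V} (hG : PreservesCoproductsInEachVariable G)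
    (r : FreeMon V) {J : Type v} {h : J → V} {Y : V} (ι : ∀ e, h e ⟶ Y)
    (hι : Nonempty (IsColimit (Cofan.mk Y ι))) {Z : V} {g g' : G.obj (FreeMon.cons Y r) ⟶ Z}
    (H : ∀ e, G.map (consHom (ι e) (𝟙 r)) ≫ g = G.map (consHom (ι e) (𝟙 r)) ≫ g') : g = g' := by
  obtain ⟨hι⟩ := hι
  have := hG FreeMon.nil r J
  have hc := isColimitCofanMkObjOfIsColimit (insertAt FreeMon.nil r ⋙ G) _ _ hι
  exact Cofan.IsColimit.hom_ext hc _ _ H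

variable {h : ∀ a b, A a b → V} {Y : S → S → V}

/-- The morphism from the labels of a string to the `Y(xᵢ₋₁, xᵢ)` along its sequence of objects `p`. -/
def incl (ι : ∀ a b e, h a b e ⟶ Y a b) {a b : S} (P : Walk A a b) (p : ObjSeq a b)
    (e : P.shape = p) : labels h P ⟶ labels (fun a b (_ : PUnit.{v + 1}) => Y a b) p :=
  labelsHom (fun a => a) (fun _ _ _ => PUnit.unit) ι P ≫
    eqToHom (congrArg (labels (fun a b _ => Y a b)) e)

theorem shape_cons {a b c : S} (x : A a b) {P : Walk A b c} {p : ObjSeq b c} (e : P.shape = p) :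
    (cons x P).shape = cons PUnit.unit p :=
  congrArg (Walk.cons (A := fun _ _ : S => PUnit.{v + 1}) (a := a) PUnit.unit) e

theorem incl_cons (ι : ∀ a b e, h a b e ⟶ Y a b) {a b c : S} (x : A a b) (P : Walk A b c)
    (p : ObjSeq b c) (e : P.shape = p) :
    incl ι (cons x P) (cons PUnit.unit p) (shape_cons x e) =
      consHom (ι _ _ x) (incl ι P p e) := by
  subst e
  exact (Category.comp_id _).trans (congrArg (consHom _) (Category.comp_id _).symm)

theorem map_consHom {W : Type*} [Category* W] (G : FreeMon V ⥤ W) {X Y : V} {l m : FreeMon V}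
    (f : X ⟶ Y) (g : l ⟶ m) : G.map (consHom f g) =
      (consFunctor X ⋙ G).map g ≫ G.map (consHom f (𝟙 m)) := by
  rw [Functor.comp_map, ← G.map_comp, consHom_comp, Category.id_comp, Category.comp_id]

theorem map_consHom' {W : Type*} [Category* W] (G : FreeMon V ⥤ W) {X Y : V} {l m : FreeMon V}
    (f : X ⟶ Y) (g : l ⟶ m) : G.map (consHom f g) =
      G.map (consHom f (𝟙 l)) ≫ (consFunctor Y ⋙ G).map g := by
  rw [Functor.comp_map, ← G.map_comp, consHom_comp, Category.id_comp, Category.comp_id]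

theorem exists_desc (ι : ∀ a b e, h a b e ⟶ Y a b)
    (hι : ∀ a b, Nonempty (IsColimit (Cofan.mk (Y a b) (ι a b)))) {a b : S} (p : ObjSeq a b) :
    ∀ (G : FreeMon V ⥤ V) (_ : PreservesCoproductsInEachVariable G) {Z : V}
      (f : ∀ P : Walk A a b, G.obj (labels h P) ⟶ Z),
      ∃ g : G.obj (labels (fun a b _ => Y a b) p) ⟶ Z,
        ∀ (P : Walk A a b) (e : P.shape = p), G.map (incl ι P p e) ≫ g = f P := by
  induction p with
  | nil a =>
    intro G _ Z f
    refine ⟨f (nil a), fun P e => ?_⟩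
    cases P with
    | nil => exact (congrArg (· ≫ _) (G.map_id _)).trans (Category.id_comp _)
    | cons x P => cases e
  | @cons a b c u p ih =>
    intro G hG Z f
    choose g hg using fun x : A a b =>
      ih (consFunctor (h a b x) ⋙ G) (preserves_cons hG _) (fun P => f (cons x P))
    obtain ⟨k, hk⟩ := exists_desc_cons hG (labels (fun a b _ => Y a b) p) (ι a b) (hι a b) g
    refine ⟨k, fun P e => ?_⟩
    cases P with
    | nil => cases e
    | cons x P =>
      have e' := e
      injection e' with h1 h2 h3 h4 h5
      subst h2
      have h5 := eq_of_heq h5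
      rw [← hg x P h5, ← hk x]
      refine (congrArg (fun t => G.map t ≫ k) (incl_cons ι x P p h5)).trans ?_
      refine (congrArg (· ≫ k) (map_consHom G _ _)).trans ?_
      exact Category.assoc _ _ _

theorem desc_ext (ι : ∀ a b e, h a b e ⟶ Y a b)
    (hι : ∀ a b, Nonempty (IsColimit (Cofan.mk (Y a b) (ι a b)))) {a b : S} (p : ObjSeq a b) :
    ∀ (G : FreeMon V ⥤ V) (_ : PreservesCoproductsInEachVariable G) {Z : V}
      (g g' : G.obj (labels (fun a b _ => Y a b) p) ⟶ Z),
      (∀ (P : Walk A a b) (e : P.shape = p), G.map (incl ι P p e) ≫ g = G.map (incl ι P p e) ≫ g') →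
      g = g' := by
  induction p with
  | nil a =>
    intro G _ Z g g' H
    have := H (nil a) rfl
    exact (Category.id_comp _).symm.trans ((congrArg (· ≫ g) (G.map_id _)).symm.trans
      (this.trans ((congrArg (· ≫ g') (G.map_id _)).trans (Category.id_comp _))))
  | @cons a b c u p ih =>
    intro G hG Z g g' H
    refine ext_cons hG (labels (fun a b _ => Y a b) p) (ι a b) (hι a b) fun x => ?_
    refine ih (consFunctor (h a b x) ⋙ G) (preserves_cons hG _) _ _ fun P e => ?_
    have := H (cons x P) (shape_cons x e)
    rw [incl_cons ι x P p e] at this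
    have h2 := map_consHom G (ι a b x) (incl ι P p e)
    exact (Category.assoc _ _ _).symm.trans ((congrArg (· ≫ g) h2.symm).trans
      (this.trans ((congrArg (· ≫ g') h2).trans (Category.assoc _ _ _))))

section

variable (E : Multitensor V)

/-- The substitution of `E` at the labels of a doubly nested string. -/
def substAt (h : ∀ a b, A a b → V) {a b : S} (R : Walk (fun a b => Walk A a b) a b) :
    E.tensor.obj (labels (fun _ _ p => E.tensor.obj (labels h p)) R) ⟶
      E.tensor.obj (labels h R.concat) :=
  E.tensor.map (eqToHom (labels_labels (fun _ _ p => labels h p) E.tensor.obj R)) ≫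
    E.subst.app (labels (fun _ _ p => labels h p) R) ≫ E.tensor.map (eqToHom (labels_concat h R))

theorem comp_aux {X₀ X₁ X₂ X₃ X₄ : V} (f : X₀ ⟶ X₁) (g : X₁ ⟶ X₂) (h : X₂ ⟶ X₃) (i : X₃ ⟶ X₄) :
    f ≫ g ≫ h ≫ i = (f ≫ g ≫ h) ≫ i := by
  simp only [Category.assoc]

theorem comp_aux' {X₀ X₁ X₂ X₃ X₄ : V} {f : X₀ ⟶ X₁} {g : X₁ ⟶ X₂} {h : X₂ ⟶ X₀} {i : X₀ ⟶ X₃}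
    {j : X₃ ⟶ X₄} {k : X₀ ⟶ X₄} (H : f ≫ g ≫ h = 𝟙 X₀) (H' : i ≫ j = k) :
    f ≫ (g ≫ h ≫ i) ≫ j = k := by
  rw [Category.assoc, Category.assoc, H', comp_aux, H, Category.id_comp]

theorem eqToHom_tensor_aux (G : FreeMon V ⥤ V) {K L M N : FreeMon V} (k : K = L)
    (n : M = N) (s : G.obj L ⟶ G.obj M) (y : G.obj N = G.obj M) (x : G.obj K = G.obj L) :
    (G.map (eqToHom k) ≫ s ≫ G.map (eqToHom n)) ≫ eqToHom y = eqToHom x ≫ s := by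
  subst k n
  simp

theorem family_eqToHom (G : FreeMon V ⥤ V) {h : ∀ a b, A a b → V} {a b : S} {Z : V}
    (ι : ∀ p : Walk A a b, G.obj (labels h p) ⟶ Z) {p q : Walk A a b} (e : p = q) :
    G.map (eqToHom (congrArg (labels h) e)) ≫ ι q = ι p := by
  subst e
  rw [eqToHom_refl, G.map_id, Category.id_comp]

theorem substAt_naturality_aux {K K' N N' N₁ : FreeMon V} {L L' : FreeMon (FreeMon V)} (φ : K ⟶ K')
    (ψ : L ⟶ L') (χ : N ⟶ N₁) (k : K = (mapSeq E.tensor).obj L) (k' : K' = (mapSeq E.tensor).obj L')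
    (n : join.obj L = N) (n' : join.obj L' = N') (n₁ : N' = N₁)
    (H : φ ≫ eqToHom k' = eqToHom k ≫ (mapSeq E.tensor).map ψ)
    (H' : join.map ψ ≫ eqToHom (n'.trans n₁) = eqToHom n ≫ χ) :
    E.tensor.map φ ≫ (E.tensor.map (eqToHom k') ≫ E.subst.app L' ≫ E.tensor.map (eqToHom n')) ≫
        E.tensor.map (eqToHom n₁) =
      (E.tensor.map (eqToHom k) ≫ E.subst.app L ≫ E.tensor.map (eqToHom n)) ≫ E.tensor.map χ := by
  subst k k' n n' n₁
  have := E.subst.naturality ψ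
  simp only [eqToHom_refl, Category.comp_id, Category.id_comp,
    CategoryTheory.Functor.map_id, Functor.comp_map] at H H' this ⊢
  rw [H, ← H']
  exact (congrArg (_ ≫ ·) (Category.comp_id _)).trans
    (this.trans (congrArg (· ≫ _) (Category.comp_id _).symm))

theorem substAt_naturality (f : S → T) (c : ∀ a b, A a b → B (f a) (f b)) {h : ∀ a b, A a b → V}
    {h' : ∀ a b, B a b → V} (φ : ∀ a b e, h a b e ⟶ h' _ _ (c a b e)) {a b : S} {Z : V}
    (ι : ∀ p : Walk B (f a) (f b), E.tensor.obj (labels h' p) ⟶ Z)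
    (R : Walk (fun a b => Walk A a b) a b) :
    E.tensor.map (labelsHom (A := fun a b => Walk A a b) (B := fun a b => Walk B a b) f
        (fun _ _ p => p.map f c) (h := fun _ _ p => E.tensor.obj (labels h p))
        (h' := fun _ _ p => E.tensor.obj (labels h' p))
        (fun _ _ p => E.tensor.map (labelsHom f c φ p)) R) ≫
      substAt E h' (R.map (B := fun a b => Walk B a b) f (fun _ _ p => p.map f c)) ≫ ι _ =
    substAt E h R ≫ E.tensor.map (labelsHom f c φ R.concat) ≫ ι _ := by
  have h1 := substAt_naturality_aux E _ _ _ _ _ _ (labels_concat h' _) (congrArg (labels h') (map_concat f c R))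
    (labelsHom_labels (A := fun a b => Walk A a b) (B := fun a b => Walk B a b) E.tensor f (fun _ _ p => p.map f c) (h := fun _ _ p => labels h p)
      (h' := fun _ _ p => labels h' p) (fun _ _ p => labelsHom f c φ p) R)
    (labelsHom_concat f c φ R)
  have h2 := family_eqToHom E.tensor ι (map_concat f c R)
  refine (congrArg (fun t => _ ≫ _ ≫ t) h2.symm).trans ?_
  exact (comp_aux _ _ _ _).trans ((congrArg (· ≫ ι _) h1).trans (Category.assoc _ _ _))

theorem eqToHom_aux' {C : Type*} [Category* C] {X Y X' Y' : C} (φ : X ⟶ Y) (ψ : X' ⟶ Y')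
    (x : X = X') (y : Y = Y') (H₀ : φ ≫ eqToHom y = eqToHom x ≫ ψ) {l l' m m' : FreeMon C}
    (f : l ⟶ m) (h : m = m') (h' : l = l') (g : l' ⟶ m') (H : f ≫ eqToHom h = eqToHom h' ≫ g) :
    consHom φ f ≫ eqToHom (congrArg₂ FreeMon.cons y h) =
      eqToHom (congrArg₂ FreeMon.cons x h') ≫ consHom ψ g := by
  subst h h' x y
  simp only [eqToHom_refl, Category.comp_id, Category.id_comp] at H H₀ ⊢
  rw [H, H₀]

theorem unit_substAt (h : ∀ a b, A a b → V) {a b : S} {Z : V}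
    (ι : ∀ p : Walk A a b, E.tensor.obj (labels h p) ⟶ Z) (p : Walk A a b) :
    E.unit.app (E.tensor.obj (labels h p)) ≫
      substAt E h (cons (A := fun a b => Walk A a b) p (nil b)) ≫ ι _ = ι p := by
  have h1 := E.unit_subst (labels h p)
  have h2 := family_eqToHom E.tensor ι (append_nil p).symm
  have h3 : substAt E h (cons (A := fun a b => Walk A a b) p (nil b)) =
      E.subst.app (single.obj (labels h p)) ≫
        E.tensor.map (eqToHom (join_single (labels h p))) ≫
        E.tensor.map (eqToHom (congrArg (labels h) (append_nil p).symm)) := by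
    rw [← E.tensor.map_comp, eqToHom_trans]
    exact (congrArg (· ≫ _) (E.tensor.map_id _)).trans (Category.id_comp _)
  exact (congrArg (fun t => _ ≫ t ≫ ι _) h3).trans (comp_aux' h1 h2)

theorem labels_map_single (h : ∀ a b, A a b → V) {a b : S} (p : Walk A a b) :
    labels (fun _ _ q => labels h q)
      (p.map (B := fun a b => Walk A a b) (fun a => a) (fun _ b e => cons e (nil b))) =
    (mapSeq single).obj (labels h p) := by
  induction p with
  | nil a => rfl
  | cons e p ih => exact congrArg (FreeMon.cons _) ih

theorem labelsHom_unit (h : ∀ a b, A a b → V) {a b : S} (p : Walk A a b) :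
    ∃ (e : labels (fun _ _ q => E.tensor.obj (labels h q))
        (p.map (B := fun a b => Walk A a b) (fun a => a) (fun _ b e => cons e (nil b))) =
      (mapSeq (single ⋙ E.tensor)).obj (labels h p)),
    labelsHom (B := fun a b => Walk A a b) (fun a => a) (fun _ b e => cons e (nil b)) (h := h)
        (h' := fun _ _ q => E.tensor.obj (labels h q)) (fun a b e => E.unit.app (h a b e)) p ≫
      eqToHom e = eqToHom (map_id_obj (labels h p)).symm ≫ (mapNat E.unit).app (labels h p) := by
  induction p with
  | nil a => exact ⟨rfl, rfl⟩
  | cons x p ih =>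
    obtain ⟨e, he⟩ := ih
    exact ⟨congrArg (FreeMon.cons _) e, eqToHom_aux _ _ _ _ _ he⟩

theorem map_unit_substAt_aux {K K' N : FreeMon V} {L : FreeMon (FreeMon V)} (φ : K ⟶ K')
    (k' : K' = (mapSeq E.tensor).obj L) (n : join.obj L = N) (e₁ : L = (mapSeq single).obj K)
    (e₂ : K' = (mapSeq (single ⋙ E.tensor)).obj K)
    (H : φ ≫ eqToHom e₂ = eqToHom (map_id_obj K).symm ≫ (mapNat E.unit).app K) (e₃ : N = K) :
    E.tensor.map φ ≫ (E.tensor.map (eqToHom k') ≫ E.subst.app L ≫ E.tensor.map (eqToHom n)) ≫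
      E.tensor.map (eqToHom e₃) = 𝟙 _ := by
  subst e₁ n k'
  have h1 := E.map_unit_subst K
  have h2 : φ = eqToHom (map_id_obj K).symm ≫ (mapNat E.unit).app K ≫ eqToHom e₂.symm := by
    rw [← Category.assoc, ← H, Category.assoc, eqToHom_trans, eqToHom_refl, Category.comp_id]
  rw [h2]
  simpa using h1

theorem map_unit_substAt (h : ∀ a b, A a b → V) {a b : S} {Z : V}
    (ι : ∀ p : Walk A a b, E.tensor.obj (labels h p) ⟶ Z) (p : Walk A a b) :
    E.tensor.map (labelsHom (B := fun a b => Walk A a b) (fun a => a) (fun _ b e => cons e (nil b))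
        (h := h) (h' := fun _ _ q => E.tensor.obj (labels h q))
        (fun a b e => E.unit.app (h a b e)) p) ≫
      substAt E h (p.map (B := fun a b => Walk A a b) (fun a => a) (fun _ b e => cons e (nil b))) ≫
      ι _ = ι p := by
  obtain ⟨e, he⟩ := labelsHom_unit E h p
  have h1 := map_unit_substAt_aux E _ (labels_labels (fun _ _ p => labels h p) E.tensor.obj _)
    (labels_concat h _) (labels_map_single h p) e he (congrArg (labels h) (concat_map_single p))
  have h2 := family_eqToHom E.tensor ι (concat_map_single p)
  refine (congrArg (fun t => _ ≫ _ ≫ t) h2.symm).trans ?_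
  exact (comp_aux _ _ _ _).trans ((congrArg (· ≫ ι p) h1).trans (Category.id_comp _))

theorem labels_map_concat (h : ∀ a b, A a b → V) {a b : S}
    (R : Walk (fun a b => Walk (fun a b => Walk A a b) a b) a b) :
    labels (fun _ _ p => labels h p) (R.map (fun a => a) (fun _ _ P => concat P)) =
      (mapSeq join).obj (labels (fun _ _ P => labels (fun _ _ p => labels h p) P) R) := by
  induction R with
  | nil a => rfl
  | cons P R ih => exact congrArg₂ FreeMon.cons (labels_concat h P).symm ih

theorem labels_labels_map (h : ∀ a b, A a b → V) {a b : S}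
    (R : Walk (fun a b => Walk (fun a b => Walk A a b) a b) a b) :
    labels (fun _ _ P => labels (fun _ _ p => E.tensor.obj (labels h p)) P) R =
      (mapSeq (mapSeq E.tensor)).obj (labels (fun _ _ P => labels (fun _ _ p => labels h p) P) R) := by
  induction R with
  | nil a => rfl
  | cons P R ih =>
    exact congrArg₂ FreeMon.cons (labels_labels (fun _ _ p => labels h p) E.tensor.obj P) ih

theorem labelsHom_substAt (h : ∀ a b, A a b → V) {a b : S}
    (R : Walk (fun a b => Walk (fun a b => Walk A a b) a b) a b) :
    ∃ (e : labels (fun _ _ p => E.tensor.obj (labels h p))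
          (R.map (fun a => a) (fun _ _ P => concat P)) =
        (mapSeq (join ⋙ E.tensor)).obj
          (labels (fun _ _ P => labels (fun _ _ p => labels h p) P) R))
      (e' : labels (fun _ _ P => E.tensor.obj
          (labels (fun _ _ p => E.tensor.obj (labels h p)) P)) R =
        (mapSeq (mapSeq E.tensor ⋙ E.tensor)).obj
          (labels (fun _ _ P => labels (fun _ _ p => labels h p) P) R)),
    labelsHom (fun a => a) (fun _ _ P => concat P)
        (h := fun _ _ P => E.tensor.obj (labels (fun _ _ p => E.tensor.obj (labels h p)) P))
        (h' := fun _ _ p => E.tensor.obj (labels h p)) (fun _ _ P => substAt E h P) R ≫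
      eqToHom e = eqToHom e' ≫ (mapNat E.subst).app _ := by
  induction R with
  | nil a => exact ⟨rfl, rfl, rfl⟩
  | cons P R ih =>
    obtain ⟨e, e', he⟩ := ih
    refine ⟨_, _, eqToHom_aux' (substAt E h P) (E.subst.app (labels (fun _ _ p => labels h p) P))
      (congrArg E.tensor.obj (labels_labels (fun _ _ p => labels h p) E.tensor.obj P))
      (congrArg E.tensor.obj (labels_concat h P).symm) ?_ _ e e' _ he⟩
    exact eqToHom_tensor_aux E.tensor _ _ _ _ _

theorem substAt_assoc_aux (Z : FreeMon (FreeMon (FreeMon V))) {L₁ L₂ L₃ : FreeMon (FreeMon V)}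
    (l₁ : L₁ = (mapSeq join).obj Z) (l₂ : L₂ = (mapSeq (mapSeq E.tensor)).obj Z)
    (l₃ : L₃ = join.obj Z) {K K' M N N' : FreeMon V} (k : K = (mapSeq E.tensor).obj L₂)
    (k' : K' = (mapSeq E.tensor).obj L₁) (m : join.obj L₂ = M) (m' : M = (mapSeq E.tensor).obj L₃)
    (n : join.obj L₁ = N) (n' : join.obj L₃ = N') (φ : K ⟶ K')
    (e : K = (mapSeq (mapSeq E.tensor ⋙ E.tensor)).obj Z)
    (e' : K' = (mapSeq (join ⋙ E.tensor)).obj Z)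
    (H : φ ≫ eqToHom e' = eqToHom e ≫ (mapNat E.subst).app Z) (nn : N = N') :
    E.tensor.map φ ≫ (E.tensor.map (eqToHom k') ≫ E.subst.app L₁ ≫ E.tensor.map (eqToHom n)) ≫
      E.tensor.map (eqToHom nn) =
    (E.tensor.map (eqToHom k) ≫ E.subst.app L₂ ≫ E.tensor.map (eqToHom m)) ≫
      (E.tensor.map (eqToHom m') ≫ E.subst.app L₃ ≫ E.tensor.map (eqToHom n')) := by
  subst l₁ l₂ l₃ m n n' k k'
  have h1 := E.assoc Z
  have h2 : φ = eqToHom e ≫ (mapNat E.subst).app Z ≫ eqToHom e'.symm := by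
    rw [← Category.assoc, ← H, Category.assoc, eqToHom_trans, eqToHom_refl, Category.comp_id]
  rw [h2]
  simpa using h1.symm

theorem substAt_assoc (h : ∀ a b, A a b → V) {a b : S} {Z : V}
    (ι : ∀ p : Walk A a b, E.tensor.obj (labels h p) ⟶ Z)
    (R : Walk (fun a b => Walk (fun a b => Walk A a b) a b) a b) :
    E.tensor.map (labelsHom (fun a => a) (fun _ _ P => concat P)
        (h := fun _ _ P => E.tensor.obj (labels (fun _ _ p => E.tensor.obj (labels h p)) P))
        (h' := fun _ _ p => E.tensor.obj (labels h p)) (fun _ _ P => substAt E h P) R) ≫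
      substAt E h (R.map (fun a => a) (fun _ _ P => concat P)) ≫ ι _ =
    substAt E (fun _ _ p => E.tensor.obj (labels h p)) R ≫ substAt E h R.concat ≫ ι _ := by
  obtain ⟨e, e', he⟩ := labelsHom_substAt E h R
  have h1 := substAt_assoc_aux E _ (labels_map_concat h R) (labels_labels_map E h R)
    (labels_concat (fun _ _ p => labels h p) R).symm
    (labels_labels (fun _ _ P => labels (fun _ _ p => E.tensor.obj (labels h p)) P) E.tensor.obj R)
    (labels_labels (fun _ _ p => labels h p) E.tensor.obj _)
    (labels_concat (fun _ _ p => E.tensor.obj (labels h p)) R)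
    (labels_labels (fun _ _ p => labels h p) E.tensor.obj _)
    (labels_concat h _) (labels_concat h _) _ e' e he (congrArg (labels h) (concat_concat R))
  have h2 := family_eqToHom E.tensor ι (concat_concat R)
  refine (congrArg (fun t => _ ≫ _ ≫ t) h2.symm).trans ?_
  exact (comp_aux _ _ _ _).trans ((congrArg (· ≫ ι _) h1).trans (Category.assoc _ _ _))

end

end Walk

section Gamma

open Walk

variable {V : Type u} [Category.{v} V] [HasCoproducts.{v} V]

/-- The sequence of homs `X(x₀, x₁), …, X(xₙ₋₁, xₙ)` along a sequence of objects of `X`. -/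
abbrev EnrichedGraph.homs (X : EnrichedGraph V) {a b : X.obj} (p : ObjSeq a b) : FreeMon V :=
  labels (fun a b _ => X.hom a b) p

/-- Apply a function to a sequence of objects. -/
abbrev ObjSeq.map {S T : Type v} (f : S → T) {a b : S} (p : ObjSeq a b) : ObjSeq (f a) (f b) :=
  Walk.map f (fun _ _ _ => PUnit.unit) p

namespace Gamma

section

variable (E : FreeMon V ⥤ V)

/-- The graph `ΓE(X)`: it has the objects of `X`, and its hom from `a` to `b` is the coproduct of
`E(X(x₀, x₁), …, X(xₙ₋₁, xₙ))` over all sequences `a = x₀, …, xₙ = b` of objects of `X`. -/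
noncomputable def obj (X : EnrichedGraph V) : EnrichedGraph V where
  obj := X.obj
  hom a b := ∐ fun p : ObjSeq a b => E.obj (X.homs p)

/-- The coproduct inclusions of the homs of `ΓE(X)`. -/
noncomputable def ι (X : EnrichedGraph V) {a b : X.obj} (p : ObjSeq a b) :
    E.obj (X.homs p) ⟶ (obj E X).hom a b :=
  Sigma.ι (fun p : ObjSeq a b => E.obj (X.homs p)) p

/-- Morphisms out of a hom of `ΓE(X)`. -/
noncomputable def desc (X : EnrichedGraph V) {a b : X.obj} {Z : V}
    (f : ∀ p : ObjSeq a b, E.obj (X.homs p) ⟶ Z) : (obj E X).hom a b ⟶ Z :=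
  Sigma.desc f

theorem ι_desc (X : EnrichedGraph V) {a b : X.obj} {Z : V}
    (f : ∀ p : ObjSeq a b, E.obj (X.homs p) ⟶ Z) (p : ObjSeq a b) :
    ι E X p ≫ desc E X f = f p :=
  Sigma.ι_desc _ _

theorem hom_ext (X : EnrichedGraph V) {a b : X.obj} {Z : V} {f g : (obj E X).hom a b ⟶ Z}
    (H : ∀ p : ObjSeq a b, ι E X p ≫ f = ι E X p ≫ g) : f = g :=
  Sigma.hom_ext _ _ H

/-- The morphism of sequences of homs induced by a morphism of graphs. -/
def homsMap {X Y : EnrichedGraph V} (f : X ⟶ Y) {a b : X.obj} (p : ObjSeq a b) :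
    X.homs p ⟶ Y.homs (ObjSeq.map f.onObj p) :=
  labelsHom (A := fun _ _ => PUnit.{v + 1}) (B := fun _ _ => PUnit.{v + 1})
    (h := fun a b _ => X.hom a b) (h' := fun a b _ => Y.hom a b) f.onObj (fun _ _ _ => PUnit.unit)
    (fun a b _ => f.onHom a b) p

/-- The action of `ΓE` on morphisms is the identity on objects, and summandwise that of `E`. -/
noncomputable def map {X Y : EnrichedGraph V} (f : X ⟶ Y) : obj E X ⟶ obj E Y :=
  (⟨f.onObj, fun _ _ => desc E X fun p =>
    E.map (homsMap f p) ≫ ι E Y (ObjSeq.map f.onObj p)⟩ : EnrichedGraph.Hom (obj E X) (obj E Y))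

theorem ι_map {X Y : EnrichedGraph V} (f : X ⟶ Y) {a b : X.obj} (p : ObjSeq a b) :
    ι E X p ≫ (map E f).onHom a b = E.map (homsMap f p) ≫ ι E Y (ObjSeq.map f.onObj p) :=
  ι_desc _ _ _ _

theorem map_id_onHom (X : EnrichedGraph V) (a b : X.obj) : (map E (𝟙 X)).onHom a b = 𝟙 _ :=
  hom_ext E X fun p => (ι_map E (𝟙 X) p).trans
    ((labelsHom_id p E (fun p => ι E X p)).trans (Category.comp_id _).symm)

/-- The endofunctor `ΓE` of `GV`. -/
noncomputable def functor : EnrichedGraph V ⥤ EnrichedGraph V where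
  obj X := obj E X
  map f := map E f
  map_id X := EnrichedGraph.Hom.congr fun a b => map_id_onHom E X a b
  map_comp {X Y Z} f g := EnrichedGraph.Hom.congr fun a b => hom_ext E X fun p => by
    refine (ι_desc _ _ _ _).trans (Eq.trans ?_ (Category.assoc _ _ _))
    refine Eq.trans ?_ (congrArg (· ≫ _) (ι_map E f p).symm)
    refine Eq.trans ?_ (Category.assoc _ _ _).symm
    refine Eq.trans ?_ (congrArg (_ ≫ ·) (ι_map E g _).symm)
    exact (labelsHom_comp (A := fun _ _ => PUnit.{v + 1}) (B := fun _ _ => PUnit.{v + 1})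
      (D := fun _ _ => PUnit.{v + 1}) (h := fun a b _ => X.hom a b) (h' := fun a b _ => Y.hom a b)
      (h'' := fun a b _ => Z.hom a b) f.onObj (fun _ _ _ => PUnit.unit) (fun a b _ => f.onHom a b) g.onObj
      (fun _ _ _ => PUnit.unit) (fun a b _ => g.onHom a b) p E (fun p => ι E Z p)).symm

/-- For morphisms `h e ⟶ X(a, b)` indexed by `e ∈ A(a, b)`, the induced morphism
`E(h e₁, …, h eₙ) ⟶ E(X(x₀, x₁), …, X(xₙ₋₁, xₙ)) ⟶ ΓE(X)(x₀, xₙ)`. -/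
noncomputable def nest {X : EnrichedGraph V} {A : X.obj → X.obj → Type v} {h : ∀ a b, A a b → V}
    (i : ∀ a b e, h a b e ⟶ X.hom a b) {a b : X.obj} (P : Walk A a b) :
    E.obj (labels h P) ⟶ (obj E X).hom a b :=
  E.map (labelsHom (fun a => a) (fun _ _ _ => PUnit.unit) (h' := fun a b _ => X.hom a b) i P) ≫
    ι E X P.shape

theorem nest_comp {X Y : EnrichedGraph V} (f : X ⟶ Y) {A : X.obj → X.obj → Type v}
    {B : Y.obj → Y.obj → Type v} {h : ∀ a b, A a b → V} {h' : ∀ a b, B a b → V}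
    (i : ∀ a b e, h a b e ⟶ X.hom a b) (j : ∀ a b e, h' a b e ⟶ Y.hom a b)
    (c : ∀ a b, A a b → B (f.onObj a) (f.onObj b))
    (φ : ∀ a b e, h a b e ⟶ h' _ _ (c a b e))
    (H : ∀ a b e, i a b e ≫ f.onHom a b = φ a b e ≫ j _ _ (c a b e))
    {a b : X.obj} (P : Walk A a b) :
    nest E i P ≫ (map E f).onHom a b =
      E.map (labelsHom f.onObj c φ P) ≫ nest E j (P.map f.onObj c) := by
  refine (Category.assoc _ _ _).trans ?_
  refine (congrArg (_ ≫ ·) (ι_map E f _)).trans ?_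
  refine (labelsHom_comp (fun a => a) (fun _ _ _ => PUnit.unit) i f.onObj (fun _ _ _ => PUnit.unit)
    (h'' := fun a b _ => Y.hom a b)
    (fun a b _ => f.onHom a b) P E (fun p => ι E Y p)).trans ?_
  refine Eq.trans ?_ (labelsHom_comp f.onObj c φ (fun a => a) (fun _ _ _ => PUnit.unit) j P E
    (fun p => ι E Y p)).symm
  have : (fun a b e => i a b e ≫ f.onHom a b) = (fun a b e => φ a b e ≫ j _ _ (c a b e)) :=
    funext fun a => funext fun b => funext fun e => H a b e
  exact congrArg (fun t => E.map (labelsHom (h' := fun a b _ => Y.hom a b) f.onObj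
    (fun _ _ _ => PUnit.unit) t P) ≫ ι E Y _) this

theorem nest_map {X : EnrichedGraph V} {A B : X.obj → X.obj → Type v}
    {h : ∀ a b, A a b → V} {h' : ∀ a b, B a b → V}
    (i : ∀ a b e, h a b e ⟶ X.hom a b) (j : ∀ a b e, h' a b e ⟶ X.hom a b)
    (c : ∀ a b, A a b → B a b)
    (φ : ∀ a b e, h a b e ⟶ h' _ _ (c a b e))
    (H : ∀ a b e, i a b e = φ a b e ≫ j _ _ (c a b e))
    {a b : X.obj} (P : Walk A a b) :
    nest E i P = E.map (labelsHom (fun a => a) c φ P) ≫ nest E j (P.map (fun a => a) c) := by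
  have := nest_comp E (𝟙 X) i j c φ (fun a b e => (Category.comp_id _).trans (H a b e)) P
  refine Eq.trans ?_ this
  exact ((congrArg (nest E i P ≫ ·) (map_id_onHom E X a b)).trans (Category.comp_id _)).symm

theorem nest_id {X : EnrichedGraph V} {a b : X.obj} (p : ObjSeq a b) :
    nest E (h := fun a b _ => X.hom a b) (fun _ _ _ => 𝟙 _) p = ι E X p :=
  labelsHom_id p E (fun p => ι E X p)

variable {E}

theorem nest_desc (hE : PreservesCoproductsInEachVariable E) {X : EnrichedGraph V}
    {A : X.obj → X.obj → Type v} {h : ∀ a b, A a b → V}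
    (i : ∀ a b e, h a b e ⟶ X.hom a b)
    (hi : ∀ a b, Nonempty (IsColimit (Cofan.mk (X.hom a b) (i a b)))) (a b : X.obj) :
    Nonempty (IsColimit (Cofan.mk ((obj E X).hom a b) (fun P : Walk A a b => nest E i P))) := by
  have key : ∀ {Z : V} (f : ∀ P : Walk A a b, E.obj (labels h P) ⟶ Z),
      ∃ g : (obj E X).hom a b ⟶ Z, ∀ P, nest E i P ≫ g = f P := by
    intro Z f
    choose g hg using fun p : ObjSeq a b => exists_desc i hi p E hE f
    refine ⟨desc E X g, fun P => ?_⟩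
    refine Eq.trans ?_ (hg P.shape P rfl)
    refine (Category.assoc _ _ _).trans ((congrArg (_ ≫ ·) (ι_desc E X g _)).trans ?_)
    exact congrArg (fun t => E.map t ≫ g _) (Category.comp_id _).symm
  choose d hd using @key
  refine ⟨Cofan.IsColimit.mk _ (fun t => d t.inj) (fun t P => hd t.inj P) fun t m hm => ?_⟩
  refine hom_ext E X fun p => desc_ext i hi p E hE _ _ fun P e => ?_
  subst e
  have := (hm P).trans (hd t.inj P).symm
  refine Eq.trans ?_ (this.trans ?_)
  · exact (Category.assoc _ _ _).symm.trans (congrArg (fun t => (E.map t ≫ _) ≫ m)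
      (Category.comp_id _))
  · exact (congrArg (fun k => (E.map k ≫ ι E X _) ≫ d t.inj) (Category.comp_id _).symm).trans
      (Category.assoc _ _ _)

end

section

variable (E : Multitensor V)

theorem isColimit_ι (E : FreeMon V ⥤ V) (X : EnrichedGraph V) (a b : X.obj) :
    Nonempty (IsColimit (Cofan.mk ((obj E X).hom a b) (fun p : ObjSeq a b => ι E X p))) :=
  ⟨coproductIsCoproduct _⟩

/-- The component at `X` of the unit of `ΓE`: the identity on objects, and on homs the composite
`X(a, b) ⟶ E₁X(a, b) ⟶ ΓE(X)(a, b)` of the unit of `E` with the inclusion at `(a, b)`. -/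
noncomputable def unitApp (X : EnrichedGraph V) : X ⟶ obj E.tensor X :=
  (⟨fun a => a, fun a b => E.unit.app (X.hom a b) ≫ ι E.tensor X (cons PUnit.unit (nil b) : ObjSeq a b)⟩ :
    EnrichedGraph.Hom X (obj E.tensor X))

/-- The coproduct inclusion `k⁽²⁾` of the hom of `(ΓE)²(X)` at a doubly nested sequence of objects
of `X`, namely the composite `EᵢEⱼ X(xᵢⱼ₋₁, xᵢⱼ) ⟶ Eᵢ ΓE(X)(xᵢ₋₁, xᵢ) ⟶ (ΓE)²(X)(a, b)`. -/
noncomputable def ι₂ (X : EnrichedGraph V) {a b : X.obj} (R : Walk (fun a b : X.obj => ObjSeq a b) a b) :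
    E.tensor.obj (labels (fun _ _ p => E.tensor.obj (X.homs p)) R) ⟶
      (obj E.tensor (obj E.tensor X)).hom a b :=
  nest E.tensor (X := obj E.tensor X) (fun _ _ p => ι E.tensor X p) R

variable {E}

/-- The inclusions `k⁽²⁾` exhibit the homs of `(ΓE)²(X)` as coproducts. -/
theorem isColimit_ι₂ (hE : E.IsDistributive) (X : EnrichedGraph V) (a b : X.obj) :
    Nonempty (IsColimit (Cofan.mk ((obj E.tensor (obj E.tensor X)).hom a b)
      (fun R : Walk (fun a b : X.obj => ObjSeq a b) a b => ι₂ E X R))) :=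
  nest_desc hE (X := obj E.tensor X) _ (isColimit_ι E.tensor X) a b

/-- The component at `X` of the multiplication of `ΓE`: the identity on objects, and on homs
determined by `k⁽²⁾ ≫ μ = σ ≫ k` for each doubly nested sequence. -/
noncomputable def multApp (hE : E.IsDistributive) (X : EnrichedGraph V) :
    obj E.tensor (obj E.tensor X) ⟶ obj E.tensor X :=
  (⟨fun a => a, fun a b => Cofan.IsColimit.desc (isColimit_ι₂ hE X a b).some
    (fun R => substAt E (fun a b _ => X.hom a b) R ≫ ι E.tensor X R.concat)⟩ :
    EnrichedGraph.Hom (obj E.tensor (obj E.tensor X)) (obj E.tensor X))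

theorem ι₂_multApp (hE : E.IsDistributive) (X : EnrichedGraph V) {a b : X.obj}
    (R : Walk (fun a b : X.obj => ObjSeq a b) a b) :
    ι₂ E X R ≫ (multApp hE X).onHom a b =
      substAt E (fun a b _ => X.hom a b) R ≫ ι E.tensor X R.concat :=
  Cofan.IsColimit.fac (isColimit_ι₂ hE X a b).some _ R

theorem ι₂_hom_ext (hE : E.IsDistributive) (X : EnrichedGraph V) {a b : X.obj} {Z : V}
    {f g : (obj E.tensor (obj E.tensor X)).hom a b ⟶ Z} (H : ∀ R, ι₂ E X R ≫ f = ι₂ E X R ≫ g) :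
    f = g :=
  Cofan.IsColimit.hom_ext (isColimit_ι₂ hE X a b).some _ _ H

theorem nest_multApp (hE : E.IsDistributive) (X : EnrichedGraph V) {A : X.obj → X.obj → Type v}
    {h : ∀ a b, A a b → V} (i : ∀ a b e, h a b e ⟶ X.hom a b) {a b : X.obj}
    (R : Walk (fun a b => Walk A a b) a b) :
    nest E.tensor (X := obj E.tensor X) (fun _ _ P => nest E.tensor i P) R ≫
        (multApp hE X).onHom a b =
      substAt E h R ≫ nest E.tensor i R.concat := by
  refine (congrArg (· ≫ (multApp hE X).onHom a b)
    (nest_map E.tensor (X := obj E.tensor X) (fun _ _ P => nest E.tensor i P)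
      (fun _ _ p => ι E.tensor X p) (fun _ _ P => P.shape)
      (fun _ _ P => E.tensor.map (labelsHom (fun a => a) (fun _ _ _ => PUnit.unit)
        (h' := fun a b _ => X.hom a b) i P)) (fun _ _ _ => rfl) R)).trans ?_
  refine (Category.assoc _ _ _).trans ?_
  refine (congrArg (_ ≫ ·) (ι₂_multApp hE X _)).trans ?_
  exact substAt_naturality E (fun a => a) (fun _ _ _ => PUnit.unit) i
    (h' := fun a b _ => X.hom a b) (fun p => ι E.tensor X p) R

theorem unitApp_naturality {X Y : EnrichedGraph V} (f : X ⟶ Y) :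
    f ≫ unitApp E Y = unitApp E X ≫ map E.tensor f :=
  EnrichedGraph.Hom.congr fun a b => by
    have h1 := E.unit.naturality (f.onHom a b)
    have h2 := ι_map E.tensor f (cons PUnit.unit (nil b) : ObjSeq a b)
    refine (Category.assoc _ _ _).symm.trans ((congrArg (· ≫ _) h1).trans ?_)
    refine (Category.assoc _ _ _).trans (Eq.trans ?_ (Category.assoc _ _ _).symm)
    exact congrArg (_ ≫ ·) h2.symm

theorem multApp_naturality (hE : E.IsDistributive) {X Y : EnrichedGraph V} (f : X ⟶ Y) :
    map E.tensor (map E.tensor f) ≫ multApp hE Y = multApp hE X ≫ map E.tensor f :=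
  EnrichedGraph.Hom.congr fun a b => ι₂_hom_ext hE X fun R => by
    have h1 := nest_comp E.tensor (map E.tensor f) (B := fun a b : Y.obj => ObjSeq a b)
      (fun _ _ p => ι E.tensor X p)
      (fun _ _ p => ι E.tensor Y p) (fun _ _ p => ObjSeq.map f.onObj p)
      (fun _ _ p => E.tensor.map (homsMap f p)) (fun _ _ p => ι_map E.tensor f p) R
    have h2 := ι_map E.tensor f R.concat
    refine (Category.assoc _ _ _).symm.trans ?_
    refine (congrArg (· ≫ (multApp hE Y).onHom (f.onObj a) (f.onObj b)) h1).trans ?_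
    refine (Category.assoc _ _ _).trans ?_
    refine (congrArg (_ ≫ ·) (ι₂_multApp hE Y _)).trans ?_
    refine Eq.trans ?_ (Category.assoc _ _ _)
    refine Eq.trans ?_ (congrArg (· ≫ (map E.tensor f).onHom a b) (ι₂_multApp hE X R)).symm
    refine Eq.trans ?_ (Category.assoc _ _ _).symm
    refine Eq.trans ?_ (congrArg (_ ≫ ·) h2.symm)
    exact substAt_naturality E f.onObj (fun _ _ _ => PUnit.unit) (h := fun a b _ => X.hom a b)
      (h' := fun a b _ => Y.hom a b) (fun a b _ => f.onHom a b) (fun p => ι E.tensor Y p) R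

theorem unitApp_multApp (hE : E.IsDistributive) (X : EnrichedGraph V) :
    unitApp E (obj E.tensor X) ≫ multApp hE X = 𝟙 (obj E.tensor X) :=
  EnrichedGraph.Hom.congr fun a b => hom_ext E.tensor X fun p => by
    have h1 := E.unit.naturality (ι E.tensor X p)
    have h2 := ι₂_multApp hE X (cons (A := fun a b : X.obj => ObjSeq a b) p (nil b))
    have h3 := unit_substAt E (fun a b _ => X.hom a b) (fun p => ι E.tensor X p) p
    refine Eq.trans ?_ (h3.trans (Category.comp_id _).symm)
    refine Eq.trans ?_ (congrArg (_ ≫ ·) h2)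
    refine (congrArg (_ ≫ ·) (Category.assoc _ _ _)).trans ?_
    refine (Category.assoc _ _ _).symm.trans ((congrArg (· ≫ _) h1).trans ?_)
    refine (Category.assoc _ _ _).trans ?_
    exact congrArg (_ ≫ ·) (Category.assoc _ _ _).symm

theorem map_unitApp_multApp (hE : E.IsDistributive) (X : EnrichedGraph V) :
    map E.tensor (unitApp E X) ≫ multApp hE X = 𝟙 (obj E.tensor X) :=
  EnrichedGraph.Hom.congr fun a b => hom_ext E.tensor X fun p => by
    have h1 := nest_comp E.tensor (unitApp E X) (A := fun _ _ => PUnit.{v + 1})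
      (B := fun a b : X.obj => ObjSeq a b) (h := fun a b _ => X.hom a b) (fun _ _ _ => 𝟙 _)
      (fun _ _ p => ι E.tensor X p) (fun a b _ => (cons PUnit.unit (nil b) : ObjSeq a b))
      (fun a b _ => E.unit.app (X.hom a b)) (fun a b _ => Category.id_comp _) p
    have h2 := map_unit_substAt E (fun a b _ => X.hom a b) (fun p => ι E.tensor X p) p
    refine Eq.trans ?_ (h2.trans (Category.comp_id _).symm)
    refine (Category.assoc _ _ _).symm.trans ?_
    refine (congrArg (fun t => (t ≫ (map E.tensor (unitApp E X)).onHom a b) ≫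
      (multApp hE X).onHom a b) (nest_id E.tensor (X := X) p).symm).trans ?_
    refine (congrArg (· ≫ (multApp hE X).onHom a b) h1).trans ?_
    refine (Category.assoc _ _ _).trans ?_
    exact congrArg (_ ≫ ·) (ι₂_multApp hE X _)

theorem multApp_assoc (hE : E.IsDistributive) (X : EnrichedGraph V) :
    map E.tensor (multApp hE X) ≫ multApp hE X = multApp hE (obj E.tensor X) ≫ multApp hE X :=
  EnrichedGraph.Hom.congr fun a b => by
    obtain ⟨hc⟩ := nest_desc hE (X := obj E.tensor (obj E.tensor X))
      (A := fun a b : X.obj => Walk (fun a b : X.obj => ObjSeq a b) a b)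
      (fun _ _ P => ι₂ E X P) (isColimit_ι₂ hE X) a b
    refine Cofan.IsColimit.hom_ext hc _ _ fun R => ?_
    have h1 := nest_comp E.tensor (multApp hE X)
      (A := fun a b : X.obj => Walk (fun a b : X.obj => ObjSeq a b) a b)
      (B := fun a b : X.obj => ObjSeq a b) (fun _ _ P => ι₂ E X P)
      (fun _ _ p => ι E.tensor X p) (fun _ _ P => concat P)
      (fun _ _ P => substAt E (fun a b _ => X.hom a b) P) (fun _ _ P => ι₂_multApp hE X P) R
    have h2 := nest_multApp hE (obj E.tensor X) (A := fun a b : X.obj => ObjSeq a b)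
      (fun _ _ p => ι E.tensor X p) R
    have h3 := substAt_assoc E (fun a b _ => X.hom a b) (fun p => ι E.tensor X p) R
    refine (Category.assoc _ _ _).symm.trans ?_
    refine (congrArg (· ≫ (multApp hE X).onHom a b) h1).trans ?_
    refine (Category.assoc _ _ _).trans ?_
    refine (congrArg (_ ≫ ·) (ι₂_multApp hE X _)).trans ?_
    refine h3.trans ?_
    refine Eq.trans ?_ (Category.assoc _ _ _)
    refine Eq.trans ?_ (congrArg (· ≫ (multApp hE X).onHom a b) h2).symm
    refine Eq.trans ?_ (Category.assoc _ _ _).symm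
    exact congrArg (_ ≫ ·) (ι₂_multApp hE X _).symm

end

end Gamma

/-- The monad `ΓE` on `GV` induced by a distributive multitensor `E` on `V`. -/
noncomputable def Multitensor.gamma (E : Multitensor V) (hE : E.IsDistributive) :
    Monad (EnrichedGraph V) where
  toFunctor := Gamma.functor E.tensor
  η :=
    { app := fun X => Gamma.unitApp E X
      naturality := fun _ _ f => Gamma.unitApp_naturality f }
  μ :=
    { app := fun X => Gamma.multApp hE X
      naturality := fun _ _ f => Gamma.multApp_naturality hE f }
  assoc X := Gamma.multApp_assoc hE X
  left_unit X := Gamma.unitApp_multApp hE X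
  right_unit X := Gamma.map_unitApp_multApp hE X

end Gamma

section Properties

variable {C D : Type*} [Category* C] [Category* D]

/-- A functor is a local right adjoint when `F_X : C/X ⥤ D/FX` is a right adjoint for all `X`. -/
def IsLocalRightAdjoint (F : C ⥤ D) : Prop :=
  ∀ X : C, (Over.post (X := X) F).IsRightAdjoint

/-- Preservation of all (small) coproducts. -/
def PreservesCoproducts {C : Type*} [Category.{v} C] {D : Type*} [Category.{v} D] (F : C ⥤ D) :
    Prop :=
  ∀ J : Type v, PreservesColimitsOfShape (Discrete J) F

/-- A monad is cartesian when it preserves pullbacks and its unit and multiplication are cartesian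
transformations, i.e. all their naturality squares are pullbacks. -/
structure IsCartesianMonad (T : Monad C) : Prop where
  preservesPullbacks : PreservesLimitsOfShape WalkingCospan T.toFunctor
  unit : NatTrans.Equifibered T.η
  mult : NatTrans.Equifibered T.μ

/-- A monad is l.r.a. when it is so as a functor, and its unit and multiplication are cartesian. -/
structure IsLRAMonad (T : Monad C) : Prop where
  localRightAdjoint : IsLocalRightAdjoint T.toFunctor
  unit : NatTrans.Equifibered T.η
  mult : NatTrans.Equifibered T.μ

variable {V : Type u} [Category.{v} V]

/-- A multitensor is cartesian when `E : MV ⥤ V` preserves pullbacks and `u`, `σ` are cartesian. -/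
structure Multitensor.IsCartesian (E : Multitensor V) : Prop where
  preservesPullbacks : PreservesLimitsOfShape WalkingCospan E.tensor
  unit : NatTrans.Equifibered E.unit
  subst : NatTrans.Equifibered E.subst

/-- A multitensor is l.r.a. when `E : MV ⥤ V` is a local right adjoint and `u`, `σ` are
cartesian. -/
structure Multitensor.IsLRA (E : Multitensor V) : Prop where
  localRightAdjoint : IsLocalRightAdjoint E.tensor
  unit : NatTrans.Equifibered E.unit
  subst : NatTrans.Equifibered E.subst

/-- An object `X` is connected when the representable `V(X, -)` preserves coproducts. -/
def IsConnectedObject (X : V) : Prop := PreservesCoproducts (coyoneda.obj (op X))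

variable (V) in
/-- Every object of `V` is a coproduct of connected objects. -/
def HasConnectedDecompositions : Prop :=
  ∀ X : V, ∃ (J : Type v) (Y : J → V) (i : ∀ j, Y j ⟶ X),
    (∀ j, IsConnectedObject (Y j)) ∧ Nonempty (IsColimit (Cofan.mk X i))

/-- A category `J` is `κ`-c-filtered when every functor `A ⥤ J` with `A` connected and `κ`-small
admits a cocone. -/
def IsCardinalCFiltered (J : Type v) [SmallCategory J] (κ : Cardinal.{v}) : Prop :=
  ∀ (A : Type v) [SmallCategory A] [IsConnected A] (F : A ⥤ J),
    HasCardinalLT (Arrow A) κ → Nonempty (Cocone F)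

variable (V) in
/-- `V` is locally `κ`-c-presentable when it is cocomplete and has a (small) set of connected,
`κ`-presentable objects such that every object of `V` is a `κ`-c-filtered colimit of objects of
this set. -/
def IsLocallyCPresentable (κ : Cardinal.{v}) [Fact κ.IsRegular] : Prop :=
  HasColimitsOfSize.{v, v} V ∧ ∃ S : Set V, Small.{v} S ∧
    (∀ X ∈ S, IsConnectedObject X ∧ IsCardinalPresentable X κ) ∧
    ∀ X : V, ∃ (J : Type v) (_ : SmallCategory J) (F : J ⥤ V) (i : F ⟶ (Functor.const J).obj X),
      IsCardinalCFiltered J κ ∧ (∀ j, F.obj j ∈ S) ∧ Nonempty (IsColimit (Cocone.mk X i))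

end Properties

end EnrichedGraphMonad

/-! The homs of ΓE(X) are coproducts, over sequences t of objects of X, of E applied to the sequence
of homs along t. Taking homs along a chosen sequence is a functor `homsAt` from graphs with a
sequence of objects to MV, and it has a left adjoint with invertible unit. This sends Z to the graph
`path Z`: a line of objects with the members of Z between consecutive ones and initial homs
elsewhere (`exists_isPath`). By distributivity E is initial on any sequence with an initial member,
so E(Z) is recovered as the hom of ΓE(path Z) between the two ends (`isIso_gammaι_path`). Thus
properties can be carried from E to ΓE through coproducts, and back through path graphs.

Preservation of colimits rests on the criterion `isColimit_gamma`: ΓE preserves a colimit of graphs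
if, for every sequence t of objects of the colimit, the values of E on the homs along the lifts of t
to the diagram have the value at t as colimit. For a coproduct, t either has exactly one lift, or
has none and then passes through an initial hom. For a filtered colimit, the diagram under any one
lift is final among all lifts, and the homs along t are filtered colimits term by term, so
accessibility of E applies. Conversely, forming path graphs preserves filtered colimits, and so does
taking the hom between compatibly chosen ends (`tensor_isCardinalAccessible`).

For the cartesian and l.r.a. statements, every object of V is a coproduct of connected ones, so
every graph is generated by its objects and its edges with connected labels (`exists_edge_cover`).
An edge of ΓE(X) with connected label C is the same as a sequence t with a morphism from C to the
value of E along t (`exists_pack`, `pack_inj`); for (ΓE)² doubly nested sequences appear instead.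
Pullback squares of graphs are tested on such edges and split into two problems. The combinatorial
one is that sequences preserve pullbacks of sets and that concatenation is cartesian
(`exists_nested_lift`, `nested_map_injective`); the other is the pullback property of E, u or σ. To
return, graphs with one object detect u, and every morphism of M²V comes, up to isomorphism, from a
morphism of graphs (`exists_realization`), which detects σ.

A functor F is l.r.a. when every B ⟶ FX has an initial factorization through the image of a morphism
to X (`isLocalRightAdjoint_iff`). For ΓE one factors each connected edge by means of E and glues the
resulting path graphs along their ends. For E and connected B one factors the corresponding edge of
ΓE(path Z) and reads off a sequence; general B follow by coproducts in MV/Z. Local c-presentability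
gives the decompositions into connected objects: a colimit splits over the connected components of
its indexing category. -/

namespace EnrichedGraphMonad

open FreeMon Walk

/-! ### Graphs with chosen objects, and homs along them as functors. -/

section Shapes

/-- A functorial construction on sets. -/
structure Shape where
  carrier : Type v → Type v
  map : ∀ {S T : Type v}, (S → T) → carrier S → carrier T
  map_id : ∀ {S : Type v} (t : carrier S), map (fun a => a) t = t
  map_comp : ∀ {S T U : Type v} (f : S → T) (g : T → U) (t : carrier S),
    map (fun a => g (f a)) t = map g (map f t)

/-- An enriched graph with a chosen element of a construction on its set of objects. -/
structure Shape.El (P : Shape.{v}) (V : Type u) [Category.{v} V] where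
  graph : EnrichedGraph V
  elt : P.carrier graph.obj

variable {V : Type u} [Category.{v} V]

namespace Shape

variable (P : Shape.{v})

/-- Morphisms of graphs with elements preserve the chosen elements. -/
instance : Category.{v} (P.El V) where
  Hom x y := { f : x.graph ⟶ y.graph // P.map f.onObj x.elt = y.elt }
  id x := ⟨𝟙 x.graph, P.map_id _⟩
  comp f g := ⟨f.1 ≫ g.1, (P.map_comp f.1.onObj g.1.onObj _).trans ((congrArg _ f.2).trans g.2)⟩

variable {P}

theorem El.hom_ext {x y : P.El V} {f g : x ⟶ y} (h : f.1 = g.1) : f = g := Subtype.ext h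

/-- A morphism of graphs, as a morphism onto the image of a given element. -/
def El.push {X Y : EnrichedGraph V} (f : X ⟶ Y) (t : P.carrier X.obj) :
    (⟨X, t⟩ : P.El V) ⟶ ⟨Y, P.map f.onObj t⟩ := ⟨f, rfl⟩

-- The element of the target is a free variable, so the equation it satisfies can be substituted.
-- Functoriality and naturality then need checking only where the identifications of endpoints are
-- trivial.
@[elab_as_elim]
theorem El.hom_rec {x : P.El V} {motive : ∀ y : P.El V, (x ⟶ y) → Prop}
    (push : ∀ (Y : EnrichedGraph V) (f : x.graph ⟶ Y), motive _ (El.push f x.elt)) {y : P.El V}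
    (f : x ⟶ y) : motive y f := by
  obtain ⟨Y, y⟩ := y
  obtain ⟨f, h⟩ := f
  change x.graph ⟶ Y at f
  change P.map f.onObj x.elt = y at h
  subst h
  exact push Y f

end Shape

/-- Ordered pairs. -/
abbrev pairs : Shape.{v} where
  carrier S := S × S
  map f t := (f t.1, f t.2)
  map_id _ := rfl
  map_comp _ _ _ := rfl

theorem walk_map_id {S : Type v} : ∀ {a b : S} (p : ObjSeq a b), ObjSeq.map (fun a => a) p = p
  | _, _, .nil _ => rfl
  | a, _, .cons _ p =>
    congrArg (Walk.cons (A := fun _ _ : S => PUnit.{v + 1}) (a := a) PUnit.unit) (walk_map_id p)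

theorem walk_map_map {S T U : Type v} (f : S → T) (g : T → U) : ∀ {a b : S} (p : ObjSeq a b),
    ObjSeq.map (fun a => g (f a)) p = ObjSeq.map g (ObjSeq.map f p)
  | _, _, .nil _ => rfl
  | a, _, .cons _ p =>
    congrArg (Walk.cons (A := fun _ _ : U => PUnit.{v + 1}) (a := g (f a)) PUnit.unit)
      (walk_map_map f g p)

/-- Apply a function to a doubly nested sequence. -/
abbrev nestedMap {S T : Type v} (f : S → T) {a b : S} (R : Walk (fun a b : S => ObjSeq a b) a b) :
    Walk (fun a b : T => ObjSeq a b) (f a) (f b) :=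
  R.map f (fun _ _ p => ObjSeq.map f p)

theorem nestedMap_id {S : Type v} : ∀ {a b : S} (R : Walk (fun a b : S => ObjSeq a b) a b),
    nestedMap (fun a => a) R = R
  | _, _, .nil _ => rfl
  | _, _, .cons p R => congrArg₂ Walk.cons (walk_map_id p) (nestedMap_id R)

theorem nestedMap_nestedMap {S T U : Type v} (f : S → T) (g : T → U) :
    ∀ {a b : S} (R : Walk (fun a b : S => ObjSeq a b) a b),
    nestedMap (fun a => g (f a)) R = nestedMap g (nestedMap f R)
  | _, _, .nil _ => rfl
  | _, _, .cons p R => congrArg₂ Walk.cons (walk_map_map f g p) (nestedMap_nestedMap f g R)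

/-- Finite non-empty sequences. -/
abbrev walks : Shape.{v} where
  carrier S := Σ a b : S, ObjSeq a b
  map f t := ⟨f t.1, f t.2.1, ObjSeq.map f t.2.2⟩
  map_id t := congrArg (fun p => (⟨t.1, t.2.1, p⟩ : Σ a b, ObjSeq a b)) (walk_map_id t.2.2)
  map_comp f g t := congrArg (fun p => (⟨g (f t.1), g (f t.2.1), p⟩ : Σ a b, ObjSeq a b))
    (walk_map_map f g t.2.2)

/-- Doubly nested sequences. -/
abbrev nested : Shape.{v} where
  carrier S := Σ a b : S, Walk (fun a b : S => ObjSeq a b) a b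
  map f t := ⟨f t.1, f t.2.1, nestedMap f t.2.2⟩
  map_id t := congrArg
    (fun p => (⟨t.1, t.2.1, p⟩ : Σ a b, Walk (fun a b => ObjSeq a b) a b)) (nestedMap_id t.2.2)
  map_comp f g t := congrArg
    (fun p => (⟨g (f t.1), g (f t.2.1), p⟩ : Σ a b, Walk (fun a b => ObjSeq a b) a b))
    (nestedMap_nestedMap f g t.2.2)

/-- The hom of a graph at a pair of objects. -/
def homAt : pairs.El V ⥤ V where
  obj x := x.graph.hom x.elt.1 x.elt.2
  map {x y} f := f.1.onHom x.elt.1 x.elt.2 ≫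
    eqToHom (congrArg (fun t : y.graph.obj × y.graph.obj => y.graph.hom t.1 t.2) f.2)
  map_id x := Category.comp_id (𝟙 (x.graph.hom x.elt.1 x.elt.2))
  map_comp {x y z} f g := by
    induction f using Shape.El.hom_rec with | _ Y f
    induction g using Shape.El.hom_rec with | _ Z g
    exact (Category.comp_id _).trans
      (congrArg₂ (· ≫ ·) (Category.comp_id _).symm (Category.comp_id _).symm)

theorem homAt_map_push {X Y : EnrichedGraph V} (f : X ⟶ Y) (a b : X.obj) :
    homAt.map (Shape.El.push (P := pairs) f (a, b)) = f.onHom a b := Category.comp_id _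

theorem nil_hom_ext {l : FreeMon V} (f g : (nil : FreeMon V) ⟶ l) : f = g := by
  cases l with
  | nil => rfl
  | cons => exact PEmpty.elim f

/-- Mapping a sequence along the identity returns it only propositionally, hence the `eqToHom`;
`eqToHom_aux` carries the identification past each member. -/
theorem homsMap_id (X : EnrichedGraph V) {a b : X.obj} (p : ObjSeq a b) :
    Gamma.homsMap (𝟙 X) p ≫ eqToHom (congrArg X.homs (walk_map_id p)) = 𝟙 (X.homs p) := by
  induction p with
  | nil => exact nil_hom_ext _ _
  | cons e p ih =>
    refine (eqToHom_aux (𝟙 _) (Gamma.homsMap (𝟙 X) p) (congrArg X.homs (walk_map_id p)) rfl (𝟙 _)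
      (ih.trans (Category.comp_id _).symm)).trans (Category.id_comp _)

theorem homsMap_comp {X Y Z : EnrichedGraph V} (f : X ⟶ Y) (g : Y ⟶ Z) {a b : X.obj}
    (p : ObjSeq a b) :
    Gamma.homsMap (f ≫ g) p ≫ eqToHom (congrArg Z.homs (walk_map_map f.onObj g.onObj p)) =
      Gamma.homsMap f p ≫ Gamma.homsMap g (ObjSeq.map f.onObj p) := by
  induction p with
  | nil => exact nil_hom_ext _ _
  | cons e p ih =>
    exact (eqToHom_aux _ (Gamma.homsMap (f ≫ g) p)
      (congrArg Z.homs (walk_map_map f.onObj g.onObj p)) rfl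
      (Gamma.homsMap f p ≫ Gamma.homsMap g (ObjSeq.map f.onObj p))
      (ih.trans (Category.id_comp _).symm)).trans (Category.id_comp _)

/-- The sequence of homs of a graph along a sequence of objects. -/
def homsAt : walks.El V ⥤ FreeMon V where
  obj x := x.graph.homs x.elt.2.2
  map {x y} f := Gamma.homsMap f.1 x.elt.2.2 ≫
    eqToHom (congrArg (fun t : walks.carrier y.graph.obj => y.graph.homs t.2.2) f.2)
  map_id x := homsMap_id x.graph x.elt.2.2
  map_comp {x y z} f g := by
    induction f using Shape.El.hom_rec with | _ Y f
    induction g using Shape.El.hom_rec with | _ Z g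
    exact (homsMap_comp f g x.elt.2.2).trans
      (congrArg₂ (· ≫ ·) (Category.comp_id _).symm (Category.comp_id _).symm)

theorem homsAt_map_push {X Y : EnrichedGraph V} (f : X ⟶ Y) (t : walks.carrier X.obj) :
    homsAt.map (Shape.El.push (P := walks) f t) = Gamma.homsMap f t.2.2 := Category.comp_id _

/-- The doubly nested sequence of homs of a graph along a doubly nested sequence of objects. -/
abbrev EnrichedGraph.nestedHoms (X : EnrichedGraph V) {a b : X.obj}
    (R : Walk (fun a b : X.obj => ObjSeq a b) a b) : FreeMon (FreeMon V) :=
  labels (fun _ _ p => X.homs p) R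

/-- The morphism of doubly nested sequences of homs induced by a morphism of graphs. -/
def nestedHomsMap {X Y : EnrichedGraph V} (f : X ⟶ Y) {a b : X.obj}
    (R : Walk (fun a b : X.obj => ObjSeq a b) a b) :
    X.nestedHoms R ⟶ Y.nestedHoms (nestedMap f.onObj R) :=
  labelsHom (A := fun a b : X.obj => ObjSeq a b) (B := fun a b : Y.obj => ObjSeq a b) f.onObj
    (fun _ _ p => ObjSeq.map f.onObj p) (h := fun _ _ p => X.homs p) (h' := fun _ _ p => Y.homs p)
    (fun _ _ p => Gamma.homsMap f p) R

theorem nestedHomsMap_id (X : EnrichedGraph V) {a b : X.obj}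
    (R : Walk (fun a b : X.obj => ObjSeq a b) a b) :
    nestedHomsMap (𝟙 X) R ≫ eqToHom (congrArg X.nestedHoms (nestedMap_id R)) =
      𝟙 (X.nestedHoms R) := by
  induction R with
  | nil => exact nil_hom_ext _ _
  | cons p R ih =>
    exact (eqToHom_aux' (Gamma.homsMap (𝟙 X) p) (𝟙 _) rfl (congrArg X.homs (walk_map_id p))
      ((homsMap_id X p).trans (Category.comp_id _).symm) (nestedHomsMap (𝟙 X) R)
      (congrArg X.nestedHoms (nestedMap_id R)) rfl (𝟙 _)
      (ih.trans (Category.comp_id _).symm)).trans (Category.id_comp _)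

theorem nestedHomsMap_comp {X Y Z : EnrichedGraph V} (f : X ⟶ Y) (g : Y ⟶ Z) {a b : X.obj}
    (R : Walk (fun a b : X.obj => ObjSeq a b) a b) :
    nestedHomsMap (f ≫ g) R ≫
        eqToHom (congrArg Z.nestedHoms (nestedMap_nestedMap f.onObj g.onObj R)) =
      nestedHomsMap f R ≫ nestedHomsMap g (nestedMap f.onObj R) := by
  induction R with
  | nil => exact nil_hom_ext _ _
  | cons p R ih =>
    exact (eqToHom_aux' (Gamma.homsMap (f ≫ g) p)
      (Gamma.homsMap f p ≫ Gamma.homsMap g (ObjSeq.map f.onObj p)) rfl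
      (congrArg Z.homs (walk_map_map f.onObj g.onObj p))
      ((homsMap_comp f g p).trans (Category.id_comp _).symm) (nestedHomsMap (f ≫ g) R)
      (congrArg Z.nestedHoms (nestedMap_nestedMap f.onObj g.onObj R)) rfl
      (nestedHomsMap f R ≫ nestedHomsMap g (nestedMap f.onObj R))
      (ih.trans (Category.id_comp _).symm)).trans (Category.id_comp _)

/-- The doubly nested sequence of homs of a graph along a doubly nested sequence of objects,
as a functor. -/
def nestedHomsAt : nested.El V ⥤ FreeMon (FreeMon V) where
  obj x := x.graph.nestedHoms x.elt.2.2
  map {x y} f := nestedHomsMap f.1 x.elt.2.2 ≫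
    eqToHom (congrArg (fun t : nested.carrier y.graph.obj => y.graph.nestedHoms t.2.2) f.2)
  map_id x := nestedHomsMap_id x.graph x.elt.2.2
  map_comp {x y z} f g := by
    induction f using Shape.El.hom_rec with | _ Y f
    induction g using Shape.El.hom_rec with | _ Z g
    exact (nestedHomsMap_comp f g x.elt.2.2).trans
      (congrArg₂ (· ≫ ·) (Category.comp_id _).symm (Category.comp_id _).symm)

theorem nestedHomsAt_map_push {X Y : EnrichedGraph V} (f : X ⟶ Y) (t : nested.carrier X.obj) :
    nestedHomsAt.map (Shape.El.push (P := nested) f t) = nestedHomsMap f t.2.2 :=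
  Category.comp_id _

theorem comp_eqToHom_move {C : Type*} [Category* C] {X Y Z W : C} {f : X ⟶ Y} {h : Y = Z}
    {g : X ⟶ Z} (H : f ≫ eqToHom h = g) (e : Z = W) (h' : Y = W) :
    f ≫ eqToHom h' = g ≫ eqToHom e := by
  subst e; rw [← H]; simp

/-- Concatenation, on doubly nested sequences with their objects. -/
def concatEl {S : Type v} (R : nested.carrier S) : walks.carrier S := ⟨R.1, R.2.1, R.2.2.concat⟩

theorem map_concatEl {S T : Type v} (f : S → T) (R : nested.carrier S) :
    walks.map f (concatEl R) = concatEl (nested.map f R) :=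
  congrArg (fun p => (⟨f R.1, f R.2.1, p⟩ : Σ a b, ObjSeq a b))
    (map_concat (A := fun _ _ => PUnit) (B := fun _ _ => PUnit) f (fun _ _ _ => PUnit.unit)
      R.2.2).symm

/-- Concatenation, as a functor on graphs with doubly nested sequences. -/
def concatFunctor : nested.El V ⥤ walks.El V where
  obj x := ⟨x.graph, concatEl x.elt⟩
  map f := ⟨f.1, (map_concatEl _ _).trans (congrArg concatEl f.2)⟩

/-- Homs along a concatenation are concatenations of the sequences of homs. -/
def nestedHomsJoin : nestedHomsAt (V := V) ⋙ join ≅ concatFunctor ⋙ homsAt :=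
  NatIso.ofComponents (fun x => eqToIso (labels_concat _ x.elt.2.2)) (by
    intro x y f
    induction f using Shape.El.hom_rec with | _ Y f
    obtain ⟨X, x⟩ := x
    have h := labelsHom_concat (A := fun _ _ : X.obj => PUnit.{v + 1})
      (B := fun _ _ : Y.obj => PUnit.{v + 1}) (h := fun a b _ => X.hom a b)
      (h' := fun a b _ => Y.hom a b) f.onObj (fun _ _ _ => PUnit.unit) (fun a b _ => f.onHom a b)
      x.2.2
    exact (congrArg (fun t => join.map t ≫ _) (nestedHomsAt_map_push f x)).trans
      ((comp_eqToHom_move h _ (labels_concat _ _)).trans (Category.assoc _ _ _)))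

end Shapes

/-! ### Combinatorics of sequences: pullbacks and concatenation. -/

section Sequences

variable {S T : Type v}

/-- The sequence with a single member. -/
def nilT (a : S) : walks.carrier S := ⟨a, a, .nil a⟩

/-- Prepend a member to a sequence. -/
def consT (a : S) (t : walks.carrier S) : walks.carrier S := ⟨a, t.2.1, .cons PUnit.unit t.2.2⟩

-- Induction in the total type, where the endpoints vary with the sequence, keeps equations between
-- mapped sequences free of casts.
@[elab_as_elim]
theorem walks_rec {motive : walks.carrier S → Prop} (nil : ∀ a, motive (nilT a))
    (cons : ∀ a t, motive t → motive (consT a t)) (t : walks.carrier S) : motive t := by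
  obtain ⟨a, b, p⟩ := t
  induction p with
  | nil a => exact nil a
  | cons e p ih => exact cons _ _ ih

theorem consT_inj {a b : S} {t s : walks.carrier S} (h : consT a t = consT b s) :
    a = b ∧ t = s := by
  obtain ⟨a', b', p⟩ := t
  obtain ⟨c', d', q⟩ := s
  unfold consT at h
  cases h
  exact ⟨rfl, rfl⟩

theorem nilT_inj {a b : S} (h : nilT a = nilT b) : a = b := congrArg (fun t => t.1) h

theorem nilT_ne_consT {a b : S} {t : walks.carrier S} : nilT a ≠ consT b t := by
  obtain ⟨a', b', p⟩ := t
  unfold nilT consT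
  intro h
  cases h

theorem map_nilT_ne {A U : Type v} {f : S → U} {g : A → U} {a : S} {b : A} {t : walks.carrier A} :
    walks.map f (nilT a) ≠ walks.map g (consT b t) :=
  nilT_ne_consT (a := f a) (b := g b) (t := walks.map g t)

theorem map_consT_inj {A U : Type v} {f : S → U} {g : A → U} {a : S} {t : walks.carrier S} {b : A}
    {s : walks.carrier A} (h : walks.map f (consT a t) = walks.map g (consT b s)) :
    f a = g b ∧ walks.map f t = walks.map g s :=
  consT_inj (t := walks.map f t) (s := walks.map g s) h

/-- Sequences with the same image have the same length and are compared member by member. With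
`exists_walks_lift` this says that forming sequences preserves pullbacks of sets. -/
theorem walks_map_injective {A B : Type v} {f : S → A} {g : S → B}
    (H : ∀ s s', f s = f s' → g s = g s' → s = s') (t t' : walks.carrier S)
    (h₁ : walks.map f t = walks.map f t') (h₂ : walks.map g t = walks.map g t') : t = t' := by
  induction t using walks_rec generalizing t' with
  | nil a =>
    induction t' using walks_rec with
    | nil b => exact congrArg nilT (H _ _ (nilT_inj h₁) (nilT_inj h₂))
    | cons b t' => exact absurd h₁ map_nilT_ne
  | cons a t ih =>
    induction t' using walks_rec with
    | nil b => exact absurd h₁.symm map_nilT_ne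
    | cons b t' =>
      exact congrArg₂ consT (H _ _ (map_consT_inj h₁).1 (map_consT_inj h₂).1)
        (ih t' (map_consT_inj h₁).2 (map_consT_inj h₂).2)

theorem exists_walks_lift {A B C : Type v} {f : S → A} {g : S → B} {h : A → C} {k : B → C}
    (H : ∀ x y, h x = k y → ∃ s, f s = x ∧ g s = y) (t : walks.carrier A) (t' : walks.carrier B)
    (e : walks.map h t = walks.map k t') : ∃ s, walks.map f s = t ∧ walks.map g s = t' := by
  induction t using walks_rec generalizing t' with
  | nil a =>
    induction t' using walks_rec with
    | nil b =>
      obtain ⟨s, rfl, rfl⟩ := H _ _ (nilT_inj e)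
      exact ⟨nilT s, rfl, rfl⟩
    | cons b t' => exact absurd e map_nilT_ne
  | cons a t ih =>
    induction t' using walks_rec with
    | nil b => exact absurd e.symm map_nilT_ne
    | cons b t' =>
      obtain ⟨s, rfl, rfl⟩ := H _ _ (map_consT_inj e).1
      obtain ⟨r, rfl, rfl⟩ := ih t' (map_consT_inj e).2
      exact ⟨consT s r, rfl, rfl⟩

/-- Mapping preserves lengths, so `t` can be cut at the place where `p'` ends. -/
theorem exists_append_of_map (f : S → T) {a b : T} (p' : ObjSeq a b) :
    ∀ {c : T} (q' : ObjSeq b c) (t : walks.carrier S),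
      walks.map f t = ⟨a, c, p'.append q'⟩ →
      ∃ (a₀ b₀ c₀ : S) (p : ObjSeq a₀ b₀) (q : ObjSeq b₀ c₀), t = ⟨a₀, c₀, p.append q⟩ ∧
        (⟨f a₀, f b₀, ObjSeq.map f p⟩ : walks.carrier T) = ⟨a, b, p'⟩ ∧
        (⟨f b₀, f c₀, ObjSeq.map f q⟩ : walks.carrier T) = ⟨b, c, q'⟩ := by
  induction p' with
  | nil a => exact fun q' t h => ⟨t.1, t.1, t.2.1, .nil _, t.2.2, rfl,
      congrArg (fun s : walks.carrier T => (nilT s.1 : walks.carrier T)) h, h⟩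
  | @cons a b c e p' ih =>
    intro d q' t h
    induction t using walks_rec with
    | nil x =>
      exact absurd (show nilT (f x) = consT a ⟨b, d, p'.append q'⟩ from h) nilT_ne_consT
    | cons x t =>
      obtain ⟨h1, h2⟩ := consT_inj (show consT (f x) (walks.map f t) =
        consT a ⟨b, d, p'.append q'⟩ from h)
      obtain ⟨a₀, b₀, c₀, p, q, rfl, hp, hq⟩ := ih q' t h2
      refine ⟨x, b₀, c₀, .cons PUnit.unit p, q, rfl, ?_, hq⟩
      exact congrArg₂ consT h1 hp

/-- The common image of `p` and `p'` fixes their common length, and a sequence can be cut in only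
one way at a given place. -/
theorem append_injective_of_map (f : S → T) {a b : S} (p : ObjSeq a b) :
    ∀ {c : S} (q : ObjSeq b c) {b' c' : S} (p' : ObjSeq a b') (q' : ObjSeq b' c'),
      (⟨f a, f b, ObjSeq.map f p⟩ : walks.carrier T) = ⟨f a, f b', ObjSeq.map f p'⟩ →
      (⟨a, c, p.append q⟩ : walks.carrier S) = ⟨a, c', p'.append q'⟩ →
      (⟨a, b, p⟩ : walks.carrier S) = ⟨a, b', p'⟩ ∧
        (⟨b, c, q⟩ : walks.carrier S) = ⟨b', c', q'⟩ := by
  induction p with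
  | nil a =>
    intro c q b' c' p' q' h h'
    cases p' with
    | nil => exact ⟨rfl, h'⟩
    | @cons _ d _ e p' =>
      exact absurd (show nilT (f a) = consT (f a) ⟨f d, f b', ObjSeq.map f p'⟩ from h) nilT_ne_consT
  | @cons a b d e p ih =>
    intro c q b' c' p' q' h h'
    cases p' with
    | nil =>
      exact absurd (show nilT (f a) = consT (f a) ⟨f b, f d, ObjSeq.map f p⟩ from h.symm)
        nilT_ne_consT
    | @cons _ y _ e' p' =>
      have h2 := (consT_inj (show consT (f a) ⟨f b, f d, ObjSeq.map f p⟩ =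
        consT (f a) ⟨f y, f b', ObjSeq.map f p'⟩ from h)).2
      have h3 := (consT_inj (show consT a ⟨b, c, p.append q⟩ =
        consT a ⟨y, c', p'.append q'⟩ from h')).2
      have h4 : b = y := congrArg (fun t => t.1) h3
      subst h4
      obtain ⟨h5, h6⟩ := ih q p' q' h2 h3
      exact ⟨congrArg (consT a) h5, h6⟩

/-- Prepend a sequence to a doubly nested sequence. -/
def consN {a b c : S} (p : ObjSeq a b) (R : Walk (fun a b : S => ObjSeq a b) b c) :
    nested.carrier S := ⟨a, c, .cons p R⟩

theorem consN_congr {a b c a' b' c' : S} {p : ObjSeq a b}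
    {R : Walk (fun a b : S => ObjSeq a b) b c} {p' : ObjSeq a' b'}
    {R' : Walk (fun a b : S => ObjSeq a b) b' c'} (h : (⟨a, b, p⟩ : walks.carrier S) = ⟨a', b', p'⟩)
    (h' : (⟨b, c, R⟩ : nested.carrier S) = ⟨b', c', R'⟩) : consN p R = consN p' R' := by
  cases h
  cases h'
  rfl

theorem consN_inj {a b c a' b' c' : S} {p : ObjSeq a b}
    {R : Walk (fun a b : S => ObjSeq a b) b c} {p' : ObjSeq a' b'}
    {R' : Walk (fun a b : S => ObjSeq a b) b' c'} (h : consN p R = consN p' R') :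
    (⟨a, b, p⟩ : walks.carrier S) = ⟨a', b', p'⟩ ∧
      (⟨b, c, R⟩ : nested.carrier S) = ⟨b', c', R'⟩ := by
  unfold consN at h
  cases h
  exact ⟨rfl, rfl⟩

theorem nil_ne_consN {a' a b c : S} {p : ObjSeq a b} {R : Walk (fun a b : S => ObjSeq a b) b c} :
    (⟨a', a', .nil a'⟩ : nested.carrier S) ≠ consN p R := by
  unfold consN
  intro h
  cases h

/-- Cut `t` after the first inner sequence of `R'` and continue with the rest. This is the existence
half of the statement that concatenation is a cartesian transformation; `nested_map_injective` is
the uniqueness half. -/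
theorem exists_nested_lift (f : S → T) {a b : T} (R' : Walk (fun a b : T => ObjSeq a b) a b) :
    ∀ t : walks.carrier S, walks.map f t = concatEl ⟨a, b, R'⟩ →
      ∃ R : nested.carrier S, nested.map f R = ⟨a, b, R'⟩ ∧ concatEl R = t := by
  induction R' with
  | nil a =>
    intro t h
    induction t using walks_rec with
    | nil x =>
      have : f x = a := nilT_inj h
      subst this
      exact ⟨⟨x, x, .nil x⟩, rfl, rfl⟩
    | cons x t =>
      exact absurd (show nilT a = consT (f x) (walks.map f t) from h.symm) nilT_ne_consT
  | @cons a b c p' R' ih =>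
    intro t h
    obtain ⟨a₀, b₀, c₀, p, q, rfl, hp, hq⟩ := exists_append_of_map f p' R'.concat t h
    obtain ⟨⟨x, y, R⟩, h1, h2⟩ := ih ⟨b₀, c₀, q⟩ hq
    have h4 : x = b₀ := congrArg (fun t => t.1) h2
    subst h4
    have h5 : y = c₀ := congrArg (fun t => t.2.1) h2
    subst h5
    have h6 : R.concat = q := by
      have := h2
      unfold concatEl at this
      simpa using this
    subst h6
    exact ⟨consN p R, consN_congr hp h1, rfl⟩

/-- The common image fixes the lengths of the inner sequences, hence the places at which the common
concatenation is cut. -/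
theorem nested_map_injective (f : S → T) {a b : S} (R : Walk (fun a b : S => ObjSeq a b) a b) :
    ∀ R' : nested.carrier S, nested.map f ⟨a, b, R⟩ = nested.map f R' →
      concatEl ⟨a, b, R⟩ = concatEl R' → (⟨a, b, R⟩ : nested.carrier S) = R' := by
  induction R with
  | nil a =>
    rintro ⟨a', b', R'⟩ h h'
    cases R' with
    | nil =>
      have : a = a' := nilT_inj h'
      subst this
      rfl
    | @cons _ y _ p' R' =>
      exact absurd (show (⟨f a, f a, .nil (f a)⟩ : nested.carrier T) =
        consN (ObjSeq.map f p') (nestedMap f R') from h) nil_ne_consN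
  | @cons a b c p R ih =>
    rintro ⟨a', b', R'⟩ h h'
    have h4 : a = a' := congrArg (fun t => t.1) h'
    subst h4
    cases R' with
    | nil =>
      exact absurd (show (⟨f a, f a, .nil (f a)⟩ : nested.carrier T) =
        consN (ObjSeq.map f p) (nestedMap f R) from h.symm) nil_ne_consN
    | @cons _ y _ p' R' =>
      obtain ⟨h1, h2⟩ := consN_inj (show consN (ObjSeq.map f p) (nestedMap f R) =
        consN (ObjSeq.map f p') (nestedMap f R') from h)
      obtain ⟨h5, h6⟩ := append_injective_of_map f p R.concat p' R'.concat h1 h'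
      exact consN_congr h5 (ih ⟨_, _, R'⟩ h2 h6)

end Sequences

/-! ### Equality of graph morphisms, and graphs freely generated over a set of objects. -/

section Graphs

variable {V : Type u} [Category.{v} V]

theorem homsAt_map_consT {X Y : EnrichedGraph V} (f : X ⟶ Y) {a : X.obj} {t : walks.carrier X.obj}
    {b : Y.obj} {s : walks.carrier Y.obj} (h : f.onObj a = b) (h' : walks.map f.onObj t = s) :
    homsAt.map (⟨f, congrArg₂ consT h h'⟩ :
        (⟨X, consT a t⟩ : walks.El V) ⟶ ⟨Y, consT b s⟩) =
      consHom (homAt.map (⟨f, congrArg₂ Prod.mk h (congrArg (fun s => s.1) h')⟩ :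
        (⟨X, (a, t.1)⟩ : pairs.El V) ⟶ ⟨Y, (b, s.1)⟩))
      (homsAt.map (⟨f, h'⟩ : (⟨X, t⟩ : walks.El V) ⟶ ⟨Y, s⟩)) := by
  subst h h'
  refine (homsAt_map_push f (consT a t)).trans ?_
  exact congrArg₂ consHom (homAt_map_push f a t.1).symm (homsAt_map_push f t).symm

theorem graph_hom_ext {X Y : EnrichedGraph V} {f g : X ⟶ Y} (h : ∀ a, f.onObj a = g.onObj a)
    (h' : ∀ a b, f.onHom a b ≫ eqToHom (congrArg₂ Y.hom (h a) (h b)) = g.onHom a b) : f = g := by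
  obtain ⟨o, φ⟩ := f
  obtain ⟨o', ψ⟩ := g
  obtain rfl : o = o' := funext h
  exact EnrichedGraph.Hom.congr fun a b => (Category.comp_id _).symm.trans (h' a b)

theorem onHom_congr {X Y : EnrichedGraph V} {f g : X ⟶ Y} (h : f = g) (a b : X.obj) :
    f.onHom a b ≫ eqToHom (congrArg (fun k : X ⟶ Y => Y.hom (k.onObj a) (k.onObj b)) h) =
      g.onHom a b := by
  subst h
  exact Category.comp_id _

/-- A family of morphisms `G k ⟶ A` exhibits `A` as freely obtained from the graphs `G k` and its
own set of objects. -/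
structure IsPush {K : Type v} (G : K → EnrichedGraph V) (A : EnrichedGraph V)
    (j : ∀ k, G k ⟶ A) : Prop where
  exists_lift : ∀ (W : EnrichedGraph V) (ν : A.obj → W.obj) (m : ∀ k, G k ⟶ W),
    (∀ k x, (m k).onObj x = ν ((j k).onObj x)) →
      ∃ τ : A ⟶ W, (∀ x, τ.onObj x = ν x) ∧ ∀ k, j k ≫ τ = m k
  hom_ext : ∀ (W : EnrichedGraph V) (τ τ' : A ⟶ W), (∀ x, τ.onObj x = τ'.onObj x) →
    (∀ k, j k ≫ τ = j k ≫ τ') → τ = τ'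

/-- The hom from `x` to `y` is the coproduct of all homs of the given graphs between objects which
`q` sends to `x` and `y`. Members of `N` outside the images remain as objects, with initial homs. -/
theorem exists_isPush [HasCoproducts.{v} V] {K : Type v} (G : K → EnrichedGraph V) {N : Type v}
    (q : ∀ k, (G k).obj → N) :
    ∃ (h : N → N → V) (j : ∀ k, G k ⟶ ⟨N, h⟩),
      (∀ k x, (j k).onObj x = q k x) ∧ IsPush G ⟨N, h⟩ j := by
  let I (x y : N) := { e : Σ k, (G k).obj × (G k).obj // q e.1 e.2.1 = x ∧ q e.1 e.2.2 = y }
  let h (x y : N) : V := ∐ fun e : I x y => (G e.1.1).hom e.1.2.1 e.1.2.2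
  let j (k : K) : EnrichedGraph.Hom (G k) ⟨N, h⟩ :=
    ⟨q k, fun a b => Sigma.ι (fun e : I (q k a) (q k b) => (G e.1.1).hom e.1.2.1 e.1.2.2)
      ⟨⟨k, a, b⟩, rfl, rfl⟩⟩
  refine ⟨h, j, fun _ _ => rfl, ⟨fun W ν m H => ?_, fun W τ τ' H H' => ?_⟩⟩
  · let τ : EnrichedGraph.Hom ⟨N, h⟩ W := ⟨ν, fun x y => Sigma.desc fun e : I x y =>
      (m e.1.1).onHom _ _ ≫ eqToHom (congrArg₂ W.hom
        ((H _ _).trans (congrArg ν e.2.1)) ((H _ _).trans (congrArg ν e.2.2)))⟩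
    refine ⟨τ, fun _ => rfl, fun k => graph_hom_ext (fun x => (H k x).symm) fun a b => ?_⟩
    refine (congrArg (· ≫ _) (Sigma.ι_desc _ _)).trans ?_
    refine (Category.assoc _ _ _).trans ?_
    rw [eqToHom_trans]
    exact Category.comp_id _
  · refine graph_hom_ext H fun x y => Sigma.hom_ext _ _ fun e => ?_
    obtain ⟨⟨k, a, b⟩, rfl, rfl⟩ := e
    have := onHom_congr (H' k) a b
    exact (Category.assoc _ _ _).symm.trans this

end Graphs

/-! ### Connected objects as test objects. -/

section Connected

variable {V : Type u} [Category.{v} V]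

theorem IsConnectedObject.exists_factor {C : V} (hC : IsConnectedObject C) {J : Type v} {Y : J → V}
    {X : V} {i : ∀ j, Y j ⟶ X} (h : IsColimit (Cofan.mk X i)) (g : C ⟶ X) :
    ∃ (j : J) (g' : C ⟶ Y j), g' ≫ i j = g := by
  have := hC J
  obtain ⟨⟨j⟩, y, hy⟩ := Types.jointly_surjective_of_isColimit
    (isColimitCofanMkObjOfIsColimit (coyoneda.obj (op C)) _ _ h) g
  exact ⟨j, y, hy⟩

/-- The set V(C, X) is the coproduct of the sets V(C, Y j), so it maps to their disjoint union; this
map recovers both the summand and the factor. -/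
theorem IsConnectedObject.factor_unique {C : V} (hC : IsConnectedObject C) {J : Type v} {Y : J → V}
    {X : V} {i : ∀ j, Y j ⟶ X} (h : IsColimit (Cofan.mk X i)) {j j' : J} {g : C ⟶ Y j}
    {g' : C ⟶ Y j'} (e : g ≫ i j = g' ≫ i j') :
    (⟨j, g⟩ : Σ j, C ⟶ Y j) = ⟨j', g'⟩ := by
  have := hC J
  have hc := isColimitCofanMkObjOfIsColimit (coyoneda.obj (op C)) _ _ h
  let d := Cofan.IsColimit.desc hc
    (fun j => TypeCat.ofHom (fun g : C ⟶ Y j => (⟨j, g⟩ : Σ j, C ⟶ Y j)))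
  have hd : ∀ j (g : C ⟶ Y j), d (g ≫ i j) = ⟨j, g⟩ := fun j g =>
    congrArg (fun k => k g) (Cofan.IsColimit.fac hc
      (fun j => TypeCat.ofHom (fun g : C ⟶ Y j => (⟨j, g⟩ : Σ j, C ⟶ Y j))) j)
  exact (hd j g).symm.trans ((congrArg _ e).trans (hd j' g'))

theorem isPullback_of_exists {C : Type*} [Category* C] {P X Y Z : C} {f : P ⟶ X}
    {g : P ⟶ Y} {h : X ⟶ Z} {k : Y ⟶ Z} (w : f ≫ h = g ≫ k)
    (ex : ∀ (Q : C) (u : Q ⟶ X) (v : Q ⟶ Y), u ≫ h = v ≫ k → ∃ l : Q ⟶ P, l ≫ f = u ∧ l ≫ g = v)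
    (un : ∀ (Q : C) (l l' : Q ⟶ P), l ≫ f = l' ≫ f → l ≫ g = l' ≫ g → l = l') :
    IsPullback f g h k := by
  choose l h1 h2 using fun s : PullbackCone h k => ex s.pt s.fst s.snd s.condition
  exact ⟨⟨w⟩, ⟨PullbackCone.IsLimit.mk w l h1 h2 fun s m e1 e2 =>
    un _ _ _ (e1.trans (h1 s).symm) (e2.trans (h2 s).symm)⟩⟩

/-- A morphism out of a coproduct is a family of morphisms out of its summands: lifts on connected
summands are glued, and uniqueness is checked on each of them. -/
theorem isPullback_of_connected (hV : HasConnectedDecompositions V) {P X Y Z : V} {f : P ⟶ X}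
    {g : P ⟶ Y} {h : X ⟶ Z} {k : Y ⟶ Z} (w : f ≫ h = g ≫ k)
    (ex : ∀ (C : V), IsConnectedObject C → ∀ (u : C ⟶ X) (v : C ⟶ Y), u ≫ h = v ≫ k →
      ∃ l : C ⟶ P, l ≫ f = u ∧ l ≫ g = v)
    (un : ∀ (C : V), IsConnectedObject C → ∀ (l l' : C ⟶ P), l ≫ f = l' ≫ f → l ≫ g = l' ≫ g →
      l = l') : IsPullback f g h k := by
  refine isPullback_of_exists w (fun Q u v e => ?_) fun Q l l' h1 h2 => ?_
  · obtain ⟨J, Y, i, hY, ⟨hi⟩⟩ := hV Q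
    choose l h1 h2 using fun j => ex (Y j) (hY j) (i j ≫ u) (i j ≫ v)
      (by rw [Category.assoc, Category.assoc, e])
    have hl : ∀ j, i j ≫ Cofan.IsColimit.desc hi l = l j := Cofan.IsColimit.fac hi l
    refine ⟨Cofan.IsColimit.desc hi l, Cofan.IsColimit.hom_ext hi _ _ fun j => ?_,
      Cofan.IsColimit.hom_ext hi _ _ fun j => ?_⟩
    · exact (Category.assoc _ _ _).symm.trans ((congrArg (· ≫ f) (hl j)).trans (h1 j))
    · exact (Category.assoc _ _ _).symm.trans ((congrArg (· ≫ g) (hl j)).trans (h2 j))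
  · obtain ⟨J, Y, i, hY, ⟨hi⟩⟩ := hV Q
    refine Cofan.IsColimit.hom_ext hi _ _ fun j => un _ (hY j) _ _ ?_ ?_
    · simp only [Category.assoc, h1]
    · simp only [Category.assoc, h2]

end Connected

/-! ### Free edges and free objects as generators of graphs. -/

section Edge

variable {V : Type u} [Category.{v} V] [HasCoproducts.{v} V]

/-- The hom of the graph freely generated by an edge. -/
noncomputable def edgeHom (C : V) : Bool → Bool → V
  | false, true => C
  | _, _ => ⊥_ V

/-- The graph with two objects freely generated by an edge labelled by `C`. -/
noncomputable def edge (C : V) : EnrichedGraph V := ⟨ULift Bool, fun x y => edgeHom C x.down y.down⟩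

/-- The function picking two elements. -/
def pick {S : Type*} (a b : S) : Bool → S
  | false => a
  | true => b

/-- The action on homs of the morphism from the free edge which corresponds to an edge. -/
noncomputable def edgeMapHom {C : V} {X : EnrichedGraph V} {a b : X.obj} (g : C ⟶ X.hom a b) :
    ∀ i j : Bool, edgeHom C i j ⟶ X.hom (pick a b i) (pick a b j)
  | false, true => g
  | false, false => initial.to _
  | true, _ => initial.to _

/-- The morphism from the free edge which corresponds to an edge. -/
noncomputable def edgeMap {C : V} {X : EnrichedGraph V} (a b : X.obj) (g : C ⟶ X.hom a b) :
    edge C ⟶ X :=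
  (⟨fun i => pick a b i.down, fun i j => edgeMapHom g i.down j.down⟩ :
    EnrichedGraph.Hom (edge C) X)

theorem edge_hom_ext {C : V} {X : EnrichedGraph V} {f g : edge C ⟶ X}
    (h₀ : f.onObj ⟨false⟩ = g.onObj ⟨false⟩) (h₁ : f.onObj ⟨true⟩ = g.onObj ⟨true⟩)
    (h : f.onHom ⟨false⟩ ⟨true⟩ ≫ eqToHom (congrArg₂ X.hom h₀ h₁) = g.onHom ⟨false⟩ ⟨true⟩) :
    f = g := by
  refine graph_hom_ext (fun ⟨i⟩ => by cases i <;> assumption) fun ⟨i⟩ ⟨j⟩ => ?_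
  cases i <;> cases j
  · exact initial.hom_ext _ _
  · exact h
  · exact initial.hom_ext _ _
  · exact initial.hom_ext _ _

theorem eq_edgeMap {C : V} {X : EnrichedGraph V} (f : edge C ⟶ X) :
    f = edgeMap (f.onObj ⟨false⟩) (f.onObj ⟨true⟩) (f.onHom ⟨false⟩ ⟨true⟩) :=
  edge_hom_ext rfl rfl (Category.comp_id _)

theorem edgeMap_comp {C : V} {X Y : EnrichedGraph V} (a b : X.obj) (g : C ⟶ X.hom a b) (f : X ⟶ Y) :
    edgeMap a b g ≫ f = edgeMap (f.onObj a) (f.onObj b) (g ≫ f.onHom a b) :=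
  edge_hom_ext rfl rfl (Category.comp_id _)

theorem edgeMap_inj {C : V} {X : EnrichedGraph V} {a b : X.obj} {g : C ⟶ X.hom a b} {a' b' : X.obj}
    {g' : C ⟶ X.hom a' b'} (h : edgeMap a b g = edgeMap a' b' g') :
    (⟨a, b, g⟩ : Σ a b, C ⟶ X.hom a b) = ⟨a', b', g'⟩ :=
  congrArg (fun f : edge C ⟶ X => (⟨f.onObj ⟨false⟩, f.onObj ⟨true⟩, f.onHom ⟨false⟩ ⟨true⟩⟩ :
    Σ a b, C ⟶ X.hom a b)) h

/-- The generating edges are the connected summands of all homs. Objects which lie on no such edge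
are taken care of by the prescribed function on objects in `IsPush`. -/
theorem exists_edge_cover (hV : HasConnectedDecompositions V) (Y : EnrichedGraph V) :
    ∃ (K : Type v) (C : K → V) (i : ∀ k, edge (C k) ⟶ Y), (∀ k, IsConnectedObject (C k)) ∧
      IsPush (fun k => edge (C k)) Y i := by
  choose J C i hC hi using fun a b => hV (Y.hom a b)
  refine ⟨Σ a b, J a b, fun k => C _ _ k.2.2, fun k => edgeMap k.1 k.2.1 (i _ _ k.2.2),
    fun k => hC _ _ _, ⟨fun W ν m H => ?_, fun W τ τ' H H' => ?_⟩⟩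
  · let d (a b : Y.obj) := (hi a b).some
    let τ : EnrichedGraph.Hom Y W := ⟨ν, fun a b => Cofan.IsColimit.desc (d a b) fun j =>
      (m ⟨a, b, j⟩).onHom ⟨false⟩ ⟨true⟩ ≫
        eqToHom (congrArg₂ W.hom (H ⟨a, b, j⟩ ⟨false⟩) (H ⟨a, b, j⟩ ⟨true⟩))⟩
    refine ⟨τ, fun _ => rfl, fun k => edge_hom_ext (H k ⟨false⟩).symm (H k ⟨true⟩).symm ?_⟩
    obtain ⟨a, b, j⟩ := k
    refine (congrArg (· ≫ _) (Cofan.IsColimit.fac (d a b) _ j)).trans ?_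
    refine (Category.assoc _ _ _).trans ?_
    rw [eqToHom_trans]
    exact Category.comp_id _
  · refine graph_hom_ext H fun a b => ?_
    obtain ⟨hd⟩ := hi a b
    refine Cofan.IsColimit.hom_ext hd _ _ fun j => ?_
    have := onHom_congr (H' ⟨a, b, j⟩) ⟨false⟩ ⟨true⟩
    exact (Category.assoc _ _ _).symm.trans this

/-- The graph with a single object freely generated by it. -/
noncomputable def point (V : Type u) [Category.{v} V] [HasCoproducts.{v} V] : EnrichedGraph V :=
  ⟨PUnit, fun _ _ => ⊥_ V⟩

/-- The morphism from the free object which corresponds to an object. -/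
noncomputable def pointMap {X : EnrichedGraph V} (a : X.obj) : point V ⟶ X :=
  (⟨fun _ => a, fun _ _ => initial.to _⟩ : EnrichedGraph.Hom (point V) X)

theorem point_hom_ext {X : EnrichedGraph V} {f g : point V ⟶ X}
    (h : f.onObj PUnit.unit = g.onObj PUnit.unit) : f = g :=
  graph_hom_ext (fun _ => h) fun _ _ => initial.hom_ext _ _

/-- The graph `point V` represents the set of objects, so a pullback of graphs is a pullback on
objects; `isPullback_obj_injective` is the other half. -/
theorem isPullback_obj {P X Y Z : EnrichedGraph V} {f : P ⟶ X} {g : P ⟶ Y} {h : X ⟶ Z} {k : Y ⟶ Z}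
    (H : IsPullback f g h k) {x : X.obj} {y : Y.obj} (e : h.onObj x = k.onObj y) :
    ∃ p, f.onObj p = x ∧ g.onObj p = y :=
  ⟨(H.lift (pointMap x) (pointMap y) (point_hom_ext e)).onObj PUnit.unit,
    congrArg (fun m : point V ⟶ X => m.onObj PUnit.unit) (H.lift_fst _ _ _),
    congrArg (fun m : point V ⟶ Y => m.onObj PUnit.unit) (H.lift_snd _ _ _)⟩

theorem isPullback_obj_injective {P X Y Z : EnrichedGraph V} {f : P ⟶ X} {g : P ⟶ Y} {h : X ⟶ Z}
    {k : Y ⟶ Z} (H : IsPullback f g h k) (p q : P.obj) (e : f.onObj p = f.onObj q)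
    (e' : g.onObj p = g.onObj q) : p = q :=
  congrArg (fun m : point V ⟶ P => m.onObj PUnit.unit)
    (H.hom_ext (point_hom_ext (f := pointMap p ≫ f) (g := pointMap q ≫ f) e)
      (point_hom_ext (f := pointMap p ≫ g) (g := pointMap q ≫ g) e'))

/-- A morphism to `P` is assembled from its values on objects and on connected edges. Uniqueness on
objects is what makes the lifted edges end at the lifted objects. -/
theorem isPullback_of_edges (hV : HasConnectedDecompositions V) {P X Y Z : EnrichedGraph V}
    {f : P ⟶ X} {g : P ⟶ Y} {h : X ⟶ Z} {k : Y ⟶ Z} (w : f ≫ h = g ≫ k)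
    (exo : ∀ x y, h.onObj x = k.onObj y → ∃ p, f.onObj p = x ∧ g.onObj p = y)
    (uno : ∀ p q, f.onObj p = f.onObj q → g.onObj p = g.onObj q → p = q)
    (ex : ∀ C : V, IsConnectedObject C → ∀ (u : edge C ⟶ X) (v : edge C ⟶ Y), u ≫ h = v ≫ k →
      ∃ l : edge C ⟶ P, l ≫ f = u ∧ l ≫ g = v)
    (un : ∀ C : V, IsConnectedObject C → ∀ l l' : edge C ⟶ P, l ≫ f = l' ≫ f → l ≫ g = l' ≫ g →
      l = l') : IsPullback f g h k := by
  refine isPullback_of_exists w (fun Q u v e => ?_) fun Q l l' h1 h2 => ?_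
  · obtain ⟨K, C, i, hC, hi⟩ := exists_edge_cover hV Q
    choose m hm1 hm2 using fun c => ex (C c) (hC c) (i c ≫ u) (i c ≫ v)
      (by rw [Category.assoc, Category.assoc, e])
    choose ν hν1 hν2 using fun q => exo (u.onObj q) (v.onObj q)
      (congrArg (fun m : Q ⟶ Z => m.onObj q) e)
    obtain ⟨τ, hτ, hτ'⟩ := hi.exists_lift P ν m fun c x => uno _ _
      ((congrArg (fun m : edge (C c) ⟶ X => m.onObj x) (hm1 c)).trans (hν1 _).symm)
      ((congrArg (fun m : edge (C c) ⟶ Y => m.onObj x) (hm2 c)).trans (hν2 _).symm)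
    refine ⟨τ, hi.hom_ext _ _ _ (fun x => ?_) fun c => ?_,
      hi.hom_ext _ _ _ (fun x => ?_) fun c => ?_⟩
    · exact (congrArg f.onObj (hτ x)).trans (hν1 x)
    · rw [← Category.assoc, hτ', hm1]
    · exact (congrArg g.onObj (hτ x)).trans (hν2 x)
    · rw [← Category.assoc, hτ', hm2]
  · obtain ⟨K, C, i, hC, hi⟩ := exists_edge_cover hV Q
    refine hi.hom_ext _ _ _ (fun x => uno _ _
      (congrArg (fun m : Q ⟶ X => m.onObj x) h1) (congrArg (fun m : Q ⟶ Y => m.onObj x) h2))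
      fun c => un _ (hC c) _ _ ?_ ?_
    · simp only [Category.assoc, h1]
    · simp only [Category.assoc, h2]

end Edge

/-! ### Connected edges of ΓE(X). -/

section Pack

variable {V : Type u} [Category.{v} V] [HasCoproducts.{v} V]

/-- The functor `E` evaluated at the homs along a sequence of objects. -/
def tensorAt (E : FreeMon V ⥤ V) : walks.El V ⥤ V := homsAt ⋙ E

/-- The endpoints of a sequence. -/
def ends {S : Type v} (t : walks.carrier S) : pairs.carrier S := (t.1, t.2.1)

/-- The endpoints of a sequence in `X` as a pair of objects of `ΓE(X)`. -/
noncomputable def gammaEnds (E : FreeMon V ⥤ V) : walks.El V ⥤ pairs.El V where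
  obj x := ⟨Gamma.obj E x.graph, ends x.elt⟩
  map f := ⟨Gamma.map E f.1, congrArg ends f.2⟩
  map_id x := Shape.El.hom_ext ((Gamma.functor E).map_id x.graph)
  map_comp f g := Shape.El.hom_ext ((Gamma.functor E).map_comp f.1 g.1)

/-- The coproduct inclusions of the homs of `ΓE(X)`, as a natural transformation. -/
noncomputable def gammaι (E : FreeMon V ⥤ V) : tensorAt E ⟶ gammaEnds E ⋙ homAt where
  app x := Gamma.ι E x.graph x.elt.2.2
  naturality x y f := by
    induction f using Shape.El.hom_rec with | _ Y f
    refine (congrArg (fun t => E.map t ≫ _) (homsAt_map_push f x.elt)).trans ?_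
    refine (Gamma.ι_map E f x.elt.2.2).symm.trans ?_
    exact congrArg (_ ≫ ·) (homAt_map_push (Gamma.map E f) x.elt.1 x.elt.2.1).symm

variable (E : FreeMon V ⥤ V)

/-- The edge of `ΓE(X)` given by a morphism to one of the summands of a hom. -/
noncomputable def pack {C : V} {X : EnrichedGraph V} (t : walks.carrier X.obj)
    (g : C ⟶ (tensorAt E).obj ⟨X, t⟩) : edge C ⟶ Gamma.obj E X :=
  edgeMap (X := Gamma.obj E X) t.1 t.2.1 (g ≫ Gamma.ι E X t.2.2)

theorem pack_comp {C : V} {X Y : EnrichedGraph V} (t : walks.carrier X.obj)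
    (g : C ⟶ (tensorAt E).obj ⟨X, t⟩) (f : X ⟶ Y) {s : walks.carrier Y.obj}
    (h : walks.map f.onObj t = s) :
    pack E t g ≫ Gamma.map E f = pack E s (g ≫ (tensorAt E).map ⟨f, h⟩) := by
  subst h
  refine (edgeMap_comp _ _ _ _).trans ?_
  refine congrArg (edgeMap (X := Gamma.obj E Y) (f.onObj t.1) (f.onObj t.2.1)) ?_
  refine (Category.assoc _ _ _).trans (Eq.trans ?_ (Category.assoc _ _ _).symm)
  refine (congrArg (g ≫ ·) (Gamma.ι_map E f t.2.2)).trans ?_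
  exact congrArg (fun k => g ≫ E.map k ≫ _) (homsAt_map_push f t).symm

/-- A connected label factors through a single summand of the hom, so the coproduct defining ΓE(X)
becomes a choice of sequence. By `pack_inj` the sequence and the factor are unique. -/
theorem exists_pack {C : V} (hC : IsConnectedObject C) {X : EnrichedGraph V}
    (m : edge C ⟶ Gamma.obj E X) : ∃ t g, m = pack E t g := by
  obtain ⟨hi⟩ := Gamma.isColimit_ι E X (m.onObj ⟨false⟩) (m.onObj ⟨true⟩)
  obtain ⟨p, g, hg⟩ := hC.exists_factor hi (m.onHom ⟨false⟩ ⟨true⟩)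
  exact ⟨⟨_, _, p⟩, g, (eq_edgeMap m).trans
    (congrArg (edgeMap (X := Gamma.obj E X) _ _) hg.symm)⟩

theorem pack_inj {C : V} (hC : IsConnectedObject C) {X : EnrichedGraph V}
    {t t' : walks.carrier X.obj} {g : C ⟶ (tensorAt E).obj ⟨X, t⟩}
    {g' : C ⟶ (tensorAt E).obj ⟨X, t'⟩} (h : pack E t g = pack E t' g') :
    (⟨t, g⟩ : Σ t, C ⟶ (tensorAt E).obj ⟨X, t⟩) = ⟨t', g'⟩ := by
  obtain ⟨a, b, p⟩ := t
  obtain ⟨a', b', p'⟩ := t'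
  have h1 := edgeMap_inj h
  have h2 : a = a' := congrArg (fun t => t.1) h1
  subst h2
  have h3 : b = b' := congrArg (fun t => t.2.1) h1
  subst h3
  have h4 : g ≫ Gamma.ι E X p = g' ≫ Gamma.ι E X p' :=
    eq_of_heq (Sigma.mk.inj (eq_of_heq (Sigma.mk.inj h1).2)).2
  obtain ⟨hi⟩ := Gamma.isColimit_ι E X a b
  have := hC.factor_unique hi h4
  exact congrArg (fun q : Σ p : ObjSeq a b, C ⟶ E.obj (X.homs p) =>
    (⟨⟨a, b, q.1⟩, q.2⟩ : Σ t, C ⟶ (tensorAt E).obj ⟨X, t⟩)) this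

end Pack

/-! ### Connected edges of (ΓE)²(X), and the multiplication on them. -/

section Nested

variable {V : Type u} [Category.{v} V]

/-- The functor `EᵢEⱼ` evaluated at the homs along a doubly nested sequence of objects. -/
def nestedTensorAt (E : FreeMon V ⥤ V) : nested.El V ⥤ V := nestedHomsAt ⋙ mapSeq E ⋙ E

/-- The substitution of `E` at the homs along doubly nested sequences of objects. -/
def substNat (E : Multitensor V) :
    nestedTensorAt E.tensor ⟶ concatFunctor ⋙ tensorAt E.tensor :=
  Functor.whiskerLeft nestedHomsAt E.subst ≫ Functor.whiskerRight nestedHomsJoin.hom E.tensor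


theorem eqToHom_comp_eq_comp_eqToHom {C : Type*} [Category* C] {X Y X' Y' : C} {f : X ⟶ Y}
    {g : X' ⟶ Y'} {e : Y = Y'} {e' : X = X'} (H : f ≫ eqToHom e = eqToHom e' ≫ g) :
    eqToHom e'.symm ≫ f = g ≫ eqToHom e.symm := by
  subst e e'
  simpa using H

variable [HasCoproducts.{v} V] (E : Multitensor V)

/-- The coproduct inclusions of the homs of `(ΓE)²(X)`. -/
noncomputable def nestedι (X : EnrichedGraph V) (R : nested.carrier X.obj) :
    (nestedTensorAt E.tensor).obj ⟨X, R⟩ ⟶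
      (Gamma.obj E.tensor (Gamma.obj E.tensor X)).hom R.1 R.2.1 :=
  E.tensor.map (eqToHom (labels_labels (fun _ _ p => X.homs p) E.tensor.obj R.2.2).symm) ≫
    Gamma.ι₂ E X R.2.2

theorem nestedι_naturality {X Y : EnrichedGraph V} (f : X ⟶ Y) (R : nested.carrier X.obj) :
    nestedι E X R ≫ (Gamma.map E.tensor (Gamma.map E.tensor f)).onHom R.1 R.2.1 =
      (nestedTensorAt E.tensor).map (Shape.El.push f R) ≫ nestedι E Y (nested.map f.onObj R) := by
  have h1 := Gamma.nest_comp E.tensor (Gamma.map E.tensor f)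
    (B := fun a b : Y.obj => ObjSeq a b)
    (fun _ _ p => Gamma.ι E.tensor X p)
    (fun _ _ p => Gamma.ι E.tensor Y p) (fun _ _ p => ObjSeq.map f.onObj p)
    (fun _ _ p => E.tensor.map (Gamma.homsMap f p)) (fun _ _ p => Gamma.ι_map E.tensor f p) R.2.2
  have h2 := labelsHom_labels (A := fun a b : X.obj => ObjSeq a b)
    (B := fun a b : Y.obj => ObjSeq a b) E.tensor f.onObj (fun _ _ p => ObjSeq.map f.onObj p)
    (h := fun _ _ p => X.homs p) (h' := fun _ _ p => Y.homs p)
    (fun _ _ p => Gamma.homsMap f p) R.2.2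
  refine (Category.assoc _ _ _).trans ((congrArg (_ ≫ ·) h1).trans ?_)
  refine (Category.assoc _ _ _).symm.trans ?_
  refine Eq.trans ?_ (Category.assoc _ _ _)
  refine congrArg (· ≫ Gamma.ι₂ E Y (nestedMap f.onObj R.2.2)) ?_
  refine (E.tensor.map_comp _ _).symm.trans ?_
  refine Eq.trans ?_ (E.tensor.map_comp _ _)
  refine congrArg E.tensor.map ?_
  refine (eqToHom_comp_eq_comp_eqToHom h2).trans ?_
  exact congrArg (fun t => (mapSeq E.tensor).map t ≫ eqToHom _) (nestedHomsAt_map_push f R).symm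

/-- The edge of `(ΓE)²(X)` given by a morphism to one of the summands of a hom. -/
noncomputable def nestedPack {C : V} {X : EnrichedGraph V} (R : nested.carrier X.obj)
    (g : C ⟶ (nestedTensorAt E.tensor).obj ⟨X, R⟩) :
    edge C ⟶ Gamma.obj E.tensor (Gamma.obj E.tensor X) :=
  edgeMap (X := Gamma.obj E.tensor (Gamma.obj E.tensor X)) R.1 R.2.1 (g ≫ nestedι E X R)

theorem nestedPack_comp {C : V} {X Y : EnrichedGraph V} (R : nested.carrier X.obj)
    (g : C ⟶ (nestedTensorAt E.tensor).obj ⟨X, R⟩) (f : X ⟶ Y) {S : nested.carrier Y.obj}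
    (h : nested.map f.onObj R = S) :
    nestedPack E R g ≫ Gamma.map E.tensor (Gamma.map E.tensor f) =
      nestedPack E S (g ≫ (nestedTensorAt E.tensor).map ⟨f, h⟩) := by
  subst h
  refine (edgeMap_comp _ _ _ _).trans ?_
  refine congrArg (edgeMap (X := Gamma.obj E.tensor (Gamma.obj E.tensor Y))
    (f.onObj R.1) (f.onObj R.2.1)) ?_
  refine (Category.assoc _ _ _).trans (Eq.trans ?_ (Category.assoc _ _ _).symm)
  exact congrArg (g ≫ ·) (nestedι_naturality E f R)

variable {E}

/-- Distributivity turns the homs of (ΓE)²(X) into coproducts over doubly nested sequences, and a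
connected label again selects one summand. -/
theorem exists_nestedPack (hE : E.IsDistributive) {C : V} (hC : IsConnectedObject C) {X : EnrichedGraph V}
    (m : edge C ⟶ Gamma.obj E.tensor (Gamma.obj E.tensor X)) : ∃ R g, m = nestedPack E R g := by
  obtain ⟨hi⟩ := Gamma.isColimit_ι₂ hE X (m.onObj ⟨false⟩) (m.onObj ⟨true⟩)
  obtain ⟨R, g, hg⟩ := hC.exists_factor hi (m.onHom ⟨false⟩ ⟨true⟩)
  let e := labels_labels (fun _ _ p => X.homs p) E.tensor.obj R
  refine ⟨⟨_, _, R⟩, g ≫ E.tensor.map (eqToHom e), (eq_edgeMap m).trans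
    (congrArg (edgeMap (X := Gamma.obj E.tensor (Gamma.obj E.tensor X)) _ _) ?_)⟩
  refine hg.symm.trans (Eq.trans ?_ (Category.assoc _ _ _).symm)
  refine congrArg (g ≫ ·) (Eq.trans ?_ (Category.assoc _ _ _))
  refine (Category.id_comp _).symm.trans (congrArg (· ≫ Gamma.ι₂ E X R) ?_)
  refine Eq.trans ?_ (E.tensor.map_comp _ _)
  exact (E.tensor.map_id _).symm.trans (congrArg E.tensor.map (eqToHom_trans e e.symm).symm)

theorem nestedPack_inj (hE : E.IsDistributive) {C : V} (hC : IsConnectedObject C) {X : EnrichedGraph V}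
    {R R' : nested.carrier X.obj} {g : C ⟶ (nestedTensorAt E.tensor).obj ⟨X, R⟩}
    {g' : C ⟶ (nestedTensorAt E.tensor).obj ⟨X, R'⟩} (h : nestedPack E R g = nestedPack E R' g') :
    (⟨R, g⟩ : Σ R, C ⟶ (nestedTensorAt E.tensor).obj ⟨X, R⟩) = ⟨R', g'⟩ := by
  obtain ⟨a, b, R⟩ := R
  obtain ⟨a', b', R'⟩ := R'
  have h1 := edgeMap_inj h
  have h2 : a = a' := congrArg (fun t => t.1) h1
  subst h2
  have h3 : b = b' := congrArg (fun t => t.2.1) h1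
  subst h3
  have h4 := eq_of_heq (Sigma.mk.inj (eq_of_heq (Sigma.mk.inj h1).2)).2
  obtain ⟨hi⟩ := Gamma.isColimit_ι₂ hE X a b
  have := hC.factor_unique hi
    ((Category.assoc _ _ _).trans (h4.trans (Category.assoc _ _ _).symm))
  -- The inclusions `nestedι` and `Gamma.ι₂` differ by an identification of equal sequences, which
  -- is undone here.
  have e (R : Walk (fun a b : X.obj => ObjSeq a b) a b)
      (g : C ⟶ (nestedTensorAt E.tensor).obj ⟨X, ⟨a, b, R⟩⟩) :
      (g ≫ E.tensor.map (eqToHom (labels_labels (fun _ _ p => X.homs p) E.tensor.obj R).symm)) ≫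
        E.tensor.map (eqToHom (labels_labels (fun _ _ p => X.homs p) E.tensor.obj R)) = g := by
    refine (Category.assoc _ _ _).trans (Eq.trans (congrArg (g ≫ ·) ?_) (Category.comp_id _))
    refine (E.tensor.map_comp _ _).symm.trans (Eq.trans (congrArg E.tensor.map ?_)
      (E.tensor.map_id _))
    exact eqToHom_trans _ _
  have := congrArg (fun q : Σ R : Walk (fun a b : X.obj => ObjSeq a b) a b,
      C ⟶ E.tensor.obj (labels (fun _ _ p => E.tensor.obj (X.homs p)) R) =>
    (⟨⟨a, b, q.1⟩, q.2 ≫ E.tensor.map (eqToHom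
      (labels_labels (fun _ _ p => X.homs p) E.tensor.obj q.1))⟩ :
      Σ R, C ⟶ (nestedTensorAt E.tensor).obj ⟨X, R⟩)) this
  exact (congrArg (fun k => (⟨⟨a, b, R⟩, k⟩ :
      Σ R, C ⟶ (nestedTensorAt E.tensor).obj ⟨X, R⟩)) (e R g)).symm.trans
    (this.trans (congrArg (fun k => (⟨⟨a, b, R'⟩, k⟩ :
      Σ R, C ⟶ (nestedTensorAt E.tensor).obj ⟨X, R⟩)) (e R' g')))

/-- On an edge coming from one summand, the multiplication concatenates the sequence and applies σ
to the label. This separates the combinatorics of sequences from the pullback property of σ. -/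
theorem nestedPack_multApp (hE : E.IsDistributive) {C : V} {X : EnrichedGraph V} (R : nested.carrier X.obj)
    (g : C ⟶ (nestedTensorAt E.tensor).obj ⟨X, R⟩) :
    nestedPack E R g ≫ Gamma.multApp hE X =
      pack E.tensor (concatEl R) (g ≫ (substNat E).app ⟨X, R⟩) := by
  refine (edgeMap_comp _ _ _ _).trans ?_
  refine congrArg (edgeMap (X := Gamma.obj E.tensor X) R.1 R.2.1) ?_
  refine (Category.assoc _ _ _).trans (Eq.trans ?_ (Category.assoc _ _ _).symm)
  refine congrArg (g ≫ ·) ?_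
  refine (Category.assoc _ _ _).trans ((congrArg (_ ≫ ·) (Gamma.ι₂_multApp hE X R.2.2)).trans ?_)
  refine (Category.assoc _ _ _).symm.trans (congrArg (· ≫ Gamma.ι E.tensor X R.2.2.concat) ?_)
  refine (Category.assoc _ _ _).symm.trans (Eq.trans (congrArg (· ≫ _) ?_) (Category.id_comp _))
  refine (E.tensor.map_comp _ _).symm.trans (Eq.trans (congrArg E.tensor.map ?_)
    (E.tensor.map_id _))
  exact eqToHom_trans _ _

end Nested

/-! ### Cartesian unit and multiplication, compared with cartesian u and σ. -/

section Equifibered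

variable {V : Type u} [Category.{v} V] {E : Multitensor V}

/-- Equifibered transformations stay so under restriction along a functor, and `substNat` is a
restriction of σ followed by an isomorphism. -/
theorem substNat_equifibered (hσ : NatTrans.Equifibered E.subst) :
    NatTrans.Equifibered (substNat E) :=
  (hσ.whiskerLeft nestedHomsAt).comp
    (NatTrans.Equifibered.of_isIso (Functor.isoWhiskerRight nestedHomsJoin E.tensor).hom)

/-- The sequence of two members. -/
def pairT {S : Type v} (a b : S) : walks.carrier S := consT a (nilT b)

theorem tensorAt_map_pairT {X Y : EnrichedGraph V} (f : X ⟶ Y) (a b : X.obj) :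
    (tensorAt E.tensor).map (⟨f, rfl⟩ : (⟨X, pairT a b⟩ : walks.El V) ⟶
      ⟨Y, pairT (f.onObj a) (f.onObj b)⟩) = (single ⋙ E.tensor).map (f.onHom a b) :=
  congrArg E.tensor.map (homsAt_map_push f (pairT a b))

variable [HasCoproducts.{v} V]

theorem edgeMap_unitApp {C : V} {X : EnrichedGraph V} (a b : X.obj) (g : C ⟶ X.hom a b) :
    edgeMap a b g ≫ Gamma.unitApp E X =
      pack E.tensor (X := X) (pairT a b) (g ≫ E.unit.app (X.hom a b)) :=
  (edgeMap_comp _ _ _ _).trans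
    (congrArg (edgeMap (X := Gamma.obj E.tensor X) a b) (Category.assoc _ _ _).symm)

theorem eq_pairT {S T : Type v} {f : S → T} {t : walks.carrier S} {a b : T}
    (h : walks.map f t = pairT a b) : ∃ x y, t = pairT x y ∧ f x = a ∧ f y = b := by
  induction t using walks_rec with
  | nil x => exact absurd (show nilT (f x) = consT a (nilT b) from h) nilT_ne_consT
  | cons x t _ =>
    obtain ⟨h1, h2⟩ := consT_inj (show consT (f x) (walks.map f t) = consT a (nilT b) from h)
    induction t using walks_rec with
    | nil y => exact ⟨x, y, rfl, h1, nilT_inj (a := f y) (b := b) h2⟩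
    | cons y t _ =>
      exact absurd (show nilT b = consT (f y) (walks.map f t) from h2.symm) nilT_ne_consT

theorem pack_inj_same {E : FreeMon V ⥤ V} {C : V} (hC : IsConnectedObject C) {X : EnrichedGraph V}
    {t : walks.carrier X.obj} {g g' : C ⟶ (tensorAt E).obj ⟨X, t⟩} (h : pack E t g = pack E t g') :
    g = g' :=
  eq_of_heq (Sigma.mk.inj (pack_inj E hC h)).2

theorem pack_inj_walk {E : FreeMon V ⥤ V} {C : V} (hC : IsConnectedObject C) {X : EnrichedGraph V}
    {t t' : walks.carrier X.obj} {g : C ⟶ (tensorAt E).obj ⟨X, t⟩}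
    {g' : C ⟶ (tensorAt E).obj ⟨X, t'⟩} (h : pack E t g = pack E t' g') : t = t' :=
  congrArg (fun q => q.1) (pack_inj E hC h)

theorem nestedPack_inj_same (hE : E.IsDistributive) {C : V} (hC : IsConnectedObject C)
    {X : EnrichedGraph V} {R : nested.carrier X.obj}
    {g g' : C ⟶ (nestedTensorAt E.tensor).obj ⟨X, R⟩} (h : nestedPack E R g = nestedPack E R g') :
    g = g' :=
  eq_of_heq (Sigma.mk.inj (nestedPack_inj hE hC h)).2

theorem nestedPack_inj_walk (hE : E.IsDistributive) {C : V} (hC : IsConnectedObject C)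
    {X : EnrichedGraph V} {R R' : nested.carrier X.obj}
    {g : C ⟶ (nestedTensorAt E.tensor).obj ⟨X, R⟩} {g' : C ⟶ (nestedTensorAt E.tensor).obj ⟨X, R'⟩}
    (h : nestedPack E R g = nestedPack E R' g') : R = R' :=
  congrArg (fun q => q.1) (nestedPack_inj hE hC h)

/-- On connected edges the naturality square of η at `f` reduces to the naturality squares of u at
the components of `f` on homs. -/
theorem gamma_unit_equifibered (hV : HasConnectedDecompositions V) (hE : E.IsDistributive)
    (hu : NatTrans.Equifibered E.unit) : NatTrans.Equifibered (E.gamma hE).η := by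
  intro X Y f
  -- The unit is the identity on objects, so the square of objects is trivially a pullback.
  refine isPullback_of_edges hV (Gamma.unitApp_naturality f) (fun y x e => ⟨x, e.symm, rfl⟩)
    (fun p q _ e => e) (fun C hC u v e => ?_) fun C hC l l' h1 h2 => ?_
  · obtain ⟨t, w, rfl⟩ := exists_pack E.tensor hC (X := X) v
    rw [eq_edgeMap u] at e ⊢
    have e1 := (edgeMap_unitApp (E := E) _ _ _).symm.trans
      (e.trans (pack_comp E.tensor t w f rfl))
    -- A sequence whose image is a single step is itself a single step, so `w` has the value of E on
    -- a one-member sequence as target.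
    obtain ⟨x, y, rfl, h1, h2⟩ := eq_pairT (pack_inj_walk hC e1).symm
    generalize u.onHom ⟨false⟩ ⟨true⟩ = g at *
    generalize u.onObj ⟨false⟩ = a at *
    generalize u.onObj ⟨true⟩ = b at *
    subst h1 h2
    have e2 := (pack_inj_same hC e1).trans (congrArg (w ≫ ·) (tensorAt_map_pairT f x y))
    have H := hu (f.onHom x y)
    refine ⟨edgeMap x y (H.lift g w e2), ?_, ?_⟩
    · exact (edgeMap_comp _ _ _ _).trans
        (congrArg (edgeMap (f.onObj x) (f.onObj y)) (H.lift_fst _ _ _))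
    · exact (edgeMap_unitApp _ _ _).trans
        (congrArg (pack E.tensor (X := X) (pairT x y)) (H.lift_snd _ _ _))
  · rw [eq_edgeMap l, eq_edgeMap l'] at h1 h2 ⊢
    have ha : l.onObj ⟨false⟩ = l'.onObj ⟨false⟩ :=
      congrArg (fun m : edge C ⟶ Gamma.obj E.tensor X => m.onObj ⟨false⟩) h2
    have hb : l.onObj ⟨true⟩ = l'.onObj ⟨true⟩ :=
      congrArg (fun m : edge C ⟶ Gamma.obj E.tensor X => m.onObj ⟨true⟩) h2
    generalize l.onHom ⟨false⟩ ⟨true⟩ = g at *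
    generalize l'.onHom ⟨false⟩ ⟨true⟩ = g' at *
    generalize l.onObj ⟨false⟩ = a at *
    generalize l.onObj ⟨true⟩ = b at *
    generalize l'.onObj ⟨false⟩ = a' at *
    generalize l'.onObj ⟨true⟩ = b' at *
    subst ha hb
    refine congrArg (edgeMap a b) ((hu (f.onHom a b)).hom_ext ?_ ?_)
    · have := edgeMap_inj ((edgeMap_comp _ _ _ _).symm.trans (h1.trans (edgeMap_comp _ _ _ _)))
      exact eq_of_heq (Sigma.mk.inj (eq_of_heq (Sigma.mk.inj this).2)).2
    · exact pack_inj_same hC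
        ((edgeMap_unitApp _ _ _).symm.trans (h2.trans (edgeMap_unitApp _ _ _)))

/-- The graph with a single object and a given hom. -/
def loop (Z : V) : EnrichedGraph V := ⟨PUnit, fun _ _ => Z⟩

/-- The morphism between graphs with a single object induced by a morphism between their homs. -/
def loopMap {Z Z' : V} (φ : Z ⟶ Z') : loop Z ⟶ loop Z' :=
  (⟨fun a => a, fun _ _ => φ⟩ : EnrichedGraph.Hom (loop Z) (loop Z'))

/-- Apply the hypothesis to graphs with one object: there a morphism of V is a morphism of graphs,
and edges of the loop are morphisms to its hom. -/
theorem unit_equifibered_of_gamma (hV : HasConnectedDecompositions V) (hE : E.IsDistributive)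
    (hη : NatTrans.Equifibered (E.gamma hE).η) : NatTrans.Equifibered E.unit := by
  intro Z Z' φ
  have H := hη (loopMap φ)
  have inj {C Z : V} {g g' : C ⟶ Z} (h : edgeMap (X := loop Z) PUnit.unit PUnit.unit g =
      edgeMap (X := loop Z) PUnit.unit PUnit.unit g') : g = g' :=
    eq_of_heq (Sigma.mk.inj (eq_of_heq (Sigma.mk.inj (edgeMap_inj h)).2)).2
  have key {C : V} (l : C ⟶ Z) := edgeMap_comp (X := loop Z) PUnit.unit PUnit.unit l (loopMap φ)
  have key' {C : V} (l : C ⟶ Z) :=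
    edgeMap_unitApp (E := E) (X := loop Z) PUnit.unit PUnit.unit l
  refine isPullback_of_connected hV (E.unit.naturality φ) (fun C hC u v e => ?_)
    fun C hC l l' h1 h2 => ?_
  · have h3 : edgeMap (X := loop Z') PUnit.unit PUnit.unit u ≫ Gamma.unitApp E (loop Z') =
        pack E.tensor (X := loop Z) (pairT PUnit.unit PUnit.unit) v ≫
          Gamma.map E.tensor (loopMap φ) := by
      refine (edgeMap_unitApp _ _ _).trans (Eq.trans ?_ (pack_comp E.tensor
        (X := loop Z) (Y := loop Z') (pairT PUnit.unit PUnit.unit) v (loopMap φ) rfl).symm)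
      refine congrArg (pack E.tensor (X := loop Z') (pairT PUnit.unit PUnit.unit)) (e.trans ?_)
      exact congrArg (v ≫ ·) (tensorAt_map_pairT (loopMap φ) PUnit.unit PUnit.unit).symm
    have h4 := eq_edgeMap (H.lift _ _ h3)
    have h5 := H.lift_fst _ _ h3
    have h6 := H.lift_snd _ _ h3
    rw [h4] at h5 h6
    exact ⟨_, inj ((key _).symm.trans h5), pack_inj_same (X := loop Z) hC ((key' _).symm.trans h6)⟩
  · refine inj (H.hom_ext ?_ ?_)
    · exact (key l).trans ((congrArg (edgeMap (X := loop Z') _ _) h1).trans (key l').symm)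
    · exact (key' l).trans ((congrArg (pack E.tensor (X := loop Z) _) h2).trans (key' l').symm)

/-- An edge of (ΓE)²(Y) and an edge of ΓE(X) with the same image in ΓE(Y) determine a unique doubly
nested sequence in X, because concatenation is cartesian. Over that sequence the lift is provided by
σ. -/
theorem gamma_mult_equifibered (hV : HasConnectedDecompositions V) (hE : E.IsDistributive)
    (hσ : NatTrans.Equifibered (substNat E)) : NatTrans.Equifibered (E.gamma hE).μ := by
  intro X Y f
  refine isPullback_of_edges hV (Gamma.multApp_naturality hE f) (fun y x e => ⟨x, e.symm, rfl⟩)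
    (fun p q _ e => e) (fun C hC u v e => ?_) fun C hC l l' h1 h2 => ?_
  · obtain ⟨t, w, rfl⟩ := exists_pack E.tensor hC (X := X) v
    obtain ⟨⟨a, b, R'⟩, g, rfl⟩ := exists_nestedPack hE hC (X := Y) u
    have e1 := (nestedPack_multApp hE _ _).symm.trans (e.trans (pack_comp E.tensor t w f rfl))
    -- The sequence `t` has the concatenation of `R'` as image, so it is cut in the same way.
    obtain ⟨R, h1, rfl⟩ := exists_nested_lift f.onObj R' t (pack_inj_walk hC e1).symm
    generalize (⟨a, b, R'⟩ : nested.carrier Y.obj) = S at *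
    subst h1
    have e2 := pack_inj_same hC ((nestedPack_multApp hE _ _).symm.trans
      (e.trans (pack_comp E.tensor (concatEl R) w f (map_concatEl f.onObj R))))
    have H := hσ (Shape.El.push (P := nested) f R)
    refine ⟨nestedPack E R (H.lift g w e2), ?_, ?_⟩
    · exact (nestedPack_comp E R _ f rfl).trans
        (congrArg (nestedPack E (X := Y) (nested.map f.onObj R)) (H.lift_fst _ _ _))
    · exact (nestedPack_multApp hE R _).trans
        (congrArg (pack E.tensor (X := X) (concatEl R)) (H.lift_snd _ _ _))
  · obtain ⟨R, g, rfl⟩ := exists_nestedPack hE hC (X := X) l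
    obtain ⟨R', g', rfl⟩ := exists_nestedPack hE hC (X := X) l'
    have e1 := (nestedPack_comp E R _ f rfl).symm.trans
      (h1.trans (nestedPack_comp E R' _ f rfl))
    have e2 := (nestedPack_multApp hE R g).symm.trans (h2.trans (nestedPack_multApp hE R' g'))
    have h3 : R = R' := nested_map_injective f.onObj R.2.2 R' (nestedPack_inj_walk hE hC e1)
      (pack_inj_walk hC e2)
    subst h3
    exact congrArg (nestedPack E R) ((hσ (Shape.El.push (P := nested) f R)).hom_ext
      (nestedPack_inj_same hE hC e1) (pack_inj_same hC e2))

/-- The square of μ provides a lift over some doubly nested sequence `R'`. It has the same image and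
the same concatenation as `R`, hence equals `R`, so the lift is one at the required summand. -/
theorem substNat_equifibered_of_gamma (hV : HasConnectedDecompositions V) (hE : E.IsDistributive)
    (hμ : NatTrans.Equifibered (E.gamma hE).μ) : NatTrans.Equifibered (substNat E) := by
  intro x y f
  induction f using Shape.El.hom_rec with | _ Y f
  obtain ⟨X, R⟩ := x
  have H := hμ f
  have key {C : V} (l : C ⟶ _) := nestedPack_comp E R l f rfl
  have key' {C : V} (l : C ⟶ _) := nestedPack_multApp (E := E) hE R l
  refine isPullback_of_connected hV ((substNat E).naturality _) (fun C hC u v e => ?_)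
    fun C hC l l' h1 h2 => ?_
  · have h3 : nestedPack E (X := Y) (nested.map f.onObj R) u ≫ Gamma.multApp hE Y =
        pack E.tensor (X := X) (concatEl R) v ≫ Gamma.map E.tensor f :=
      (nestedPack_multApp hE _ _).trans ((congrArg (pack E.tensor (X := Y) _) e).trans
        (pack_comp E.tensor (concatEl R) v f (map_concatEl f.onObj R)).symm)
    obtain ⟨R', l, hl⟩ := exists_nestedPack hE hC (X := X) (H.lift _ _ h3)
    have h5 := H.lift_fst _ _ h3
    have h6 := H.lift_snd _ _ h3
    rw [hl] at h5 h6
    have e1 := (nestedPack_comp E R' l f rfl).symm.trans h5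
    have e2 := (nestedPack_multApp hE R' l).symm.trans h6
    have h7 : R' = R := nested_map_injective f.onObj R'.2.2 R (nestedPack_inj_walk hE hC e1)
      (pack_inj_walk hC e2)
    subst h7
    exact ⟨l, nestedPack_inj_same hE hC e1, pack_inj_same hC e2⟩
  · refine nestedPack_inj_same hE hC (H.hom_ext ?_ ?_)
    · exact (key l).trans ((congrArg (nestedPack E (X := Y) _) h1).trans (key l').symm)
    · exact (key' l).trans ((congrArg (pack E.tensor (X := X) _) h2).trans (key' l').symm)

end Equifibered

/-! ### Morphisms which are isomorphisms on homs. -/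

section Isomorphisms

variable {V : Type u} [Category.{v} V]

theorem isIso_consHom {X Y : V} {l m : FreeMon V} {f : X ⟶ Y} {g : l ⟶ m} (hf : IsIso f)
    (hg : IsIso g) : IsIso (consHom f g) :=
  ⟨consHom (inv f) (inv g), by rw [consHom_comp, IsIso.hom_inv_id, IsIso.hom_inv_id, consHom_id],
    by rw [consHom_comp, IsIso.inv_hom_id, IsIso.inv_hom_id, consHom_id]⟩

theorem isIso_labelsHom {S T : Type v} {A : S → S → Type v} {B : T → T → Type v} (f : S → T)
    (c : ∀ a b, A a b → B (f a) (f b)) {h : ∀ a b, A a b → V} {h' : ∀ a b, B a b → V}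
    (φ : ∀ a b e, h a b e ⟶ h' _ _ (c a b e)) (hφ : ∀ a b e, IsIso (φ a b e)) {a b : S}
    (P : Walk A a b) : IsIso (labelsHom f c φ P) := by
  induction P with
  | nil a => exact inferInstanceAs (IsIso (𝟙 (nil : FreeMon V)))
  | cons e p ih =>
    exact isIso_consHom (hφ _ _ e) ih

theorem isIso_homsMap {X Y : EnrichedGraph V} (f : X ⟶ Y) (hf : ∀ a b, IsIso (f.onHom a b))
    {a b : X.obj} (p : ObjSeq a b) : IsIso (Gamma.homsMap f p) :=
  isIso_labelsHom _ _ _ (fun a b _ => hf a b) p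

theorem isIso_nestedHomsMap {X Y : EnrichedGraph V} (f : X ⟶ Y) (hf : ∀ a b, IsIso (f.onHom a b))
    {a b : X.obj} (R : Walk (fun a b : X.obj => ObjSeq a b) a b) : IsIso (nestedHomsMap f R) :=
  isIso_labelsHom (A := fun a b : X.obj => ObjSeq a b) (B := fun a b : Y.obj => ObjSeq a b)
    f.onObj (fun _ _ p => ObjSeq.map f.onObj p) (h := fun _ _ p => X.homs p)
    (h' := fun _ _ p => Y.homs p) (fun _ _ p => Gamma.homsMap f p)
    (fun _ _ p => isIso_homsMap f hf p) R

theorem isIso_homsAt_push {X Y : EnrichedGraph V} (f : X ⟶ Y) (hf : ∀ a b, IsIso (f.onHom a b))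
    (t : walks.carrier X.obj) : IsIso (homsAt.map (Shape.El.push (P := walks) f t)) := by
  rw [homsAt_map_push]
  exact isIso_homsMap f hf _

theorem isIso_nestedHomsAt_push {X Y : EnrichedGraph V} (f : X ⟶ Y)
    (hf : ∀ a b, IsIso (f.onHom a b)) (R : nested.carrier X.obj) :
    IsIso (nestedHomsAt.map (Shape.El.push (P := nested) f R)) := by
  rw [nestedHomsAt_map_push]
  exact isIso_nestedHomsMap f hf _

end Isomorphisms

/-! ### Adjoining an object and an edge at the start. -/

section Prepend

variable {V : Type u} [Category.{v} V] [HasCoproducts.{v} V]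

/-- The homs of a graph with an additional object and an additional edge to a given object. -/
noncomputable def prependHom (X : EnrichedGraph V) (a : X.obj) (z : V) :
    Option X.obj → Option X.obj → V
  | some x, some y => X.hom x y
  | none, some y => ∐ fun _ : ULift.{v} (PLift (y = a)) => z
  | _, none => ⊥_ V

/-- Adjoin freely to a graph an additional object and an additional edge to a given object. -/
noncomputable def prepend (X : EnrichedGraph V) (a : X.obj) (z : V) : EnrichedGraph V :=
  ⟨Option X.obj, prependHom X a z⟩

variable {X : EnrichedGraph V} {a : X.obj} {z : V}

/-- The inclusion of the original graph. -/
noncomputable def prependIncl (X : EnrichedGraph V) (a : X.obj) (z : V) : X ⟶ prepend X a z :=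
  (⟨some, fun _ _ => 𝟙 _⟩ : EnrichedGraph.Hom X (prepend X a z))

theorem isIso_prependIncl (X : EnrichedGraph V) (a : X.obj) (z : V) (x y : X.obj) :
    IsIso ((prependIncl X a z).onHom x y) :=
  inferInstanceAs (IsIso (𝟙 (X.hom x y)))

/-- The additional edge. -/
noncomputable def prependEdge (X : EnrichedGraph V) (a : X.obj) (z : V) :
    z ⟶ (prepend X a z).hom none (some a) :=
  Sigma.ι (fun _ : ULift.{v} (PLift (a = a)) => z) ⟨⟨rfl⟩⟩

theorem isIso_prependEdge (X : EnrichedGraph V) (a : X.obj) (z : V) :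
    IsIso (prependEdge X a z) :=
  ⟨Sigma.desc fun _ => 𝟙 z, Sigma.ι_desc _ _, Sigma.hom_ext _ _ fun _ =>
    (Category.assoc _ _ _).symm.trans ((congrArg (· ≫ prependEdge X a z) (Sigma.ι_desc _ _)).trans
      ((Category.id_comp _).trans (Category.comp_id _).symm))⟩

/-- The action on objects of a morphism from a graph with an additional edge. -/
def prependDescObj {S T : Type*} (c : T) (r : S → T) : Option S → T
  | none => c
  | some x => r x

/-- The action on homs of a morphism from a graph with an additional edge. -/
noncomputable def prependDescHom {W : EnrichedGraph V} (c : W.obj) (r : X ⟶ W)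
    (g : z ⟶ W.hom c (r.onObj a)) : ∀ x y : Option X.obj,
      prependHom X a z x y ⟶ W.hom (prependDescObj c r.onObj x) (prependDescObj c r.onObj y)
  | some x, some y => r.onHom x y
  | none, some _ => Sigma.desc fun e => g ≫ eqToHom (congrArg (fun y => W.hom c (r.onObj y))
      e.down.down.symm)
  | some _, none => initial.to _
  | none, none => initial.to _

/-- The morphism from a graph with an additional edge given by a morphism from the original graph
and an edge. -/
noncomputable def prependDesc {W : EnrichedGraph V} (c : W.obj) (r : X ⟶ W)
    (g : z ⟶ W.hom c (r.onObj a)) : prepend X a z ⟶ W :=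
  (⟨prependDescObj c r.onObj, prependDescHom c r g⟩ : EnrichedGraph.Hom (prepend X a z) W)

theorem prependIncl_desc {W : EnrichedGraph V} (c : W.obj) (r : X ⟶ W)
    (g : z ⟶ W.hom c (r.onObj a)) : prependIncl X a z ≫ prependDesc c r g = r :=
  EnrichedGraph.Hom.congr fun _ _ => Category.id_comp _

theorem prependEdge_desc {W : EnrichedGraph V} (c : W.obj) (r : X ⟶ W)
    (g : z ⟶ W.hom c (r.onObj a)) :
    prependEdge X a z ≫ (prependDesc c r g).onHom none (some a) = g :=
  (Sigma.ι_desc _ _).trans (Category.comp_id _)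

theorem prepend_hom_ext {W : EnrichedGraph V} {f g : prepend X a z ⟶ W}
    (h : prependIncl X a z ≫ f = prependIncl X a z ≫ g) (h₀ : f.onObj none = g.onObj none)
    (h₁ : f.onObj (some a) = g.onObj (some a))
    (h' : prependEdge X a z ≫ f.onHom none (some a) ≫ eqToHom (congrArg₂ W.hom h₀ h₁) =
      prependEdge X a z ≫ g.onHom none (some a)) : f = g := by
  refine graph_hom_ext (fun x => ?_) fun x y => ?_
  · cases x with
    | none => exact h₀
    | some x => exact congrArg (fun m : X ⟶ W => m.onObj x) h
  · cases y with
    | none => cases x <;> exact initial.hom_ext _ _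
    | some y =>
      cases x with
      | none =>
        refine Sigma.hom_ext _ _ fun e => ?_
        obtain ⟨⟨rfl⟩⟩ := e
        exact h'
      | some x =>
        have := onHom_congr h x y
        refine Eq.trans ?_ (this.trans (Category.id_comp _))
        exact congrArg (· ≫ _) (Category.id_comp _).symm

end Prepend

/-! ### Sequences with an initial member. -/

section Initial

variable {V : Type u} [Category.{v} V]

/-- Some member of a sequence is an initial object. -/
def HasInitialMember : List V → Prop
  | [] => False
  | Z :: l => Nonempty (IsInitial Z) ∨ HasInitialMember l

/-- Preserving coproducts in a variable includes preserving the empty one. The members in front of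
the initial one are absorbed into the functor by the induction. -/
theorem HasInitialMember.isInitial {l : FreeMon V} (h : HasInitialMember l) :
    ∀ {G : FreeMon V ⥤ V}, PreservesCoproductsInEachVariable G →
      Nonempty (IsInitial (G.obj l)) := by
  induction l with
  | nil => exact h.elim
  | cons Z l ih =>
    intro G hG
    rcases h with h | h
    · obtain ⟨hZ⟩ := h
      have := hG FreeMon.nil l PEmpty
      have hc := isColimitCofanMkObjOfIsColimit (insertAt FreeMon.nil l ⋙ G)
        (fun e : PEmpty => (e.elim : V)) (fun e : PEmpty => (e.elim : _ ⟶ Z))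
        (Cofan.IsColimit.mk _ (fun s => hZ.to _) (fun _ e => e.elim) fun _ _ _ => hZ.hom_ext _ _)
      exact ⟨IsInitial.ofUniqueHom
        (fun W => Cofan.IsColimit.desc hc (fun e : PEmpty => e.elim))
        fun W m => Cofan.IsColimit.hom_ext hc _ _ fun e => e.elim⟩
    · exact ih h (preserves_cons hG Z)

end Initial

/-! ### Free graphs on finite sequences of homs. -/

section Path

variable {V : Type u} [Category.{v} V] [HasCoproducts.{v} V]

/-- The graph `P` with its given sequence of objects is the free one on the sequence `Z` of its
homs. -/
structure IsPath (Z : FreeMon V) (P : walks.El V) (α : Z ⟶ homsAt.obj P) : Prop where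
  isIso : IsIso α
  exists_lift : ∀ (x : walks.El V) (h : Z ⟶ homsAt.obj x), ∃ r : P ⟶ x, α ≫ homsAt.map r = h
  hom_ext : ∀ (x : walks.El V) (r r' : P ⟶ x), α ≫ homsAt.map r = α ≫ homsAt.map r' → r = r'
  other : ∀ t : walks.carrier P.graph.obj, ends t = ends P.elt → t ≠ P.elt →
    HasInitialMember (P.graph.homs t.2.2)

theorem isPath_nil : IsPath (nil : FreeMon V) ⟨point V, nilT PUnit.unit⟩ (𝟙 _) where
  isIso := inferInstanceAs (IsIso (𝟙 (nil : FreeMon V)))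
  exists_lift x h := by
    obtain ⟨W, t⟩ := x
    induction t using walks_rec with
    | nil a => exact ⟨⟨pointMap a, rfl⟩, nil_hom_ext _ _⟩
    | cons a t _ => exact PEmpty.elim h
  hom_ext x r r' _ := by
    refine Shape.El.hom_ext (point_hom_ext ?_)
    exact (congrArg (fun t => t.1) r.2).trans (congrArg (fun t => t.1) r'.2).symm
  other t h h' := by
    induction t using walks_rec with
    | nil a => exact absurd rfl h'
    | cons a t _ => exact Or.inl ⟨initialIsInitial⟩

theorem hasInitialMember_map_some {X : EnrichedGraph V} {a : X.obj} {z : V}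
    (t : walks.carrier X.obj) (h : HasInitialMember (X.homs t.2.2)) :
    HasInitialMember ((prepend X a z).homs (walks.map some t).2.2) := by
  induction t using walks_rec with
  | nil x => exact h.elim
  | cons x t ih => exact h.imp id ih

/-- All homs into the additional object are initial. A sequence starting at an old object therefore
either stays among the old ones or passes through an initial hom. -/
theorem walk_prepend {X : EnrichedGraph V} {a : X.obj} {z : V}
    (t : walks.carrier (prepend X a z).obj) (h : t.1 ≠ none) :
    (∃ s : walks.carrier X.obj, t = walks.map some s) ∨
      HasInitialMember ((prepend X a z).homs t.2.2) := by
  induction t using walks_rec with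
  | nil x =>
    cases x with
    | none => exact absurd rfl h
    | some x => exact Or.inl ⟨nilT x, rfl⟩
  | cons x t ih =>
    cases x with
    | none => exact absurd rfl h
    | some x =>
      obtain ⟨y, y', p⟩ := t
      cases y with
      | none => exact Or.inr (Or.inl ⟨initialIsInitial⟩)
      | some y =>
        obtain ⟨s, hs⟩ | hs := ih (Option.some_ne_none y)
        · refine Or.inl ⟨consT x s, ?_⟩
          exact congrArg (consT (some x)) hs
        · exact Or.inr (Or.inr hs)

/-- The line is extended at its start by one object and one edge to the former first object, and the
two universal properties combine. A competing sequence from the new start either leaves it by an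
initial hom, or returns to it by one, or follows the new edge and then competes in the old graph. -/
theorem IsPath.cons {l : FreeMon V} {P : walks.El V} {α : l ⟶ homsAt.obj P} (hα : IsPath l P α)
    (z : V) : IsPath (cons z l)
      ⟨prepend P.graph P.elt.1 z, consT none (walks.map some P.elt)⟩
      (consHom (prependEdge P.graph P.elt.1 z)
        (α ≫ homsAt.map (Shape.El.push (P := walks) (prependIncl P.graph P.elt.1 z) P.elt))) where
  isIso := by
    exact isIso_consHom (isIso_prependEdge P.graph P.elt.1 z)
          (IsIso.comp_isIso' hα.isIso (isIso_homsAt_push _ (isIso_prependIncl P.graph P.elt.1 z) _))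
  exists_lift x h := by
    obtain ⟨W, t⟩ := x
    induction t using walks_rec with
    | nil a => exact PEmpty.elim h
    | cons c t _ =>
      obtain ⟨g, h⟩ := h
      obtain ⟨r, hr⟩ := hα.exists_lift ⟨W, t⟩ h
      obtain ⟨P, s⟩ := P
      obtain ⟨r, e⟩ := r
      change P ⟶ W at r
      change walks.map r.onObj s = t at e
      subst e
      let d : prepend P s.1 z ⟶ W := prependDesc c r g
      have e : walks.map d.onObj (walks.map some s) = walks.map r.onObj s :=
        (walks.map_comp _ _ _).symm
      refine ⟨⟨d, congrArg (consT c) e⟩, ?_⟩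
      refine (congrArg (_ ≫ ·) (homsAt_map_consT d (a := none) (t := walks.map some s) rfl e)).trans ?_
      refine (consHom_comp _ _ _ _).trans (congrArg₂ consHom ?_ ?_)
      · exact (congrArg (_ ≫ ·) (Category.comp_id _)).trans (prependEdge_desc c r g)
      · refine (Category.assoc _ _ _).trans (Eq.trans (congrArg (α ≫ ·) ?_) hr)
        refine (homsAt.map_comp _ _).symm.trans (congrArg homsAt.map ?_)
        exact Shape.El.hom_ext (prependIncl_desc c r g)
  hom_ext x r r' h := by
    obtain ⟨W, t⟩ := x
    obtain ⟨P, s⟩ := P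
    induction t using walks_rec with
    | nil a =>
      exact absurd (show nilT a = consT (r.1.onObj none) (walks.map r.1.onObj (walks.map some s))
        from r.2.symm) nilT_ne_consT
    | cons c t _ =>
      obtain ⟨f, e⟩ := r
      obtain ⟨f', e'⟩ := r'
      change prepend P s.1 z ⟶ W at f f'
      have e := consT_inj (t := walks.map f.onObj (walks.map some s)) e
      have e' := consT_inj (t := walks.map f'.onObj (walks.map some s)) e'
      have k := (congrArg (_ ≫ ·) (homsAt_map_consT f e.1 e.2)).symm.trans
        (h.trans (congrArg (_ ≫ ·) (homsAt_map_consT f' e'.1 e'.2)))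
      have k := (consHom_comp _ _ _ _).symm.trans (k.trans (consHom_comp _ _ _ _))
      have k1 := congrArg Prod.fst k
      have k2 := congrArg Prod.snd k
      refine Shape.El.hom_ext ?_
      have k3 := hα.hom_ext ⟨W, t⟩
        (Shape.El.push (P := walks) (prependIncl P s.1 z) s ≫ ⟨f, e.2⟩)
        (Shape.El.push (P := walks) (prependIncl P s.1 z) s ≫ ⟨f', e'.2⟩) (by
          refine (congrArg (α ≫ ·) (homsAt.map_comp _ _)).trans ?_
          refine (Category.assoc _ _ _).symm.trans (Eq.trans k2 ?_)
          refine (Category.assoc _ _ _).trans ?_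
          exact (congrArg (α ≫ ·) (homsAt.map_comp _ _)).symm)
      have k4 := congrArg (fun m => m.1) k3
      refine prepend_hom_ext k4 (e.1.trans e'.1.symm)
        (congrArg (fun m : P ⟶ W => m.onObj s.1) k4) ?_
      -- The equations of the first components hold up to two identifications of homs; only their
      -- composite is of importance.
      have k5 : ∀ {Y : V} {q : (prepend P s.1 z).hom none (some s.1) ⟶ Y} {Y' Y'' : V}
          {q' : (prepend P s.1 z).hom none (some s.1) ⟶ Y'} (h₁ : Y = Y'') (h₂ : Y' = Y'')
          (h₃ : Y = Y'), prependEdge P s.1 z ≫ q ≫ eqToHom h₁ =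
            prependEdge P s.1 z ≫ q' ≫ eqToHom h₂ →
          prependEdge P s.1 z ≫ q ≫ eqToHom h₃ = prependEdge P s.1 z ≫ q' := by
        intro Y q Y' Y'' q' h₁ h₂ h₃ H
        subst h₁ h₃
        simpa using H
      exact k5 _ _ _ k1
  other t h h' := by
    obtain ⟨P, s⟩ := P
    induction t using walks_rec with
    | nil x =>
      have h1 : x = none := congrArg Prod.fst h
      have h2 : x = some s.2.1 := congrArg Prod.snd h
      rw [h1] at h2
      exact absurd h2 (by simp)
    | cons x t _ =>
      have h1 : x = none := congrArg Prod.fst h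
      subst h1
      have h2 : t.2.1 = some s.2.1 := congrArg Prod.snd h
      -- Here the first step would be a loop at the additional object, whose hom is initial.
      by_cases h3 : t.1 = none
      · obtain ⟨y, y', p⟩ := t
        have h3 : y = none := h3
        subst h3
        exact Or.inl ⟨initialIsInitial⟩
      obtain ⟨q, rfl⟩ | hq := walk_prepend (X := P) (a := s.1) (z := z) t h3
      · have h4 : q.2.1 = s.2.1 := Option.some.inj h2
        -- If the first step does not lead to the former first object, its hom is an empty
        -- coproduct. Otherwise the remainder `q` has the ends of the old line but differs from it.
        by_cases h5 : q.1 = s.1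
        · refine Or.inr (hasInitialMember_map_some q (hα.other q (Prod.ext h5 h4) ?_))
          rintro rfl
          exact h' rfl
        · refine Or.inl ⟨IsInitial.ofUniqueHom
            (fun W => Sigma.desc fun e => absurd e.down.down h5) fun W m => ?_⟩
          exact Sigma.hom_ext _ _ fun e => absurd e.down.down h5
      · exact Or.inr hq

theorem exists_isPath (Z : FreeMon V) : ∃ P α, IsPath Z P α := by
  induction Z with
  | nil => exact ⟨⟨point V, nilT PUnit.unit⟩, 𝟙 (nil : FreeMon V), isPath_nil⟩
  | cons z l ih =>
    obtain ⟨P, α, h⟩ := ih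
    exact ⟨_, _, h.cons z⟩

end Path

/-! ### Realizing morphisms of nested sequences by morphisms of graphs. -/

section Realization

variable {V : Type u} [Category.{v} V] [HasCoproducts.{v} V]

/-- Edges realizing `φ` are adjoined one by one in front of graphs realizing `ζ`. Each inclusion is
invertible on homs, so what has been realized before is not disturbed. The equation between `t.2.1`
and `R.1` allows the new sequence to be joined to the nested one. -/
theorem exists_realization_append {X Y : EnrichedGraph V} (f : X ⟶ Y) {R : nested.carrier X.obj}
    {R' : nested.carrier Y.obj} (hR : nested.map f.onObj R = R') {L L' : FreeMon (FreeMon V)}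
    (ζ : L ⟶ L') (β : L ⟶ nestedHomsAt.obj ⟨X, R⟩) (β' : L' ⟶ nestedHomsAt.obj ⟨Y, R'⟩)
    (hβ : IsIso β) (hβ' : IsIso β')
    (w : β ≫ nestedHomsAt.map (⟨f, hR⟩ : (⟨X, R⟩ : nested.El V) ⟶ ⟨Y, R'⟩) = ζ ≫ β')
    (l : FreeMon V) : ∀ (l' : FreeMon V) (φ : l ⟶ l'),
    ∃ (X Y : EnrichedGraph V) (f : X ⟶ Y) (t : walks.carrier X.obj) (t' : walks.carrier Y.obj)
      (R : nested.carrier X.obj) (R' : nested.carrier Y.obj) (ht : walks.map f.onObj t = t')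
      (hR : nested.map f.onObj R = R') (α : l ⟶ homsAt.obj ⟨X, t⟩) (α' : l' ⟶ homsAt.obj ⟨Y, t'⟩)
      (β : L ⟶ nestedHomsAt.obj ⟨X, R⟩) (β' : L' ⟶ nestedHomsAt.obj ⟨Y, R'⟩),
      t.2.1 = R.1 ∧ IsIso α ∧ IsIso α' ∧ IsIso β ∧ IsIso β' ∧
      α ≫ homsAt.map (⟨f, ht⟩ : (⟨X, t⟩ : walks.El V) ⟶ ⟨Y, t'⟩) = φ ≫ α' ∧
      β ≫ nestedHomsAt.map (⟨f, hR⟩ : (⟨X, R⟩ : nested.El V) ⟶ ⟨Y, R'⟩) = ζ ≫ β' := by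
  induction l with
  | nil =>
    intro l' φ
    cases l' with
    | cons => exact PEmpty.elim φ
    | nil =>
      -- The empty sequence is placed at the first object of the nested one, where edges will be
      -- adjoined.
      exact ⟨X, Y, f, nilT R.1, nilT R'.1, R, R',
        congrArg (fun R : nested.carrier Y.obj => nilT R.1) hR, hR, 𝟙 (nil : FreeMon V),
        𝟙 (nil : FreeMon V), β, β', rfl, inferInstanceAs (IsIso (𝟙 (nil : FreeMon V))),
        inferInstanceAs (IsIso (𝟙 (nil : FreeMon V))), hβ, hβ', nil_hom_ext _ _, w⟩
  | cons z l ih =>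
    intro l' φ
    cases l' with
    | nil => exact PEmpty.elim φ
    | cons z' l' =>
      obtain ⟨g, φ⟩ := φ
      obtain ⟨X, Y, f, t, t', R, R', ht, hR, α, α', β, β', h0, h1, h2, h3, h4, h5, h6⟩ := ih l' φ
      subst ht hR
      let d : prepend X t.1 z ⟶ prepend Y (f.onObj t.1) z' :=
        prependDesc none (f ≫ prependIncl Y (f.onObj t.1) z')
          (g ≫ prependEdge Y (f.onObj t.1) z')
      have hd : prependIncl X t.1 z ≫ d = f ≫ prependIncl Y (f.onObj t.1) z' :=
        prependIncl_desc _ _ _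
      have e : walks.map d.onObj (walks.map some t) = walks.map some (walks.map f.onObj t) :=
        (walks.map_comp _ _ _).symm.trans (walks.map_comp f.onObj some t)
      have e' : nested.map d.onObj (nested.map some R) = nested.map some (nested.map f.onObj R) :=
        (nested.map_comp _ _ _).symm.trans (nested.map_comp f.onObj some R)
      refine ⟨prepend X t.1 z, prepend Y (f.onObj t.1) z', d, consT none (walks.map some t),
        consT none (walks.map some (walks.map f.onObj t)), nested.map some R,
        nested.map some (nested.map f.onObj R), congrArg (consT none) e, e',
        consHom (prependEdge X t.1 z) (α ≫ homsAt.map (Shape.El.push (prependIncl X t.1 z) t)),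
        consHom (prependEdge Y (f.onObj t.1) z') (α' ≫ homsAt.map (Shape.El.push
          (prependIncl Y (f.onObj t.1) z') (walks.map f.onObj t))),
        β ≫ nestedHomsAt.map (Shape.El.push (prependIncl X t.1 z) R),
        β' ≫ nestedHomsAt.map (Shape.El.push (prependIncl Y (f.onObj t.1) z')
          (nested.map f.onObj R)), congrArg some h0, ?_, ?_, ?_, ?_, ?_, ?_⟩
      · exact isIso_consHom (isIso_prependEdge X t.1 z)
          (IsIso.comp_isIso' h1 (isIso_homsAt_push _ (isIso_prependIncl X t.1 z) _))
      · exact isIso_consHom (isIso_prependEdge Y (f.onObj t.1) z')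
          (IsIso.comp_isIso' h2 (isIso_homsAt_push _ (isIso_prependIncl Y (f.onObj t.1) z') _))
      · exact IsIso.comp_isIso' h3 (isIso_nestedHomsAt_push _ (isIso_prependIncl X t.1 z) _)
      · exact IsIso.comp_isIso' h4 (isIso_nestedHomsAt_push _ (isIso_prependIncl Y (f.onObj t.1) z') _)
      · refine (congrArg (_ ≫ ·) (homsAt_map_consT d (a := none)
          (t := walks.map some t) rfl e)).trans ?_
        refine (consHom_comp _ _ _ _).trans (congrArg₂ consHom ?_ ?_)
        · exact (congrArg (_ ≫ ·) (Category.comp_id _)).trans (prependEdge_desc _ _ _)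
        · have h7 : Shape.El.push (P := walks) (prependIncl X t.1 z) t ≫ ⟨d, e⟩ =
              Shape.El.push f t ≫ Shape.El.push (prependIncl Y (f.onObj t.1) z')
                (walks.map f.onObj t) := Shape.El.hom_ext hd
          have h8 := (homsAt.map_comp _ _).symm.trans
            ((congrArg homsAt.map h7).trans (homsAt.map_comp _ _))
          refine (Category.assoc _ _ _).trans ((congrArg (α ≫ ·) h8).trans ?_)
          refine (Category.assoc _ _ _).symm.trans ((congrArg (· ≫ _) h5).trans ?_)
          exact Category.assoc _ _ _
      · have h7 : Shape.El.push (P := nested) (prependIncl X t.1 z) R ≫ ⟨d, e'⟩ =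
            Shape.El.push f R ≫ Shape.El.push (prependIncl Y (f.onObj t.1) z')
              (nested.map f.onObj R) := Shape.El.hom_ext hd
        have h8 := (nestedHomsAt.map_comp _ _).symm.trans
          ((congrArg nestedHomsAt.map h7).trans (nestedHomsAt.map_comp _ _))
        refine (Category.assoc _ _ _).trans ((congrArg (β ≫ ·) h8).trans ?_)
        refine (Category.assoc _ _ _).symm.trans ((congrArg (· ≫ _) h6).trans ?_)
        exact Category.assoc _ _ _

/-- Every morphism of doubly nested sequences is, up to isomorphism, induced by a morphism of
graphs. -/
theorem exists_realization (L : FreeMon (FreeMon V)) : ∀ (L' : FreeMon (FreeMon V)) (ζ : L ⟶ L'),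
    ∃ (x y : nested.El V) (F : x ⟶ y) (β : L ⟶ nestedHomsAt.obj x) (β' : L' ⟶ nestedHomsAt.obj y),
      IsIso β ∧ IsIso β' ∧ β ≫ nestedHomsAt.map F = ζ ≫ β' := by
  induction L with
  | nil =>
    intro L' ζ
    cases L' with
    | cons => exact PEmpty.elim ζ
    | nil =>
      exact ⟨⟨point V, ⟨PUnit.unit, PUnit.unit, .nil _⟩⟩, ⟨point V, ⟨PUnit.unit, PUnit.unit, .nil _⟩⟩,
        𝟙 _, 𝟙 (nil : FreeMon (FreeMon V)), 𝟙 (nil : FreeMon (FreeMon V)),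
        inferInstanceAs (IsIso (𝟙 (nil : FreeMon (FreeMon V)))),
        inferInstanceAs (IsIso (𝟙 (nil : FreeMon (FreeMon V)))), nil_hom_ext _ _⟩
  | cons l L ih =>
    intro L' ζ
    cases L' with
    | nil => exact PEmpty.elim ζ
    | cons l' L' =>
      obtain ⟨φ, ζ⟩ := ζ
      obtain ⟨⟨X, R⟩, ⟨Y, R'⟩, ⟨f, hR⟩, β, β', hβ, hβ', w⟩ := ih L' ζ
      obtain ⟨X, Y, f, t, t', R, R', ht, hR, α, α', β, β', h0, h1, h2, h3, h4, h5, h6⟩ :=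
        exists_realization_append f hR ζ β β' hβ hβ' w l l' φ
      subst ht hR
      obtain ⟨a, b, p⟩ := t
      obtain ⟨b', c, R⟩ := R
      -- The sequence realizing `φ` ends where the nested one starts, so it becomes its first
      -- member.
      have h0 : b = b' := h0
      subst h0
      refine ⟨⟨X, consN p R⟩, ⟨Y, nested.map f.onObj (consN p R)⟩, Shape.El.push f (consN p R),
        consHom α β, consHom α' β', isIso_consHom h1 h3, isIso_consHom h2 h4, ?_⟩
      refine (congrArg (_ ≫ ·) (nestedHomsAt_map_push f (consN p R))).trans ?_
      refine (consHom_comp _ _ _ _).trans (congrArg₂ consHom ?_ ?_)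
      · exact (congrArg (α ≫ ·) (homsAt_map_push f ⟨a, b, p⟩).symm).trans h5
      · exact (congrArg (β ≫ ·) (nestedHomsAt_map_push f ⟨b, c, R⟩).symm).trans h6

/-- Cancelling the isomorphism in `substNat` shows that the squares of σ at morphisms induced by
graphs are pullbacks. By `exists_realization` every square of σ is isomorphic to one of these. -/
theorem subst_equifibered {E : Multitensor V} (h : NatTrans.Equifibered (substNat E)) :
    NatTrans.Equifibered E.subst := by
  intro L L' ζ
  obtain ⟨x, y, F, β, β', hβ, hβ', w⟩ := exists_realization L L' ζ
  have h' := (h.comp (NatTrans.Equifibered.of_isIso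
    (Functor.isoWhiskerRight nestedHomsJoin E.tensor).inv)) F
  have k (x : nested.El V) : (substNat E ≫ (Functor.isoWhiskerRight nestedHomsJoin
      E.tensor).inv).app x = E.subst.app (nestedHomsAt.obj x) := by
    refine congrArg (fun m : nestedTensorAt E.tensor ⟶ _ => m.app x)
      ((Category.assoc _ _ _).trans ((congrArg (_ ≫ ·) ?_).trans (Category.comp_id _)))
    exact (Functor.isoWhiskerRight nestedHomsJoin E.tensor).hom_inv_id
  rw [k, k] at h'
  have s (Q : FreeMon (FreeMon V) ⥤ V) : Q.map ζ ≫ Q.map β' = Q.map β ≫ Q.map (nestedHomsAt.map F) := by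
    rw [← Q.map_comp, ← Q.map_comp, w]
  exact h'.of_iso (asIso ((mapSeq E.tensor ⋙ E.tensor).map β)).symm
    (asIso ((mapSeq E.tensor ⋙ E.tensor).map β')).symm
    (asIso ((join ⋙ E.tensor).map β)).symm (asIso ((join ⋙ E.tensor).map β')).symm
    ((Iso.eq_inv_comp _).2 ((Category.assoc _ _ _).symm.trans ((Iso.comp_inv_eq _).2 (s (mapSeq E.tensor ⋙ E.tensor)).symm)))
    ((Iso.eq_inv_comp _).2 ((Category.assoc _ _ _).symm.trans
      ((Iso.comp_inv_eq _).2 (E.subst.naturality β))))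
    ((Iso.eq_inv_comp _).2 ((Category.assoc _ _ _).symm.trans
      ((Iso.comp_inv_eq _).2 (E.subst.naturality β'))))
    ((Iso.eq_inv_comp _).2 ((Category.assoc _ _ _).symm.trans ((Iso.comp_inv_eq _).2 (s (join ⋙ E.tensor)).symm)))

end Realization

/-! ### Preservation of pullbacks in terms of squares. -/

section PreservesPullbacks

variable {C D : Type*} [Category* C] [Category* D]

theorem preservesPullbacks_iff (F : C ⥤ D) :
    PreservesLimitsOfShape WalkingCospan F ↔
      ∀ {P X Y Z : C} {f : P ⟶ X} {g : P ⟶ Y} {h : X ⟶ Z} {k : Y ⟶ Z}, IsPullback f g h k →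
        IsPullback (F.map f) (F.map g) (F.map h) (F.map k) := by
  refine ⟨fun _ _ _ _ _ _ _ _ _ H => H.map F, fun H => ⟨fun {K} => ?_⟩⟩
  have : PreservesLimit (cospan (K.map WalkingCospan.Hom.inl) (K.map WalkingCospan.Hom.inr)) F := by
    refine ⟨fun {c} hc => ?_⟩
    have h1 := IsPullback.of_isLimit_cone hc
    have : PreservesLimit (cospan (K.map WalkingCospan.Hom.inl) (K.map WalkingCospan.Hom.inr)) F :=
      preservesLimit_of_preserves_limit_cone h1.isLimit
        ((isLimitMapConePullbackConeEquiv F h1.w).symm (H h1).isLimit)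
    exact ⟨isLimitOfPreserves F hc⟩
  exact preservesLimit_of_iso_diagram F (diagramIsoCospan K).symm

theorem comp_map_comp_map (F : C ⥤ D) {K : D} {X Y Z : C} (x : K ⟶ F.obj X) {a : X ⟶ Y} {b : Y ⟶ Z}
    {c : X ⟶ Z} (h : a ≫ b = c) : (x ≫ F.map a) ≫ F.map b = x ≫ F.map c := by
  rw [Category.assoc, ← F.map_comp, h]

end PreservesPullbacks

/-! ### Pullbacks under homs along sequences, ΓE and E. -/

section Paths

variable {V : Type u} [Category.{v} V]

/-- The set of objects is the pullback of the sets of objects, and each hom is a pullback of homs in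
V after the two endpoints in `Z` have been identified. -/
theorem exists_isPullback [HasPullbacks V] {X Y Z : EnrichedGraph V} (h : X ⟶ Z) (k : Y ⟶ Z) :
    ∃ (P : EnrichedGraph V) (f : P ⟶ X) (g : P ⟶ Y), IsPullback f g h k := by
  let N := { p : X.obj × Y.obj // k.onObj p.2 = h.onObj p.1 }
  let a (p q : N) := h.onHom p.1.1 q.1.1
  let b (p q : N) := k.onHom p.1.2 q.1.2 ≫ eqToHom (congrArg₂ Z.hom p.2 q.2)
  let P : EnrichedGraph V := ⟨N, fun p q => pullback (a p q) (b p q)⟩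
  let f : EnrichedGraph.Hom P X := ⟨fun p => p.1.1, fun p q => pullback.fst (a p q) (b p q)⟩
  let g : EnrichedGraph.Hom P Y := ⟨fun p => p.1.2, fun p q => pullback.snd (a p q) (b p q)⟩
  refine ⟨P, f, g, isPullback_of_exists (Eq.symm ?_) (fun Q u v e => ?_) fun Q l l' h1 h2 => ?_⟩
  · refine graph_hom_ext (fun p => p.2) fun p q => ?_
    exact (Category.assoc _ _ _).trans (pullback.condition (f := a p q) (g := b p q)).symm
  · let o (q : Q.obj) : N := ⟨(u.onObj q, v.onObj q),
      congrArg (fun m : Q ⟶ Z => m.onObj q) e.symm⟩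
    let l : EnrichedGraph.Hom Q P := ⟨o, fun p q => pullback.lift (f := a (o p) (o q))
      (g := b (o p) (o q)) (u.onHom p q) (v.onHom p q)
      ((onHom_congr e.symm p q).symm.trans (Category.assoc _ _ _))⟩
    exact ⟨l, EnrichedGraph.Hom.congr fun p q => pullback.lift_fst _ _ _,
      EnrichedGraph.Hom.congr fun p q => pullback.lift_snd _ _ _⟩
  · obtain ⟨o, φ⟩ := l
    obtain ⟨o', ψ⟩ := l'
    obtain rfl : o = o' := funext fun q => Subtype.ext (Prod.ext
      (congrArg (fun m : Q ⟶ X => m.onObj q) h1) (congrArg (fun m : Q ⟶ Y => m.onObj q) h2))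
    refine EnrichedGraph.Hom.congr fun p q =>
      pullback.hom_ext (f := a (o p) (o q)) (g := b (o p) (o q)) ?_ ?_
    · exact (Category.comp_id _).symm.trans (onHom_congr h1 p q)
    · exact (Category.comp_id _).symm.trans (onHom_congr h2 p q)

variable [HasCoproducts.{v} V]

/-- The free graph on a sequence of homs, with its defining sequence of objects. -/
noncomputable def path (Z : FreeMon V) : walks.El V := (exists_isPath Z).choose

/-- The identification of a sequence with the sequence of homs of the graph free on it. -/
noncomputable def pathUnit (Z : FreeMon V) : Z ⟶ homsAt.obj (path Z) :=
  (exists_isPath Z).choose_spec.choose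

theorem isPath_path (Z : FreeMon V) : IsPath Z (path Z) (pathUnit Z) :=
  (exists_isPath Z).choose_spec.choose_spec

instance (Z : FreeMon V) : IsIso (pathUnit Z) := (isPath_path Z).isIso

/-- The morphism from a free graph given by a morphism of sequences. -/
noncomputable def pathDesc {Z : FreeMon V} {x : walks.El V} (h : Z ⟶ homsAt.obj x) : path Z ⟶ x :=
  ((isPath_path Z).exists_lift x h).choose

theorem pathUnit_desc {Z : FreeMon V} {x : walks.El V} (h : Z ⟶ homsAt.obj x) :
    pathUnit Z ≫ homsAt.map (pathDesc h) = h :=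
  ((isPath_path Z).exists_lift x h).choose_spec

theorem path_hom_ext {Z : FreeMon V} {x : walks.El V} {r r' : path Z ⟶ x}
    (h : pathUnit Z ≫ homsAt.map r = pathUnit Z ≫ homsAt.map r') : r = r' :=
  (isPath_path Z).hom_ext x r r' h

/-- A morphism from Q to the homs along a sequence is a morphism out of `path Q` preserving the
chosen sequence, so the universal property of the graph pullback transfers. -/
theorem homsAt_isPullback {x x₁ x₂ x₃ : walks.El V} {f : x ⟶ x₁} {g : x ⟶ x₂} {h : x₁ ⟶ x₃}
    {k : x₂ ⟶ x₃} (H : IsPullback f.1 g.1 h.1 k.1) :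
    IsPullback (homsAt.map f) (homsAt.map g) (homsAt.map h) (homsAt.map k) := by
  have w : f ≫ h = g ≫ k := Shape.El.hom_ext H.w
  refine isPullback_of_exists ((homsAt.map_comp _ _).symm.trans
    ((congrArg homsAt.map w).trans (homsAt.map_comp _ _))) (fun Q u v e => ?_)
    fun Q l l' h1 h2 => ?_
  · have e' : pathDesc u ≫ h = pathDesc v ≫ k := path_hom_ext (by
      rw [homsAt.map_comp, homsAt.map_comp, ← Category.assoc, ← Category.assoc, pathUnit_desc,
        pathUnit_desc, e])
    let r := H.lift (pathDesc u).1 (pathDesc v).1 (congrArg (fun m => m.1) e')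
    have r1 : r ≫ f.1 = (pathDesc u).1 := H.lift_fst _ _ _
    have r2 : r ≫ g.1 = (pathDesc v).1 := H.lift_snd _ _ _
    -- The graph pullback ignores the chosen sequences; that `r` respects them follows since
    -- sequences in a pullback are determined by their two projections.
    have hr : walks.map r.onObj (path Q).elt = x.elt := by
      refine walks_map_injective (f := f.1.onObj) (g := g.1.onObj)
        (fun s s' => isPullback_obj_injective H s s') _ _ ?_ ?_
      · refine (walks.map_comp _ _ _).symm.trans (Eq.trans ?_ ((pathDesc u).2.trans f.2.symm))
        exact congrArg (fun m : (path Q).graph ⟶ x₁.graph => walks.map m.onObj (path Q).elt) r1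
      · refine (walks.map_comp _ _ _).symm.trans (Eq.trans ?_ ((pathDesc v).2.trans g.2.symm))
        exact congrArg (fun m : (path Q).graph ⟶ x₂.graph => walks.map m.onObj (path Q).elt) r2
    let r' : path Q ⟶ x := ⟨r, hr⟩
    have r1' : r' ≫ f = pathDesc u := Shape.El.hom_ext r1
    have r2' : r' ≫ g = pathDesc v := Shape.El.hom_ext r2
    refine ⟨pathUnit Q ≫ homsAt.map r', ?_, ?_⟩
    · rw [Category.assoc, ← homsAt.map_comp, r1', pathUnit_desc]
    · rw [Category.assoc, ← homsAt.map_comp, r2', pathUnit_desc]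
  · have k1 : pathDesc l ≫ f = pathDesc l' ≫ f := path_hom_ext (by
      rw [homsAt.map_comp, homsAt.map_comp, ← Category.assoc, ← Category.assoc, pathUnit_desc,
        pathUnit_desc, h1])
    have k2 : pathDesc l ≫ g = pathDesc l' ≫ g := path_hom_ext (by
      rw [homsAt.map_comp, homsAt.map_comp, ← Category.assoc, ← Category.assoc, pathUnit_desc,
        pathUnit_desc, h2])
    have : pathDesc l = pathDesc l' := Shape.El.hom_ext
      (H.hom_ext (congrArg (fun m => m.1) k1) (congrArg (fun m => m.1) k2))
    rw [← pathUnit_desc l, this, pathUnit_desc]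

/-- Connected edges reduce the claim to two pullbacks: that of sequences of objects, and, over each
sequence, that of homs along it, which E preserves. -/
theorem gamma_isPullback {E : FreeMon V ⥤ V} (hV : HasConnectedDecompositions V)
    (hE : PreservesLimitsOfShape WalkingCospan E) {P X Y Z : EnrichedGraph V} {f : P ⟶ X}
    {g : P ⟶ Y} {h : X ⟶ Z} {k : Y ⟶ Z} (H : IsPullback f g h k) :
    IsPullback ((Gamma.functor E).map f) ((Gamma.functor E).map g) ((Gamma.functor E).map h)
      ((Gamma.functor E).map k) := by
  -- The two images of `t` in `Z` are only propositionally equal, so that equation enters as an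
  -- argument.
  have key (t : walks.carrier P.obj) (e : walks.map k.onObj (walks.map g.onObj t) =
      walks.map h.onObj (walks.map f.onObj t)) :
      IsPullback ((tensorAt E).map (Shape.El.push (P := walks) f t))
        ((tensorAt E).map (Shape.El.push (P := walks) g t))
        ((tensorAt E).map (Shape.El.push (P := walks) h (walks.map f.onObj t)))
        ((tensorAt E).map (⟨k, e⟩ : (⟨Y, walks.map g.onObj t⟩ : walks.El V) ⟶ _)) :=
    (homsAt_isPullback H).map E
  have inj := walks_map_injective (f := f.onObj) (g := g.onObj)
    (fun s s' => isPullback_obj_injective H s s')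
  refine isPullback_of_edges hV (((Gamma.functor E).map_comp _ _).symm.trans
    ((congrArg (Gamma.functor E).map H.w).trans ((Gamma.functor E).map_comp _ _)))
    (fun x y e => isPullback_obj H e) (fun p q e e' => isPullback_obj_injective H p q e e')
    (fun C hC u v e => ?_) fun C hC l l' h1 h2 => ?_
  · obtain ⟨t, a, rfl⟩ := exists_pack E hC (X := X) u
    obtain ⟨t', b, rfl⟩ := exists_pack E hC (X := Y) v
    have e1 := pack_inj_walk hC ((pack_comp E t a h rfl).symm.trans
      (e.trans (pack_comp E t' b k rfl)))
    obtain ⟨s, rfl, rfl⟩ := exists_walks_lift (fun x y e => isPullback_obj H e) t t' e1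
    have e2 := pack_inj_same hC ((pack_comp E _ a h rfl).symm.trans
      (e.trans (pack_comp E _ b k e1.symm)))
    refine ⟨pack E s ((key s e1.symm).lift a b e2), ?_, ?_⟩
    · exact (pack_comp E s _ f rfl).trans
        (congrArg (pack E (walks.map f.onObj s)) ((key s e1.symm).lift_fst _ _ _))
    · exact (pack_comp E s _ g rfl).trans
        (congrArg (pack E (walks.map g.onObj s)) ((key s e1.symm).lift_snd _ _ _))
  · obtain ⟨t, a, rfl⟩ := exists_pack E hC (X := P) l
    obtain ⟨t', b, rfl⟩ := exists_pack E hC (X := P) l'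
    have e1 := (pack_comp E t a f rfl).symm.trans (h1.trans (pack_comp E t' b f rfl))
    have e2 := (pack_comp E t a g rfl).symm.trans (h2.trans (pack_comp E t' b g rfl))
    have := inj t t' (pack_inj_walk hC e1) (pack_inj_walk hC e2)
    subst this
    refine congrArg (pack E t) ((key t ?_).hom_ext (pack_inj_same hC e1) (pack_inj_same hC e2))
    refine (walks.map_comp _ _ _).symm.trans (Eq.trans ?_ (walks.map_comp _ _ _))
    exact congrArg (fun m : P ⟶ Z => walks.map m.onObj t) H.w.symm

/-- Compare with the graph pullback `Q` of the path graphs, which ΓE preserves. Nothing identifies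
`Q` with `path A`, but `A` is a retract of the homs along a suitable sequence in `Q`, and this is
enough. -/
theorem tensor_isPullback [HasPullbacks V] {E : FreeMon V ⥤ V} (hV : HasConnectedDecompositions V)
    (hE : PreservesLimitsOfShape WalkingCospan (Gamma.functor E)) {A B C D : FreeMon V} {f : A ⟶ B}
    {g : A ⟶ C} {h : B ⟶ D} {k : C ⟶ D} (H : IsPullback f g h k) :
    IsPullback (E.map f) (E.map g) (E.map h) (E.map k) := by
  let h' : path B ⟶ path D := pathDesc (h ≫ pathUnit D)
  let k' : path C ⟶ path D := pathDesc (k ≫ pathUnit D)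
  obtain ⟨Q, q₁, q₂, hQ⟩ := exists_isPullback h'.1 k'.1
  have hQ' := hQ.map (Gamma.functor E)
  -- Homs along a sequence of `Q` over the two given lines map compatibly to `B` and `C`, hence to
  -- their pullback `A`.
  have ret (t : walks.carrier Q.obj) (h₁ : walks.map q₁.onObj t = (path B).elt)
      (h₂ : walks.map q₂.onObj t = (path C).elt) : ∃ ρ : homsAt.obj ⟨Q, t⟩ ⟶ A,
        ρ ≫ f ≫ pathUnit B = homsAt.map ⟨q₁, h₁⟩ ∧ ρ ≫ g ≫ pathUnit C = homsAt.map ⟨q₂, h₂⟩ := by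
    let p₁ : (⟨Q, t⟩ : walks.El V) ⟶ path B := ⟨q₁, h₁⟩
    let p₂ : (⟨Q, t⟩ : walks.El V) ⟶ path C := ⟨q₂, h₂⟩
    have w : p₁ ≫ h' = p₂ ≫ k' := Shape.El.hom_ext hQ.w
    have e : (homsAt.map p₁ ≫ inv (pathUnit B)) ≫ h = (homsAt.map p₂ ≫ inv (pathUnit C)) ≫ k := by
      rw [← cancel_mono (pathUnit D)]
      have e1 : inv (pathUnit B) ≫ h ≫ pathUnit D = homsAt.map h' := by
        rw [IsIso.inv_comp_eq]; exact (pathUnit_desc _).symm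
      have e2 : inv (pathUnit C) ≫ k ≫ pathUnit D = homsAt.map k' := by
        rw [IsIso.inv_comp_eq]; exact (pathUnit_desc _).symm
      simp only [Category.assoc]
      rw [e1, e2, ← homsAt.map_comp, ← homsAt.map_comp, w]
    refine ⟨H.lift _ _ e, ?_, ?_⟩
    · rw [← Category.assoc, H.lift_fst, Category.assoc, IsIso.inv_hom_id, Category.comp_id]
    · rw [← Category.assoc, H.lift_snd, Category.assoc, IsIso.inv_hom_id, Category.comp_id]
  refine isPullback_of_connected hV (by rw [← E.map_comp, ← E.map_comp, H.w])
    (fun K hK u v e => ?_) fun K hK l l' h1 h2 => ?_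
  · have e' : pack E (path B).elt (u ≫ E.map (pathUnit B)) ≫ Gamma.map E h'.1 =
        pack E (path C).elt (v ≫ E.map (pathUnit C)) ≫ Gamma.map E k'.1 := by
      refine (pack_comp E _ _ h'.1 h'.2).trans (Eq.trans ?_ (pack_comp E _ _ k'.1 k'.2).symm)
      refine congrArg (pack E (path D).elt) ?_
      refine (comp_map_comp_map E u (pathUnit_desc (h ≫ pathUnit D))).trans
        (Eq.trans ?_ (comp_map_comp_map E v (pathUnit_desc (k ≫ pathUnit D))).symm)
      rw [E.map_comp, E.map_comp, ← Category.assoc, ← Category.assoc, e]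
    obtain ⟨t, w, hw⟩ := exists_pack E hK (X := Q) (hQ'.lift _ _ e')
    have h1 := hQ'.lift_fst _ _ e'
    have h2 := hQ'.lift_snd _ _ e'
    rw [hw] at h1 h2
    have h3 := pack_inj_walk hK ((pack_comp E t w q₁ rfl).symm.trans h1)
    have h4 := pack_inj_walk hK ((pack_comp E t w q₂ rfl).symm.trans h2)
    have h5 := pack_inj_same hK ((pack_comp E t w q₁ h3).symm.trans h1)
    have h6 := pack_inj_same hK ((pack_comp E t w q₂ h4).symm.trans h2)
    obtain ⟨ρ, r1, r2⟩ := ret t h3 h4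
    refine ⟨w ≫ E.map ρ, ?_, ?_⟩
    · rw [← cancel_mono (E.map (pathUnit B))]
      exact (Category.assoc _ _ _).trans ((congrArg (_ ≫ ·) (E.map_comp _ _).symm).trans
        ((comp_map_comp_map E w r1).trans h5))
    · rw [← cancel_mono (E.map (pathUnit C))]
      exact (Category.assoc _ _ _).trans ((congrArg (_ ≫ ·) (E.map_comp _ _).symm).trans
        ((comp_map_comp_map E w r2).trans h6))
  · let f' : path A ⟶ path B := pathDesc (f ≫ pathUnit B)
    let g' : path A ⟶ path C := pathDesc (g ≫ pathUnit C)
    have w : f' ≫ h' = g' ≫ k' := path_hom_ext (by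
      rw [homsAt.map_comp, homsAt.map_comp, ← Category.assoc, ← Category.assoc, pathUnit_desc,
        pathUnit_desc, Category.assoc, Category.assoc, pathUnit_desc, pathUnit_desc,
        ← Category.assoc, ← Category.assoc, H.w])
    let s := hQ.lift f'.1 g'.1 (congrArg (fun m => m.1) w)
    have s1 : s ≫ q₁ = f'.1 := hQ.lift_fst _ _ _
    have s2 : s ≫ q₂ = g'.1 := hQ.lift_snd _ _ _
    have h₁ : walks.map q₁.onObj (walks.map s.onObj (path A).elt) = (path B).elt :=
      (walks.map_comp _ _ _).symm.trans ((congrArg (fun m : (path A).graph ⟶ (path B).graph =>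
        walks.map m.onObj (path A).elt) s1).trans f'.2)
    have h₂ : walks.map q₂.onObj (walks.map s.onObj (path A).elt) = (path C).elt :=
      (walks.map_comp _ _ _).symm.trans ((congrArg (fun m : (path A).graph ⟶ (path C).graph =>
        walks.map m.onObj (path A).elt) s2).trans g'.2)
    obtain ⟨ρ, r1, r2⟩ := ret _ h₁ h₂
    have s1' : Shape.El.push s (path A).elt ≫ ⟨q₁, h₁⟩ = f' := Shape.El.hom_ext s1
    have s2' : Shape.El.push s (path A).elt ≫ ⟨q₂, h₂⟩ = g' := Shape.El.hom_ext s2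
    let d := pathUnit A ≫ homsAt.map (Shape.El.push s (path A).elt)
    -- So `E.map d` is a split monomorphism, and morphisms to `E.obj A` can be compared as edges of
    -- ΓE(Q).
    have hd : d ≫ ρ = 𝟙 A := by
      refine H.hom_ext ?_ ?_
      · rw [← cancel_mono (pathUnit B), Category.id_comp, Category.assoc, Category.assoc, r1]
        refine (Category.assoc _ _ _).trans ?_
        exact (congrArg (pathUnit A ≫ ·) ((homsAt.map_comp _ _).symm.trans
          (congrArg homsAt.map s1'))).trans (pathUnit_desc _)
      · rw [← cancel_mono (pathUnit C), Category.id_comp, Category.assoc, Category.assoc, r2]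
        refine (Category.assoc _ _ _).trans ?_
        exact (congrArg (pathUnit A ≫ ·) ((homsAt.map_comp _ _).symm.trans
          (congrArg homsAt.map s2'))).trans (pathUnit_desc _)
    have key (l : K ⟶ E.obj A) : pack E (walks.map s.onObj (path A).elt) (l ≫ E.map d) ≫
        Gamma.map E q₁ = pack E (path B).elt ((l ≫ E.map f) ≫ E.map (pathUnit B)) := by
      refine (pack_comp E _ _ q₁ h₁).trans (congrArg (pack E (path B).elt) ?_)
      refine (Category.assoc _ _ _).trans (Eq.trans (congrArg (l ≫ ·) ?_) (Category.assoc _ _ _).symm)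
      refine (E.map_comp _ _).symm.trans (Eq.trans (congrArg E.map ?_) (E.map_comp _ _))
      rw [← r1, ← Category.assoc, hd, Category.id_comp]
    have key' (l : K ⟶ E.obj A) : pack E (walks.map s.onObj (path A).elt) (l ≫ E.map d) ≫
        Gamma.map E q₂ = pack E (path C).elt ((l ≫ E.map g) ≫ E.map (pathUnit C)) := by
      refine (pack_comp E _ _ q₂ h₂).trans (congrArg (pack E (path C).elt) ?_)
      refine (Category.assoc _ _ _).trans (Eq.trans (congrArg (l ≫ ·) ?_) (Category.assoc _ _ _).symm)
      refine (E.map_comp _ _).symm.trans (Eq.trans (congrArg E.map ?_) (E.map_comp _ _))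
      rw [← r2, ← Category.assoc, hd, Category.id_comp]
    have h3 := pack_inj_same hK (hQ'.hom_ext
      ((key l).trans ((congrArg (fun m => pack E _ (m ≫ _)) h1).trans (key l').symm))
      ((key' l).trans ((congrArg (fun m => pack E _ (m ≫ _)) h2).trans (key' l').symm)))
    have h4 (l : K ⟶ E.obj A) : (l ≫ E.map d) ≫ E.map ρ = l :=
      (comp_map_comp_map E l hd).trans ((congrArg (l ≫ ·) (E.map_id A)).trans (Category.comp_id l))
    exact (h4 l).symm.trans ((congrArg (· ≫ E.map ρ) h3).trans (h4 l'))

theorem isCartesian_iff {E : Multitensor V} (hE : E.IsDistributive) [HasPullbacks V]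
    (hV : HasConnectedDecompositions V) : E.IsCartesian ↔ IsCartesianMonad (E.gamma hE) where
  mp h := ⟨(preservesPullbacks_iff (Gamma.functor E.tensor)).2
      (fun H => gamma_isPullback hV h.preservesPullbacks H),
    gamma_unit_equifibered hV hE h.unit,
    gamma_mult_equifibered hV hE (substNat_equifibered h.subst)⟩
  mpr h := ⟨(preservesPullbacks_iff E.tensor).2
      (fun H => tensor_isPullback hV h.preservesPullbacks H),
    unit_equifibered_of_gamma hV hE h.unit,
    subst_equifibered (substNat_equifibered_of_gamma hV hE h.mult)⟩

end Paths

/-! ### Local right adjoints through generic factorizations. -/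

section Generic

variable {C D : Type*} [Category* C] [Category* D]

/-- The factorization of `b` through `F.map m` is initial among the factorizations of `b` through
images of morphisms over the same object. -/
structure IsGeneric (F : C ⥤ D) {X A : C} {B : D} (b : B ⟶ F.obj X) (g : B ⟶ F.obj A)
    (m : A ⟶ X) : Prop where
  fac : g ≫ F.map m = b
  exists_lift : ∀ (A' : C) (m' : A' ⟶ X) (g' : B ⟶ F.obj A'), g' ≫ F.map m' = b →
    ∃ t : A ⟶ A', t ≫ m' = m ∧ g ≫ F.map t = g'
  hom_ext : ∀ (A' : C) (m' : A' ⟶ X) (t t' : A ⟶ A'), t ≫ m' = m → t' ≫ m' = m →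
    g ≫ F.map t = g ≫ F.map t' → t = t'

/-- The functor on slices is a right adjoint exactly when each of its categories of structured
arrows has an initial object; a generic factorization is such an object written out. -/
theorem isLocalRightAdjoint_iff (F : C ⥤ D) : IsLocalRightAdjoint F ↔
    ∀ (X : C) (B : D) (b : B ⟶ F.obj X), ∃ (A : C) (g : B ⟶ F.obj A) (m : A ⟶ X),
      IsGeneric F b g m := by
  refine forall_congr' fun X => isRightAdjoint_iff_hasInitial_structuredArrow.trans
    ⟨fun H B b => ?_, fun H Y => ?_⟩
  · have := H (Over.mk b)
    let T : StructuredArrow (Over.mk b) (Over.post (X := X) F) := ⊥_ _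
    let mk (A' : C) (m' : A' ⟶ X) (g' : B ⟶ F.obj A') (w : g' ≫ F.map m' = b) :
        StructuredArrow (Over.mk b) (Over.post (X := X) F) :=
      StructuredArrow.mk (Y := Over.mk m') (Over.homMk g' w)
    have w : T.hom.left ≫ F.map T.right.hom = b := Over.w T.hom
    refine ⟨T.right.left, T.hom.left, T.right.hom, w, fun A' m' g' w' => ?_,
      fun A' m' t t' h h' e => ?_⟩
    · let k : T ⟶ mk A' m' g' w' := initial.to _
      exact ⟨k.right.left, Over.w k.right, congrArg (fun m => m.left) (StructuredArrow.w k)⟩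
    · have w' : (T.hom.left ≫ F.map t) ≫ F.map m' = b := by
        exact (comp_map_comp_map F (X := T.right.left) T.hom.left h).trans w
      let k : T ⟶ mk A' m' _ w' := StructuredArrow.homMk (Over.homMk t h) (Over.OverMorphism.ext rfl)
      let k' : T ⟶ mk A' m' _ w' :=
        StructuredArrow.homMk (Over.homMk t' h') (Over.OverMorphism.ext e.symm)
      have : k = k' := initial.hom_ext _ _
      exact congrArg (fun k => k.right.left) this
  · obtain ⟨A, g, m, h⟩ := H Y.left Y.hom
    let T : StructuredArrow Y (Over.post (X := X) F) :=
      StructuredArrow.mk (Y := Over.mk m) (Over.homMk g h.fac)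
    have fac (S : StructuredArrow Y (Over.post (X := X) F)) :
        S.hom.left ≫ F.map S.right.hom = Y.hom := Over.w S.hom
    choose t h₁ h₂ using fun S => h.exists_lift _ _ _ (fac S)
    refine IsInitial.hasInitial (X := T) (IsInitial.ofUniqueHom (fun S =>
      StructuredArrow.homMk (Over.homMk (t S) (h₁ S)) (Over.OverMorphism.ext (h₂ S))) fun S k => ?_)
    refine StructuredArrow.ext _ _ (Over.OverMorphism.ext (h.hom_ext _ _ _ _ (Over.w k.right)
      (h₁ S) ?_))
    exact (congrArg (fun m => m.left) (StructuredArrow.w k)).trans (h₂ S).symm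

end Generic

/-! ### Generic factorizations for ΓE and for E. -/

section Gamma

variable {V : Type u} [Category.{v} V] [HasCoproducts.{v} V] {E : FreeMon V ⥤ V}

/-- The edge of `ΓE` of the graph free on a sequence given by a morphism to the value of `E`. -/
noncomputable def pathPack {C : V} (E : FreeMon V ⥤ V) {Z : FreeMon V} (g : C ⟶ E.obj Z) :
    edge C ⟶ Gamma.obj E (path Z).graph :=
  pack E (path Z).elt (g ≫ E.map (pathUnit Z))

theorem pathPack_comp {C : V} {Z : FreeMon V} (g : C ⟶ E.obj Z) {x : walks.El V}
    (r : path Z ⟶ x) : pathPack E g ≫ Gamma.map E r.1 =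
      pack E x.elt (g ≫ E.map (pathUnit Z ≫ homsAt.map r)) :=
  (pack_comp E _ _ r.1 r.2).trans
    (congrArg (pack E x.elt) (comp_map_comp_map E g rfl))

theorem pathPack_desc {C : V} {Z : FreeMon V} (g : C ⟶ E.obj Z) {x : walks.El V}
    (h : Z ⟶ homsAt.obj x) : pathPack E g ≫ Gamma.map E (pathDesc h).1 =
      pack E x.elt (g ≫ E.map h) :=
  (pathPack_comp g _).trans (congrArg (fun k => pack E x.elt (g ≫ E.map k)) (pathUnit_desc h))

theorem pathPack_map {C : V} {Z Z' : FreeMon V} (g : C ⟶ E.obj Z) (h : Z ⟶ Z') :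
    pathPack E g ≫ Gamma.map E (pathDesc (h ≫ pathUnit Z')).1 = pathPack E (g ≫ E.map h) :=
  (pathPack_desc g _).trans 
    (congrArg (pack E _) (comp_map_comp_map E g rfl).symm)

theorem pathDesc_comp {Z : FreeMon V} {x y : walks.El V} (h : Z ⟶ homsAt.obj x) (r : x ⟶ y) :
    pathDesc h ≫ r = pathDesc (h ≫ homsAt.map r) :=
  path_hom_ext (by rw [homsAt.map_comp, ← Category.assoc, pathUnit_desc, pathUnit_desc])

/-- Graphs with given sequences of objects can be glued to a set along the endpoints. -/
theorem exists_glued {N K : Type v} (G : K → walks.El V) (s e : K → N) :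
    ∃ (A : EnrichedGraph V) (j : ∀ k, (G k).graph ⟶ A) (q : N → A.obj),
      (∀ k, q (s k) = (j k).onObj (G k).elt.1) ∧ (∀ k, q (e k) = (j k).onObj (G k).elt.2.1) ∧
      (∀ (W : EnrichedGraph V) (ν : N → W.obj) (m : ∀ k, (G k).graph ⟶ W),
        (∀ k, ν (s k) = (m k).onObj (G k).elt.1) → (∀ k, ν (e k) = (m k).onObj (G k).elt.2.1) →
          ∃ τ : A ⟶ W, (∀ k, j k ≫ τ = m k) ∧ ∀ x, τ.onObj (q x) = ν x) ∧
      ∀ (W : EnrichedGraph V) (τ τ' : A ⟶ W), (∀ k, j k ≫ τ = j k ≫ τ') →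
        (∀ x, τ.onObj (q x) = τ'.onObj (q x)) → τ = τ' := by
  let r : N ⊕ (Σ k, (G k).graph.obj) → N ⊕ (Σ k, (G k).graph.obj) → Prop :=
    fun p q => (∃ k, p = .inl (s k) ∧ q = .inr ⟨k, (G k).elt.1⟩) ∨
      ∃ k, p = .inl (e k) ∧ q = .inr ⟨k, (G k).elt.2.1⟩
  obtain ⟨h, j, hj, hA⟩ := exists_isPush (fun k => (G k).graph) (N := Quot r)
    (fun k x => Quot.mk r (.inr ⟨k, x⟩))
  refine ⟨_, j, fun x => Quot.mk r (.inl x),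
    fun k => (Quot.sound (r := r) (Or.inl ⟨k, rfl, rfl⟩)).trans (hj k _).symm,
    fun k => (Quot.sound (r := r) (Or.inr ⟨k, rfl, rfl⟩)).trans (hj k _).symm,
    fun W ν m h₁ h₂ => ?_, fun W τ τ' H H' => hA.hom_ext W τ τ' ?_ H⟩
  · obtain ⟨τ, hτ, hτ'⟩ := hA.exists_lift W
      (Quot.lift (Sum.elim ν fun p => (m p.1).onObj p.2) (by
        rintro _ _ (⟨k, rfl, rfl⟩ | ⟨k, rfl, rfl⟩)
        · exact h₁ k
        · exact h₂ k)) m fun k x => by rw [hj]; rfl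
    exact ⟨τ, hτ', fun x => hτ _⟩
  · rintro ⟨x | ⟨k, x⟩⟩
    · exact H' x
    · have := congrArg (fun f : (G k).graph ⟶ W => f.onObj x) (H k)
      have h' : τ.onObj ((j k).onObj x) = τ'.onObj ((j k).onObj x) := this
      rw [hj k x] at h'
      exact h'

/-- Each generating edge of `Y` selects a sequence in `X` and a morphism to the value of E there,
which factors generically through some `Z k`. The graph sought is the union of the `path (Z k)`,
glued to the objects of `Y` at the ends of the corresponding edges. -/
theorem exists_generic_of_pack (hE : ∀ (Z : FreeMon V) (B : V) (b : B ⟶ E.obj Z),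
      ∃ (A : FreeMon V) (g : B ⟶ E.obj A) (m : A ⟶ Z), IsGeneric E b g m)
    {X Y : EnrichedGraph V} (y : Y ⟶ (Gamma.functor E).obj X) {K : Type v} {C : K → V}
    {i : ∀ k, edge (C k) ⟶ Y} (hi : IsPush (fun k => edge (C k)) Y i)
    (hC : ∀ k, IsConnectedObject (C k)) :
    ∃ (A : EnrichedGraph V) (g : Y ⟶ (Gamma.functor E).obj A) (m : A ⟶ X),
      IsGeneric (Gamma.functor E) y g m := by
  choose t a ha using fun k => exists_pack E (hC k) (X := X) (i k ≫ y)
  choose Z γ μ hγ using fun k => hE _ _ (a k)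
  -- Gluing along ends only is right because ΓE does not change objects: `g` needs an image `q` for
  -- every object of `Y`, and nothing more is forced.
  obtain ⟨A, j, q, hf, ht, build, ext⟩ := exists_glued (fun k => path (Z k))
    (fun k => (i k).onObj ⟨false⟩) (fun k => (i k).onObj ⟨true⟩)
  obtain ⟨g, hg, hg'⟩ := hi.exists_lift (Gamma.obj E A) q
    (fun k => pathPack E (γ k) ≫ Gamma.map E (j k)) (by
      rintro k ⟨_ | _⟩
      · exact (hf k).symm
      · exact (ht k).symm)
  obtain ⟨m, hm, hm'⟩ := build X y.onObj (fun k => (pathDesc (μ k)).1)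
    (fun k => (congrArg (fun f : edge (C k) ⟶ Gamma.obj E X => f.onObj ⟨false⟩) (ha k)).trans
      (congrArg (fun t => t.1) (pathDesc (μ k)).2).symm)
    (fun k => (congrArg (fun f : edge (C k) ⟶ Gamma.obj E X => f.onObj ⟨true⟩) (ha k)).trans
      (congrArg (fun t => t.2.1) (pathDesc (μ k)).2).symm)
  have comp {W : EnrichedGraph V} (f : A ⟶ W) (k : K) : i k ≫ g ≫ (Gamma.functor E).map f =
      pathPack E (γ k) ≫ Gamma.map E (j k ≫ f) := by
    refine (Category.assoc _ _ _).symm.trans ((congrArg (· ≫ _) (hg' k)).trans ?_)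
    exact (Category.assoc _ _ _).trans (congrArg (_ ≫ ·) ((Gamma.functor E).map_comp _ _).symm)
  refine ⟨A, g, m, ?_, fun A' m' g' w => ?_, fun A' m' f f' h₁ h₂ h₃ => ?_⟩
  · refine hi.hom_ext _ _ _ (fun y' => (congrArg m.onObj (hg y')).trans (hm' y')) fun k => ?_
    refine (comp m k).trans ((congrArg (fun f => _ ≫ Gamma.map E f) (hm k)).trans ?_)
    exact (pathPack_desc (γ k) (μ k)).trans
      ((congrArg (pack E (t k)) (hγ k).fac).trans (ha k).symm)
  · choose s c hc using fun k => exists_pack E (hC k) (X := A') (i k ≫ g')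
    have e (k) := (ha k).symm.trans ((congrArg (i k ≫ ·) w.symm).trans
      ((Category.assoc _ _ _).symm.trans ((congrArg (· ≫ _) (hc k)).trans
        (pack_comp E (s k) (c k) m' rfl))))
    have e' (k) := (pack_inj_walk (hC k) (e k)).symm
    have e'' (k) := pack_inj_same (hC k) ((ha k).symm.trans ((congrArg (i k ≫ ·) w.symm).trans
      ((Category.assoc _ _ _).symm.trans ((congrArg (· ≫ _) (hc k)).trans
        (pack_comp E (s k) (c k) m' (e' k))))))
    choose τ hτ hτ' using fun k => (hγ k).exists_lift _ _ _ (e'' k).symm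
    obtain ⟨f, hf, hf'⟩ := build A' g'.onObj (fun k => (pathDesc (τ k)).1)
      (fun k => (congrArg (fun f : edge (C k) ⟶ Gamma.obj E A' => f.onObj ⟨false⟩) (hc k)).trans
        (congrArg (fun t => t.1) (pathDesc (τ k)).2).symm)
      (fun k => (congrArg (fun f : edge (C k) ⟶ Gamma.obj E A' => f.onObj ⟨true⟩) (hc k)).trans
        (congrArg (fun t => t.2.1) (pathDesc (τ k)).2).symm)
    refine ⟨f, ext _ _ _ (fun k => ?_) (fun y' => ?_),
      hi.hom_ext _ _ _ (fun y' => (congrArg f.onObj (hg y')).trans (hf' y')) fun k => ?_⟩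
    · rw [← Category.assoc, hf, hm]
      have := pathDesc_comp (τ k) (⟨m', e' k⟩ : (⟨A', s k⟩ : walks.El V) ⟶ ⟨X, t k⟩)
      rw [hτ k] at this
      exact congrArg (fun m => m.1) this
    · exact (congrArg m'.onObj (hf' y')).trans
        ((congrArg (fun f : Y ⟶ Gamma.obj E X => f.onObj y') w).trans (hm' y').symm)
    · refine (comp f k).trans ((congrArg (fun f => _ ≫ Gamma.map E f) (hf k)).trans ?_)
      exact (pathPack_desc (γ k) (τ k)).trans
        ((congrArg (pack E (s k)) (hτ' k)).trans (hc k).symm)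
  · refine ext _ _ _ (fun k => ?_) fun y' => ?_
    · have e₁ : (j k ≫ f) ≫ m' = (pathDesc (μ k)).1 := by rw [Category.assoc, h₁, hm k]
      have e₂ : (j k ≫ f') ≫ m' = (pathDesc (μ k)).1 := by rw [Category.assoc, h₂, hm k]
      have e₃ : pathPack E (γ k) ≫ Gamma.map E (j k ≫ f) =
          pathPack E (γ k) ≫ Gamma.map E (j k ≫ f') :=
        (comp f k).symm.trans ((congrArg (i k ≫ ·) h₃).trans (comp f' k))
      generalize j k ≫ f = p at *
      generalize j k ≫ f' = p' at *
      -- Both morphisms send the line to the same sequence; they can then be compared as morphisms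
      -- out of a path graph, by the generic property over `X`.
      have e₄ := pack_inj_walk (hC k) ((pathPack_comp (γ k) (Shape.El.push (P := walks) p _)).symm.trans
        (e₃.trans (pathPack_comp (γ k) (Shape.El.push (P := walks) p' _))))
      let x : walks.El V := ⟨A', walks.map p.onObj (path (Z k)).elt⟩
      let P : path (Z k) ⟶ x := ⟨p, rfl⟩
      let P' : path (Z k) ⟶ x := ⟨p', e₄.symm⟩
      have e₅ := pack_inj_same (hC k) ((pathPack_comp (γ k) P).symm.trans
        (e₃.trans (pathPack_comp (γ k) P')))
      let M : x ⟶ ⟨X, t k⟩ := ⟨m', (walks.map_comp _ _ _).symm.trans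
        ((congrArg (fun m : (path (Z k)).graph ⟶ X => walks.map m.onObj (path (Z k)).elt) e₁).trans
          (pathDesc (μ k)).2)⟩
      have e₆ : P ≫ M = pathDesc (μ k) := Shape.El.hom_ext e₁
      have e₇ : P' ≫ M = pathDesc (μ k) := Shape.El.hom_ext e₂
      have := path_hom_ext ((hγ k).hom_ext _ (homsAt.map M) _ _
        (by rw [Category.assoc, ← homsAt.map_comp, e₆, pathUnit_desc])
        (by rw [Category.assoc, ← homsAt.map_comp, e₇, pathUnit_desc]) e₅)
      exact congrArg (fun m => m.1) this
    · exact (congrArg f.onObj (hg y')).symm.trans ((congrArg (fun f : Y ⟶ Gamma.obj E A' =>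
        f.onObj y') h₃).trans (congrArg f'.onObj (hg y')))

/-- Factor generically the edge of ΓE(path Z) given by `f`. Since `B` is connected, the generic edge
of ΓE(A) comes from a sequence `p` in `A`, and the homs along `p` form the required sequence. -/
theorem exists_generic_of_connected
    (hE : ∀ (X Y : EnrichedGraph V) (y : Y ⟶ (Gamma.functor E).obj X),
      ∃ (A : EnrichedGraph V) (g : Y ⟶ (Gamma.functor E).obj A) (m : A ⟶ X),
        IsGeneric (Gamma.functor E) y g m) {B : V} (hB : IsConnectedObject B) {Z : FreeMon V}
    (f : B ⟶ E.obj Z) : ∃ (Z' : FreeMon V) (g : B ⟶ E.obj Z') (m : Z' ⟶ Z), IsGeneric E f g m := by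
  obtain ⟨A, g, m, h⟩ := hE _ _ (pathPack E f)
  obtain ⟨p, g₁, rfl⟩ := exists_pack E hB (X := A) g
  have hp := pack_inj_walk hB ((pack_comp E p g₁ m rfl).symm.trans h.fac)
  have hg₁ := pack_inj_same hB ((pack_comp E p g₁ m hp).symm.trans h.fac)
  let m' : (⟨A, p⟩ : walks.El V) ⟶ path Z := ⟨m, hp⟩
  let μ : homsAt.obj ⟨A, p⟩ ⟶ Z := homsAt.map m' ≫ inv (pathUnit Z)
  have hμ : μ ≫ pathUnit Z = homsAt.map m' := by
    rw [Category.assoc, IsIso.inv_hom_id, Category.comp_id]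
  have cancel {K : V} {Q : FreeMon V} {a b : K ⟶ E.obj Q}
      (e : a ≫ E.map (pathUnit Q) = b ≫ E.map (pathUnit Q)) : a = b := (cancel_mono _).1 e
  refine ⟨homsAt.obj ⟨A, p⟩, g₁, μ, cancel ?_, fun Z' w f' e => ?_, fun Z' w τ τ' e e' e₁ => ?_⟩
  · exact (comp_map_comp_map E g₁ hμ).trans hg₁
  · obtain ⟨t, ht, ht'⟩ := h.exists_lift (path Z').graph (pathDesc (w ≫ pathUnit Z)).1 (pathPack E f')
      ((pathPack_map f' w).trans (congrArg (pathPack E) e))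
    have e₁ := pack_inj_walk hB ((pack_comp E p g₁ t rfl).symm.trans ht')
    have e₂ := pack_inj_same hB ((pack_comp E p g₁ t e₁).symm.trans ht')
    let t' : (⟨A, p⟩ : walks.El V) ⟶ path Z' := ⟨t, e₁⟩
    have e₃ : t' ≫ pathDesc (w ≫ pathUnit Z) = m' := Shape.El.hom_ext ht
    have e₄ : inv (pathUnit Z') ≫ w ≫ pathUnit Z = homsAt.map (pathDesc (w ≫ pathUnit Z)) := by
      rw [IsIso.inv_comp_eq]; exact (pathUnit_desc _).symm
    refine ⟨homsAt.map t' ≫ inv (pathUnit Z'), ?_, cancel ?_⟩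
    · rw [← cancel_mono (pathUnit Z), Category.assoc, Category.assoc, e₄, ← homsAt.map_comp, e₃, hμ]
    · refine (comp_map_comp_map E g₁ (c := homsAt.map t') ?_).trans e₂
      rw [Category.assoc, IsIso.inv_hom_id, Category.comp_id]
  · let r : path (homsAt.obj ⟨A, p⟩) ⟶ ⟨A, p⟩ := pathDesc (𝟙 _)
    have hr : pathUnit (homsAt.obj ⟨A, p⟩) ≫ homsAt.map r = 𝟙 _ := pathUnit_desc _
    have hg : pathPack E g₁ ≫ Gamma.map E r.1 = pack E p g₁ :=
      (pathPack_desc g₁ _).trans (congrArg (pack E p)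
        ((congrArg (g₁ ≫ ·) (E.map_id _)).trans (Category.comp_id g₁)))
    have hrm : r ≫ m' = pathDesc (μ ≫ pathUnit Z) :=
      (pathDesc_comp _ _).trans (congrArg pathDesc ((Category.id_comp _).trans hμ.symm))
    have hrm' : pathPack E g₁ ≫ (Gamma.functor E).map (r ≫ m').1 = pathPack E f := by
      rw [hrm]
      exact (pathPack_map g₁ μ).trans (congrArg (pathPack E)
        (cancel ((comp_map_comp_map E g₁ hμ).trans hg₁)))
    obtain ⟨s, hs, hs'⟩ := h.exists_lift _ (r ≫ m').1 (pathPack E g₁) hrm'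
    -- Genericity gives a section of the counit, so `A` is a retract of a path graph and uniqueness
    -- can be transported to it.
    have hsr : s ≫ r.1 = 𝟙 A := h.hom_ext _ m _ _ ((Category.assoc _ _ _).trans hs)
      (Category.id_comp _) (by
        rw [(Gamma.functor E).map_comp, (Gamma.functor E).map_id]
        refine (Category.assoc _ _ _).symm.trans ((congrArg (· ≫ _) hs').trans ?_)
        exact hg.trans (Category.comp_id _).symm)
    have e₂ := pack_inj_walk hB ((pack_comp E p g₁ s rfl).symm.trans hs')
    let s' : (⟨A, p⟩ : walks.El V) ⟶ path (homsAt.obj ⟨A, p⟩) := ⟨s, e₂⟩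
    have hsr' : s' ≫ r = 𝟙 _ := Shape.El.hom_ext hsr
    have key (τ : homsAt.obj ⟨A, p⟩ ⟶ Z') (e : τ ≫ w = μ) :
        (s ≫ (pathDesc (τ ≫ pathUnit Z')).1) ≫ (pathDesc (w ≫ pathUnit Z)).1 = m := by
      have := pathDesc_comp (τ ≫ pathUnit Z') (pathDesc (w ≫ pathUnit Z))
      rw [Category.assoc, pathUnit_desc, ← Category.assoc, e, ← hrm] at this
      exact (Category.assoc _ _ _).trans ((congrArg (fun m => s ≫ m.1) this).trans hs)
    have key' (τ : homsAt.obj ⟨A, p⟩ ⟶ Z') : pack E p g₁ ≫ (Gamma.functor E).map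
        (s ≫ (pathDesc (τ ≫ pathUnit Z')).1) = pathPack E (g₁ ≫ E.map τ) :=
      (congrArg (_ ≫ ·) ((Gamma.functor E).map_comp _ _)).trans ((Category.assoc _ _ _).symm.trans
        ((congrArg (· ≫ _) hs').trans (pathPack_map g₁ τ)))
    have e₃ := h.hom_ext _ _ _ _ (key τ e) (key τ' e')
      ((key' τ).trans ((congrArg (pathPack E) e₁).trans (key' τ').symm))
    have e₄ : s' ≫ pathDesc (τ ≫ pathUnit Z') = s' ≫ pathDesc (τ' ≫ pathUnit Z') :=
      Shape.El.hom_ext e₃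
    -- The counit becomes invertible under `homsAt`, with both of these as its inverse.
    have e₅ : homsAt.map s' = pathUnit _ := by
      have h₁ : homsAt.map s' ≫ homsAt.map r = 𝟙 _ := by
        rw [← homsAt.map_comp, hsr', homsAt.map_id]
      have : IsIso (homsAt.map r) := IsIso.of_isIso_fac_left hr
      rw [← cancel_mono (homsAt.map r), h₁, hr]
    have e₆ := congrArg homsAt.map e₄
    rw [homsAt.map_comp, homsAt.map_comp, e₅, pathUnit_desc, pathUnit_desc] at e₆
    exact (cancel_mono (pathUnit Z')).1 e₆

/-- Coproducts of sequences over a given sequence. -/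
theorem exists_coproduct_over (Z : FreeMon V) {K : Type v} (p : K → Σ Z' : FreeMon V, Z' ⟶ Z) :
    ∃ (A : FreeMon V) (ι : ∀ k, (p k).1 ⟶ A) (m : A ⟶ Z), (∀ k, ι k ≫ m = (p k).2) ∧
      (∀ (W : FreeMon V) (w : W ⟶ Z) (h : ∀ k, (p k).1 ⟶ W), (∀ k, h k ≫ w = (p k).2) →
        ∃ t : A ⟶ W, t ≫ w = m ∧ ∀ k, ι k ≫ t = h k) ∧
      ∀ (W : FreeMon V) (w : W ⟶ Z) (t t' : A ⟶ W), t ≫ w = m → t' ≫ w = m →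
        (∀ k, ι k ≫ t = ι k ≫ t') → t = t' := by
  induction Z with
  | nil =>
    have hp : ∀ q : Σ Z' : FreeMon V, Z' ⟶ (nil : FreeMon V), q = ⟨nil, 𝟙 _⟩ := by
      rintro ⟨Z' | ⟨z, Z'⟩, q⟩
      · rfl
      · exact PEmpty.elim q
    obtain rfl : p = fun _ => ⟨nil, 𝟙 _⟩ := funext fun k => hp _
    refine ⟨nil, fun k => 𝟙 (nil : FreeMon V), 𝟙 (nil : FreeMon V), fun _ => nil_hom_ext _ _,
      fun W w h _ => ?_, fun W w t t' _ _ _ => nil_hom_ext _ _⟩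
    cases W with
    | nil => exact ⟨𝟙 (nil : FreeMon V), nil_hom_ext _ _, fun _ => nil_hom_ext _ _⟩
    | cons => exact PEmpty.elim w
  | cons a l ih =>
    have hp : ∀ q : Σ Z' : FreeMon V, Z' ⟶ (FreeMon.cons a l : FreeMon V),
        ∃ (z : V) (φ : z ⟶ a) (q' : Σ Z' : FreeMon V, Z' ⟶ l),
          q = ⟨FreeMon.cons z q'.1, consHom φ q'.2⟩ := by
      rintro ⟨Z' | ⟨z, Z'⟩, q⟩
      · exact PEmpty.elim q
      · exact ⟨z, q.1, ⟨Z', q.2⟩, rfl⟩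
    choose z φ q hq using fun k => hp (p k)
    obtain rfl := funext hq
    obtain ⟨A, ι, m, h₁, h₂, h₃⟩ := ih q
    -- The base sequence prescribes the length, so coproducts over it are formed term by term; for
    -- empty `K` every term is initial.
    refine ⟨FreeMon.cons (∐ z) A, fun k => consHom (Sigma.ι z k) (ι k), consHom (Sigma.desc φ) m,
      fun k => ?_, fun W w h e => ?_, fun W w t t' e e' e₁ => ?_⟩
    · exact (consHom_comp _ _ _ _).trans (congrArg₂ consHom (Sigma.ι_desc _ _) (h₁ k))
    · cases W with
      | nil => exact PEmpty.elim w
      | cons b W =>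
        obtain ⟨t, ht, ht'⟩ := h₂ W w.2 (fun k => (h k).2) fun k => congrArg Prod.snd (e k)
        refine ⟨consHom (Sigma.desc fun k => (h k).1) t, ?_, fun k => ?_⟩
        · refine (consHom_comp _ _ w.1 w.2).trans (congrArg₂ consHom ?_ ht)
          refine Sigma.hom_ext _ _ fun k => ?_
          refine (Category.assoc _ _ _).symm.trans ((congrArg (· ≫ w.1) (Sigma.ι_desc _ _)).trans ?_)
          exact (congrArg Prod.fst (e k)).trans (Sigma.ι_desc φ k).symm
        · exact (consHom_comp _ _ _ _).trans (congrArg₂ consHom (Sigma.ι_desc _ _) (ht' k))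
    · cases W with
      | nil => exact PEmpty.elim w
      | cons b W =>
        exact Prod.ext (Sigma.hom_ext _ _ fun k => congrArg Prod.fst (e₁ k))
          (h₃ W w.2 t.2 t'.2 (congrArg Prod.snd e) (congrArg Prod.snd e')
            fun k => congrArg Prod.snd (e₁ k))

/-- Factorizations of `f` are compatible families of factorizations of its restrictions, so the
coproduct over `Z` of the generic ones is generic. -/
theorem exists_generic_of_decomposition {K : Type v} {B : V} {C : K → V} {i : ∀ k, C k ⟶ B}
    (hi : IsColimit (Cofan.mk B i)) {Z : FreeMon V} (f : B ⟶ E.obj Z)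
    (H : ∀ k, ∃ (Z' : FreeMon V) (g : C k ⟶ E.obj Z') (m : Z' ⟶ Z), IsGeneric E (i k ≫ f) g m) :
    ∃ (Z' : FreeMon V) (g : B ⟶ E.obj Z') (m : Z' ⟶ Z), IsGeneric E f g m := by
  choose Z' g m h using H
  obtain ⟨A, ι, μ, h₁, h₂, h₃⟩ := exists_coproduct_over Z (fun k => ⟨Z' k, m k⟩)
  let γ : B ⟶ E.obj A := Cofan.IsColimit.desc hi fun k => g k ≫ E.map (ι k)
  have hγ (k : K) : i k ≫ γ = g k ≫ E.map (ι k) :=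
    Cofan.IsColimit.fac hi (fun k => g k ≫ E.map (ι k)) k
  have hγ' (k : K) {W : FreeMon V} {t : A ⟶ W} {s : Z' k ⟶ W} (e : ι k ≫ t = s) :
      i k ≫ γ ≫ E.map t = g k ≫ E.map s := by
    rw [← Category.assoc, hγ, comp_map_comp_map E _ e]
  refine ⟨A, γ, μ, Cofan.IsColimit.hom_ext hi _ _ fun k => ?_, fun W w f' e => ?_,
    fun W w t t' e e' e₁ => ?_⟩
  · exact (hγ' k (h₁ k)).trans (h k).fac
  · choose τ hτ hτ' using fun k => (h k).exists_lift W w (i k ≫ f') (by rw [Category.assoc, e])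
    obtain ⟨t, ht, ht'⟩ := h₂ W w τ hτ
    exact ⟨t, ht, Cofan.IsColimit.hom_ext hi _ _ fun k => (hγ' k (ht' k)).trans (hτ' k)⟩
  · refine h₃ W w t t' e e' fun k => (h k).hom_ext W w _ _ ?_ ?_ ?_
    · rw [Category.assoc, e]; exact h₁ k
    · rw [Category.assoc, e']; exact h₁ k
    · exact (hγ' k rfl).symm.trans ((congrArg (i k ≫ ·) e₁).trans (hγ' k rfl))

theorem isLRA_iff {E : Multitensor V} (hE : E.IsDistributive)
    (hV : HasConnectedDecompositions V) : E.IsLRA ↔ IsLRAMonad (E.gamma hE) where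
  mp h := ⟨(isLocalRightAdjoint_iff _).2 fun X Y y => by
      obtain ⟨K, C, i, hC, hi⟩ := exists_edge_cover hV Y
      exact exists_generic_of_pack ((isLocalRightAdjoint_iff _).1 h.localRightAdjoint) y hi hC,
    gamma_unit_equifibered hV hE h.unit,
    gamma_mult_equifibered hV hE (substNat_equifibered h.subst)⟩
  mpr h := ⟨(isLocalRightAdjoint_iff _).2 fun Z B f => by
      obtain ⟨K, C, i, hC, ⟨hi⟩⟩ := hV B
      exact exists_generic_of_decomposition hi f fun k => exists_generic_of_connected
        ((isLocalRightAdjoint_iff _).1 h.localRightAdjoint) (hC k) (i k ≫ f),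
    unit_equifibered_of_gamma hV hE h.unit,
    subst_equifibered (substNat_equifibered_of_gamma hV hE h.mult)⟩

end Gamma

/-! ### Connected decompositions from local c-presentability. -/

section Decompositions

variable {V : Type u} [Category.{v} V]

theorem isConnectedObject_of_exists {C : V}
    (ex : ∀ (J : Type v) (Y : J → V) (X : V) (i : ∀ j, Y j ⟶ X), IsColimit (Cofan.mk X i) →
      ∀ g : C ⟶ X, ∃ (j : J) (g' : C ⟶ Y j), g' ≫ i j = g)
    (un : ∀ (J : Type v) (Y : J → V) (X : V) (i : ∀ j, Y j ⟶ X), IsColimit (Cofan.mk X i) →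
      ∀ (j j' : J) (g : C ⟶ Y j) (g' : C ⟶ Y j'), g ≫ i j = g' ≫ i j' →
        (⟨j, g⟩ : Σ j, C ⟶ Y j) = ⟨j', g'⟩) : IsConnectedObject C := by
  intro J
  have key : ∀ Y : J → V, PreservesColimit (Discrete.functor Y) (coyoneda.obj (op C)) := by
    refine fun Y => ⟨fun {c} hc => ?_⟩
    let i (j : J) : Y j ⟶ c.pt := c.ι.app ⟨j⟩
    have hc' : IsColimit (Cofan.mk c.pt i) :=
      hc.ofIsoColimit (Cocone.ext (Iso.refl _) fun j => Category.comp_id _)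
    choose j g hg using fun g : C ⟶ c.pt => ex J Y c.pt i hc' g
    refine ⟨⟨fun s => TypeCat.ofHom fun x => s.ι.app ⟨j x⟩ (g x), fun s => ?_, fun s m hm => ?_⟩⟩
    · rintro ⟨k⟩
      ext x
      have := un J Y c.pt i hc' _ _ _ _ (hg (x ≫ i k))
      exact congrArg (fun q : Σ j, C ⟶ Y j => s.ι.app ⟨q.1⟩ q.2) this
    · ext x
      refine (congrArg m (hg x).symm).trans ?_
      exact congrArg (fun k => k (g x)) (hm ⟨j x⟩)
  exact ⟨fun {F} => preservesColimit_of_iso_diagram _ (Discrete.natIsoFunctor (F := F)).symm⟩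

/-- A morphism from the colimit to a coproduct selects a summand at each stage. Compatibility makes
the selected summand locally constant, hence constant on a connected category. -/
theorem isConnectedObject_colimit {A : Type v} [SmallCategory A] [IsConnected A] {G : A ⥤ V}
    {c : Cocone G} (hc : IsColimit c) (hG : ∀ a, IsConnectedObject (G.obj a)) :
    IsConnectedObject c.pt := by
  obtain ⟨a₀⟩ := IsConnected.is_nonempty (J := A)
  refine isConnectedObject_of_exists (fun J Y X i hi g => ?_) fun J Y X i hi j j' g g' e => ?_
  · choose j h hh using fun a => (hG a).exists_factor hi (c.ι.app a ≫ g)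
    have step (a b : A) (φ : a ⟶ b) :
        (⟨j a, h a⟩ : Σ j, G.obj a ⟶ Y j) = ⟨j b, G.map φ ≫ h b⟩ := by
      refine (hG a).factor_unique hi ?_
      rw [Category.assoc, hh, hh, ← Category.assoc, c.w]
    obtain ⟨k, hk⟩ := constant_of_preserves_morphisms' j fun a b φ => congrArg (fun q => q.1) (step a b φ)
    obtain rfl : j = fun _ => k := funext hk
    refine ⟨k, hc.desc ⟨Y k, ⟨h, fun a b φ => ?_⟩⟩, hc.hom_ext fun a => ?_⟩
    · exact (eq_of_heq (Sigma.mk.inj (step a b φ)).2).symm.trans (Category.comp_id _).symm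
    · rw [← Category.assoc, hc.fac]
      exact hh a
  · have h (a : A) : (⟨j, c.ι.app a ≫ g⟩ : Σ j, G.obj a ⟶ Y j) = ⟨j', c.ι.app a ≫ g'⟩ :=
      (hG a).factor_unique hi (by rw [Category.assoc, e, Category.assoc])
    obtain rfl : j = j' := congrArg (fun q => q.1) (h a₀)
    rw [hc.hom_ext fun a => eq_of_heq (Sigma.mk.inj (h a)).2]

/-- Group the given diagram by the connected components of its indexing category. The colimit over
each component is connected, and the whole colimit is their coproduct. -/
theorem hasConnectedDecompositions_of_isLocallyCPresentable {κ : Cardinal.{v}} [Fact κ.IsRegular]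
    (h : IsLocallyCPresentable V κ) : HasConnectedDecompositions V := by
  obtain ⟨_, S, _, hS, h⟩ := h
  intro X
  obtain ⟨J, _, F, i, _, hF, ⟨hi⟩⟩ := h X
  let Y (c : CategoryTheory.ConnectedComponents J) : V := colimit (c.ι ⋙ F)
  let i' (c : CategoryTheory.ConnectedComponents J) : Y c ⟶ X := colimit.desc (c.ι ⋙ F) ((Cocone.mk X i).whisker c.ι)
  have hi' (c : CategoryTheory.ConnectedComponents J) (j : c.Component) :
      colimit.ι (c.ι ⋙ F) j ≫ i' c = i.app j.obj := colimit.ι_desc _ _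
  let d (s : Cofan Y) : Cocone F := ⟨s.pt, ⟨fun j =>
      colimit.ι ((CategoryTheory.ConnectedComponents.mk j).ι ⋙ F) ⟨j, rfl⟩ ≫
        s.inj (CategoryTheory.ConnectedComponents.mk j), fun j j' f => by
    -- Two objects joined by a morphism have only propositionally equal components; the leg is
    -- rewritten with respect to the other component.
    have key (c : CategoryTheory.ConnectedComponents J)
        (hc : CategoryTheory.ConnectedComponents.mk j = c) :
        colimit.ι ((CategoryTheory.ConnectedComponents.mk j).ι ⋙ F) ⟨j, rfl⟩ ≫
          s.inj (CategoryTheory.ConnectedComponents.mk j) =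
          colimit.ι (c.ι ⋙ F) ⟨j, hc⟩ ≫ s.inj c := by
      subst hc
      rfl
    have hc : CategoryTheory.ConnectedComponents.mk j = CategoryTheory.ConnectedComponents.mk j' :=
      Quotient.sound (Zigzag.of_hom f)
    let k : (⟨j, hc⟩ : (CategoryTheory.ConnectedComponents.mk j').Component) ⟶ ⟨j', rfl⟩ := ⟨f⟩
    have := colimit.w ((CategoryTheory.ConnectedComponents.mk j').ι ⋙ F) k
    refine Eq.trans ?_ (Category.comp_id _).symm
    refine Eq.trans ?_ (key _ hc).symm
    exact (Category.assoc _ _ _).symm.trans (congrArg (· ≫ _) this)⟩⟩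
  refine ⟨CategoryTheory.ConnectedComponents J, Y, i',
    fun c => isConnectedObject_colimit (colimit.isColimit _) fun j => (hS _ (hF _)).1,
    ⟨Cofan.IsColimit.mk _ (fun s => hi.desc (d s)) (fun s c => colimit.hom_ext fun j => ?_)
      fun s m hm => hi.hom_ext fun j => ?_⟩⟩
  · obtain ⟨j, rfl⟩ := j
    refine (Category.assoc _ _ _).symm.trans ((congrArg (· ≫ _) (hi' _ _)).trans ?_)
    exact hi.fac (d s) j
  · refine Eq.trans ?_ (hi.fac (d s) j).symm
    refine (congrArg (· ≫ m) (hi' (CategoryTheory.ConnectedComponents.mk j) ⟨j, rfl⟩).symm).trans ?_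
    exact (Category.assoc _ _ _).trans (congrArg (_ ≫ ·) (hm _))

end Decompositions

/-! ### Objects and homs of a colimit of graphs. -/

section Fibres

variable {V : Type u} [Category.{v} V] {J : Type v} [Category.{v} J] {F : J ⥤ EnrichedGraph V}

/-- The components of a cocone of graphs. -/
def leg (c : Cocone F) (j : J) : F.obj j ⟶ c.pt := c.ι.app j

theorem map_leg (c : Cocone F) {i j : J} (f : i ⟶ j) : F.map f ≫ leg c j = leg c i := c.w f

/-- The elements of the graphs of a diagram which are sent to a given one by a cocone. -/
structure Fib {P : Shape.{v}} (c : Cocone F) (t : P.carrier c.pt.obj) : Type v where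
  index : J
  elt : P.carrier (F.obj index).obj
  map_elt : P.map (leg c index).onObj elt = t

variable {P : Shape.{v}} (c : Cocone F)

/-- Morphisms of the diagram which relate elements. -/
instance (t : P.carrier c.pt.obj) : Category.{v} (Fib c t) where
  Hom q r := { f : q.index ⟶ r.index // P.map (F.map f).onObj q.elt = r.elt }
  id q := ⟨𝟙 _, (congrArg (fun m : F.obj q.index ⟶ F.obj q.index => P.map m.onObj q.elt)
    (F.map_id _)).trans (P.map_id _)⟩
  comp {q r s} f g := ⟨f.1 ≫ g.1,
    (congrArg (fun m : F.obj q.index ⟶ F.obj s.index => P.map m.onObj q.elt)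
      (F.map_comp f.1 g.1)).trans
    ((P.map_comp (F.map f.1).onObj (F.map g.1).onObj _).trans ((congrArg (P.map (F.map g.1).onObj) f.2).trans g.2))⟩

/-- The diagram of graphs with elements over a given element. -/
def fibEl (t : P.carrier c.pt.obj) : Fib c t ⥤ P.El V where
  obj q := ⟨F.obj q.index, q.elt⟩
  map f := ⟨F.map f.1, f.2⟩
  map_id _ := Shape.El.hom_ext (F.map_id _)
  map_comp _ _ := Shape.El.hom_ext (F.map_comp _ _)

/-- The cocone of graphs with elements over a given element. -/
def fibCocone (t : P.carrier c.pt.obj) : Cocone (fibEl c t) where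
  pt := ⟨c.pt, t⟩
  ι :=
    { app := fun q => ⟨leg c q.index, q.map_elt⟩
      naturality := fun _ _ f => Shape.El.hom_ext
        ((map_leg c f.1).trans (Category.comp_id (leg c _)).symm) }

variable {c}

/-- The graph with homs those of `X` and objects tagged by the elements of a set. -/
def tagged (X : EnrichedGraph V) (S : Type v) : EnrichedGraph V :=
  ⟨S × X.obj, fun x y => X.hom x.2 y.2⟩

/-- A morphism of graphs with a tagging of the objects of its source. -/
def tag {X Y : EnrichedGraph V} {S : Type v} (m : X ⟶ Y) (ν : X.obj → S) : X ⟶ tagged Y S :=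
  (⟨fun x => (ν x, m.onObj x), m.onHom⟩ : EnrichedGraph.Hom X (tagged Y S))

/-- A function on objects becomes a morphism to a graph whose objects carry tags in `S` and whose
homs are those of the colimit itself. No terminal object of V is needed for this. -/
theorem exists_nodes_desc (hc : IsColimit c) {S : Type v} (ν : ∀ j, (F.obj j).obj → S)
    (hν : ∀ {i j} (f : i ⟶ j) x, ν j ((F.map f).onObj x) = ν i x) :
    ∃ ν' : c.pt.obj → S, ∀ j x, ν' ((leg c j).onObj x) = ν j x := by
  let s : Cocone F :=
    { pt := tagged c.pt S
      ι :=
        { app := fun j => tag (leg c j) (ν j)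
          naturality := fun i j f =>
            (congrArg₂ (tag (S := S)) (map_leg c f) (funext (hν f))).trans
              (Category.comp_id (tag (leg c i) (ν i))).symm } }
  exact ⟨fun x => ((hc.desc s).onObj x).1, fun j x =>
    congrArg (fun m : F.obj j ⟶ tagged c.pt S => (m.onObj x).1) (hc.fac s j)⟩

theorem nodes_hom_ext (hc : IsColimit c) {S : Type v} (ν ν' : c.pt.obj → S)
    (h : ∀ j x, ν ((leg c j).onObj x) = ν' ((leg c j).onObj x)) : ν = ν' := by
  have : tag (𝟙 c.pt) ν = tag (𝟙 c.pt) ν' := hc.hom_ext fun j =>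
    congrArg (tag (leg c j ≫ 𝟙 c.pt)) (funext fun x => h j x)
  exact funext fun x => congrArg (fun m : c.pt ⟶ tagged c.pt S => (m.onObj x).1) this

/-- The indicator function of the union of the images agrees with the constant function true on
every leg. -/
theorem exists_node (hc : IsColimit c) (x : c.pt.obj) : ∃ j y, (leg c j).onObj y = x := by
  have := nodes_hom_ext hc (fun x => ULift.up.{v} (∃ j y, (leg c j).onObj y = x))
    (fun _ => ULift.up True) (fun j y => congrArg ULift.up (eq_true ⟨j, y, rfl⟩))
  exact of_eq_true (congrArg ULift.down (congrFun this x))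

/-- Only cocones of graphs can be descended, so cocones are prescribed for all pairs at once. Their
apexes are the homs of a graph on the same objects, and the descended morphism is the identity on
objects. -/
theorem exists_hom_desc (hc : IsColimit c)
    (S : ∀ t : pairs.carrier c.pt.obj, Cocone (fibEl c t ⋙ homAt)) :
    ∃ d : ∀ t : pairs.carrier c.pt.obj, c.pt.hom t.1 t.2 ⟶ (S t).pt,
      ∀ t q, homAt.map ((fibCocone c t).ι.app q) ≫ d t = (S t).ι.app q := by
  let W : EnrichedGraph V := ⟨c.pt.obj, fun x y => (S (x, y)).pt⟩
  let m (j : J) : F.obj j ⟶ W := (⟨(leg c j).onObj, fun a b =>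
    (S ((leg c j).onObj a, (leg c j).onObj b)).ι.app ⟨j, (a, b), rfl⟩⟩ : EnrichedGraph.Hom _ W)
  have hm : ∀ {i j : J} (f : i ⟶ j), F.map f ≫ m j = m i := by
    intro i j f
    have e (x) : (leg c j).onObj ((F.map f).onObj x) = (leg c i).onObj x :=
      congrArg (fun m : F.obj i ⟶ c.pt => m.onObj x) (map_leg c f)
    refine graph_hom_ext e fun a b => ?_
    have key : ∀ (t t' : pairs.carrier c.pt.obj) (h : t' = t) (q : Fib c t')
        (hh : (S t').pt = (S t).pt), (S t').ι.app q ≫ eqToHom hh =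
          (S t).ι.app ⟨q.index, q.elt, q.map_elt.trans h⟩ := by
      rintro t _ rfl q _
      exact Category.comp_id _
    refine (Category.assoc _ _ _).trans ((congrArg ((F.map f).onHom a b ≫ ·)
      (key _ _ (congrArg₂ Prod.mk (e a) (e b)) _ _)).trans ?_)
    refine Eq.trans ?_ ((S ((leg c i).onObj a, (leg c i).onObj b)).w
      (⟨f, rfl⟩ : (⟨i, (a, b), rfl⟩ : Fib (P := pairs) c ((leg c i).onObj a, (leg c i).onObj b)) ⟶
        ⟨j, ((F.map f).onObj a, (F.map f).onObj b), congrArg₂ Prod.mk (e a) (e b)⟩))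
    exact congrArg (· ≫ _) (homAt_map_push (F.map f) a b).symm
  let s : Cocone F :=
    { pt := W
      ι :=
        { app := m
          naturality := fun i j f => (hm f).trans (Category.comp_id (m i)).symm } }
  let τ : c.pt ⟶ W := hc.desc s
  have hτ (j) : leg c j ≫ τ = m j := hc.fac s j
  have h : τ.onObj = fun x => x := nodes_hom_ext hc _ _ fun j x =>
    congrArg (fun m : F.obj j ⟶ W => m.onObj x) (hτ j)
  refine ⟨fun t => τ.onHom t.1 t.2 ≫ eqToHom (by rw [h]), fun t q => ?_⟩
  obtain ⟨j, ⟨a, b⟩, rfl⟩ := q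
  refine (congrArg (· ≫ _) (homAt_map_push (leg c j) a b)).trans ?_
  exact (Category.assoc _ _ _).symm.trans (onHom_congr (hτ j) a b)

/-- Two morphisms on one hom extend to two morphisms of graphs by taking identities on all the other
homs; the extensions agree on every leg. -/
theorem hom_hom_ext (hc : IsColimit c) (t : pairs.carrier c.pt.obj) {Z : V}
    (m m' : c.pt.hom t.1 t.2 ⟶ Z)
    (h : ∀ q, homAt.map ((fibCocone c t).ι.app q) ≫ m = homAt.map ((fibCocone c t).ι.app q) ≫ m') :
    m = m' := by
  classical
  let D (t : pairs.carrier c.pt.obj) := Σ Z : V, { m : (c.pt.hom t.1 t.2 ⟶ Z) × (c.pt.hom t.1 t.2 ⟶ Z) //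
    ∀ q, homAt.map ((fibCocone c t).ι.app q) ≫ m.1 = homAt.map ((fibCocone c t).ι.app q) ≫ m.2 }
  have key (d : ∀ t, D t) (t) : (d t).2.1.1 = (d t).2.1.2 := by
    let W : EnrichedGraph V := ⟨c.pt.obj, fun x y => (d (x, y)).1⟩
    have : (⟨fun x => x, fun a b => (d (a, b)).2.1.1⟩ : EnrichedGraph.Hom c.pt W) =
        (⟨fun x => x, fun a b => (d (a, b)).2.1.2⟩ : EnrichedGraph.Hom c.pt W) :=
      hc.hom_ext (W := W) fun j => EnrichedGraph.Hom.congr fun a b => by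
        have := (d ((leg c j).onObj a, (leg c j).onObj b)).2.2 ⟨j, (a, b), rfl⟩
        exact (congrArg (· ≫ _) (homAt_map_push (leg c j) a b)).symm.trans
          (this.trans (congrArg (· ≫ _) (homAt_map_push (leg c j) a b)))
    exact (Category.comp_id _).symm.trans (onHom_congr (X := c.pt) (Y := W) this t.1 t.2)
  have := key (Function.update (fun t => ⟨_, (𝟙 _, 𝟙 _), fun _ => rfl⟩) t ⟨Z, (m, m'), h⟩) t
  rwa [Function.update_self] at this

theorem isColimit_homAt (hc : IsColimit c) (t : pairs.carrier c.pt.obj) :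
    Nonempty (IsColimit (homAt.mapCocone (fibCocone c t))) := by
  classical
  have ex (s : Cocone (fibEl c t ⋙ homAt)) : ∃ d : c.pt.hom t.1 t.2 ⟶ s.pt,
      ∀ q, homAt.map ((fibCocone c t).ι.app q) ≫ d = s.ι.app q := by
    obtain ⟨S, hS⟩ : ∃ S : ∀ t : pairs.carrier c.pt.obj, Cocone (fibEl c t ⋙ homAt), S t = s :=
      -- The given cocone is used at `t`, and the canonical one at every other pair.
      ⟨Function.update (fun t => homAt.mapCocone (fibCocone c t)) t s, Function.update_self ..⟩
    subst hS
    obtain ⟨d, hd⟩ := exists_hom_desc hc S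
    exact ⟨d t, hd t⟩
  choose d hd using ex
  exact ⟨⟨d, hd, fun s m hm => hom_hom_ext hc t _ _ fun q => (hm q).trans (hd s q).symm⟩⟩

end Fibres

/-! ### A criterion for ΓE to preserve a colimit. -/

section Detect

variable {V : Type u} [Category.{v} V] [HasCoproducts.{v} V] {J : Type v} [Category.{v} J]
  {F : J ⥤ EnrichedGraph V} {c : Cocone F} {E : FreeMon V ⥤ V}

theorem gamma_hom_ext (hc : IsColimit c)
    (H : ∀ t : walks.carrier c.pt.obj, Nonempty (IsColimit ((tensorAt E).mapCocone (fibCocone c t))))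
    {W : EnrichedGraph V} (m m' : Gamma.obj E c.pt ⟶ W)
    (h : ∀ j, Gamma.map E (leg c j) ≫ m = Gamma.map E (leg c j) ≫ m') : m = m' := by
  have e : m.onObj = m'.onObj := nodes_hom_ext hc _ _ fun j x =>
    congrArg (fun m : Gamma.obj E (F.obj j) ⟶ W => m.onObj x) (h j)
  refine graph_hom_ext (congrFun e) fun a b => Gamma.hom_ext E c.pt fun p => ?_
  obtain ⟨hp⟩ := H ⟨a, b, p⟩
  refine hp.hom_ext fun q => ?_
  have key : ∀ (t : walks.carrier c.pt.obj) (q : Fib c t)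
      (e' : W.hom (m.onObj t.1) (m.onObj t.2.1) = W.hom (m'.onObj t.1) (m'.onObj t.2.1)),
      (tensorAt E).map ((fibCocone c t).ι.app q) ≫ Gamma.ι E c.pt t.2.2 ≫
        m.onHom t.1 t.2.1 ≫ eqToHom e' =
      (tensorAt E).map ((fibCocone c t).ι.app q) ≫ Gamma.ι E c.pt t.2.2 ≫ m'.onHom t.1 t.2.1 := by
    rintro _ ⟨j, t, rfl⟩ e'
    have h1 : (tensorAt E).map (Shape.El.push (P := walks) (leg c j) t) ≫
        Gamma.ι E c.pt (ObjSeq.map (leg c j).onObj t.2.2) =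
        Gamma.ι E (F.obj j) t.2.2 ≫ (Gamma.map E (leg c j)).onHom t.1 t.2.1 :=
      (congrArg (fun k => E.map k ≫ _) (homsAt_map_push (leg c j) t)).trans
        (Gamma.ι_map E (leg c j) t.2.2).symm
    have h2 := onHom_congr (h j) t.1 t.2.1
    have h3 {Z : V} (k : (Gamma.obj E c.pt).hom ((leg c j).onObj t.1) ((leg c j).onObj t.2.1) ⟶ Z) :
        (tensorAt E).map (Shape.El.push (P := walks) (leg c j) t) ≫
          Gamma.ι E c.pt (ObjSeq.map (leg c j).onObj t.2.2) ≫ k =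
        Gamma.ι E (F.obj j) t.2.2 ≫ (Gamma.map E (leg c j)).onHom t.1 t.2.1 ≫ k :=
      (Category.assoc _ _ _).symm.trans ((congrArg (· ≫ k) h1).trans (Category.assoc _ _ _))
    refine (h3 _).trans (Eq.trans ?_ (h3 _).symm)
    exact congrArg (Gamma.ι E (F.obj j) t.2.2 ≫ ·) ((Category.assoc _ _ _).symm.trans h2)
  exact key ⟨a, b, p⟩ q _

/-- The cocone on the tensor products over a sequence of objects induced by a cocone on the
image of a diagram under `ΓE`. -/
noncomputable def tensorCocone (s : Cocone (F ⋙ Gamma.functor E)) (ν : c.pt.obj → s.pt.obj)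
    (hν : ∀ j x, ν ((leg c j).onObj x) = (s.ι.app j).onObj x) (t : walks.carrier c.pt.obj) :
    Cocone (fibEl c t ⋙ tensorAt E) where
  pt := s.pt.hom (ν t.1) (ν t.2.1)
  ι :=
    { app := fun q => (gammaι E).app ((fibEl c t).obj q) ≫ homAt.map
        (⟨s.ι.app q.index, by
          obtain ⟨j, w, rfl⟩ := q
          exact congrArg₂ Prod.mk (hν _ _).symm (hν _ _).symm⟩ :
          (gammaEnds E).obj ((fibEl c t).obj q) ⟶ ⟨s.pt, (ν t.1, ν t.2.1)⟩)
      naturality := fun q r f => by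
        refine ((Category.assoc _ _ _).symm.trans (congrArg (· ≫ _)
          ((gammaι E).naturality ((fibEl c t).map f)))).trans ?_
        refine (Category.assoc _ _ _).trans ?_
        refine Eq.trans ?_ (Category.comp_id _).symm
        refine congrArg (_ ≫ ·) ?_
        refine (homAt.map_comp _ _).symm.trans (congrArg homAt.map (Shape.El.hom_ext ?_))
        exact s.w f.1 }

/-- A cocone under the image of ΓE determines a function on objects, since ΓE leaves these
unchanged. At each sequence `t` it determines a cocone on the lifts of `t`, and the morphisms out of
the summands obtained from these assemble to one out of ΓE of the colimit. -/
theorem isColimit_gamma (hc : IsColimit c)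
    (H : ∀ t : walks.carrier c.pt.obj, Nonempty (IsColimit ((tensorAt E).mapCocone (fibCocone c t)))) :
    Nonempty (IsColimit ((Gamma.functor E).mapCocone c)) := by
  have ex (s : Cocone (F ⋙ Gamma.functor E)) : ∃ τ : Gamma.obj E c.pt ⟶ s.pt,
      ∀ j, Gamma.map E (leg c j) ≫ τ = s.ι.app j := by
    obtain ⟨ν, hν⟩ := exists_nodes_desc hc (S := s.pt.obj) (fun j => (s.ι.app j).onObj)
      fun {i j} f x => congrArg (fun m : Gamma.obj E (F.obj i) ⟶ s.pt => m.onObj x) (s.w f)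
    let d (t : walks.carrier c.pt.obj) := (H t).some.desc (tensorCocone s ν hν t)
    have hd (t : walks.carrier c.pt.obj) (q : Fib c t) :
        (tensorAt E).map ((fibCocone c t).ι.app q) ≫ d t = (tensorCocone s ν hν t).ι.app q :=
      (H t).some.fac (tensorCocone s ν hν t) q
    let τ : Gamma.obj E c.pt ⟶ s.pt := (⟨ν, fun a b => Gamma.desc E c.pt fun p => d ⟨a, b, p⟩⟩ :
      EnrichedGraph.Hom (Gamma.obj E c.pt) s.pt)
    refine ⟨τ, fun j => graph_hom_ext (hν j) fun a b => Gamma.hom_ext E _ fun p => ?_⟩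
    have h1 := hd _ ⟨j, ⟨a, b, p⟩, rfl⟩
    have h2 : Gamma.ι E (F.obj j) p ≫ (Gamma.map E (leg c j)).onHom a b ≫
        τ.onHom ((leg c j).onObj a) ((leg c j).onObj b) =
        (tensorCocone s ν hν (walks.map (leg c j).onObj ⟨a, b, p⟩)).ι.app ⟨j, ⟨a, b, p⟩, rfl⟩ := by
      refine (Category.assoc _ _ _).symm.trans ((congrArg (· ≫ _)
        (Gamma.ι_map E (leg c j) p)).trans ?_)
      refine (Category.assoc _ _ _).trans ?_
      refine (congrArg (_ ≫ ·) (Gamma.ι_desc E c.pt _ _)).trans ?_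
      refine Eq.trans ?_ h1
      exact congrArg (fun k => E.map k ≫ _) (homsAt_map_push (leg c j) ⟨a, b, p⟩).symm
    have h3 (e : s.pt.hom (ν ((leg c j).onObj a)) (ν ((leg c j).onObj b)) =
        s.pt.hom ((s.ι.app j).onObj a) ((s.ι.app j).onObj b)) :
        (tensorCocone s ν hν (walks.map (leg c j).onObj ⟨a, b, p⟩)).ι.app
          ⟨j, ⟨a, b, p⟩, rfl⟩ ≫ eqToHom e = Gamma.ι E (F.obj j) p ≫ (s.ι.app j).onHom a b := by
      refine (Category.assoc _ _ _).trans (congrArg (Gamma.ι E (F.obj j) p ≫ ·) ?_)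
      refine (Category.assoc _ _ _).trans ?_
      refine (congrArg (_ ≫ ·) (eqToHom_trans _ _)).trans ?_
      exact Category.comp_id _
    refine Eq.trans ?_ (h3 (congrArg₂ s.pt.hom (hν j a) (hν j b)))
    refine Eq.trans ?_ (congrArg (· ≫ eqToHom _) h2)
    exact (Category.assoc _ _ _).symm
  choose τ hτ using ex
  exact ⟨⟨τ, hτ, fun s m hm => gamma_hom_ext hc H _ _ fun j => (hm j).trans (hτ s j).symm⟩⟩

end Detect

/-! ### ΓE preserves coproducts. -/

section Coproducts

theorem isColimit_of_isTerminal {K C : Type*} [Category* K] [Category* C] {G : K ⥤ C} (c : Cocone G)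
    {k : K} (hk : IsTerminal k) (h : IsIso (c.ι.app k)) : Nonempty (IsColimit c) :=
  ⟨⟨fun s => inv (c.ι.app k) ≫ s.ι.app k, fun s j => by
      rw [← c.w (hk.from j), Category.assoc, IsIso.hom_inv_id_assoc, s.w], fun s m hm => by
      rw [← hm k, IsIso.inv_hom_id_assoc]⟩⟩

/-- An initial object is the colimit of an empty diagram. -/
def isColimitOfIsEmpty {K C : Type*} [Category* K] [Category* C] [IsEmpty K] {G : K ⥤ C}
    (c : Cocone G) (h : IsInitial c.pt) : IsColimit c :=
  ⟨fun s => h.to s.pt, fun _ j => isEmptyElim j, fun _ _ _ => h.hom_ext _ _⟩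

theorem isInitial_of_isEmpty {K C : Type*} [Category* K] [Category* C] [IsEmpty K] {G : K ⥤ C}
    {c : Cocone G} (h : IsColimit c) : Nonempty (IsInitial c.pt) :=
  ⟨IsInitial.ofUniqueHom (fun W => h.desc ⟨W, ⟨fun q => isEmptyElim q, fun q => isEmptyElim q⟩⟩)
    fun _ _ => h.hom_ext fun q => isEmptyElim q⟩

variable {V : Type u} [Category.{v} V] {J : Type v} {F : Discrete J ⥤ EnrichedGraph V} {c : Cocone F}

/-- The indexing category is discrete, so tagging each object with its index and itself is
compatible and descends to the colimit. -/
theorem node_injective (hc : IsColimit c) {i j : Discrete J} {x : (F.obj i).obj}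
    {y : (F.obj j).obj} (h : (leg c i).onObj x = (leg c j).onObj y) :
    (⟨i, x⟩ : Σ i, (F.obj i).obj) = ⟨j, y⟩ := by
  obtain ⟨ν, hν⟩ := exists_nodes_desc hc (S := Σ i, (F.obj i).obj) (fun i x => ⟨i, x⟩) (by
    rintro ⟨i⟩ ⟨j⟩ f x
    obtain rfl : i = j := Discrete.eq_of_hom f
    obtain rfl : f = 𝟙 _ := Subsingleton.elim _ _
    exact congrArg (fun m : F.obj ⟨i⟩ ⟶ F.obj ⟨i⟩ => (⟨⟨i⟩, m.onObj x⟩ : Σ i, (F.obj i).obj))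
      (F.map_id _))
  exact (hν i x).symm.trans ((congrArg ν h).trans (hν j y))

theorem walk_injective (hc : IsColimit c) {i j : Discrete J} (w : walks.carrier (F.obj i).obj)
    (w' : walks.carrier (F.obj j).obj)
    (h : walks.map (leg c i).onObj w = walks.map (leg c j).onObj w') :
    (⟨i, w⟩ : Σ i, walks.carrier (F.obj i).obj) = ⟨j, w'⟩ := by
  induction w using walks_rec generalizing w' with
  | nil a =>
    induction w' using walks_rec with
    | nil b => cases node_injective hc (nilT_inj h); rfl
    | cons b w' => exact absurd h map_nilT_ne
  | cons a w ih =>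
    induction w' using walks_rec with
    | nil b => exact absurd h.symm map_nilT_ne
    | cons b w' =>
      cases node_injective hc (map_consT_inj h).1
      cases ih w' (map_consT_inj h).2
      rfl

/-- An element over a given one is terminal when there are no others. -/
def isTerminalFib {P : Shape.{v}} {t : P.carrier c.pt.obj} (q : Fib c t)
    (h : ∀ r : Fib c t, (⟨r.index, r.elt⟩ : Σ i, P.carrier (F.obj i).obj) = ⟨q.index, q.elt⟩) :
    IsTerminal q :=
  IsTerminal.ofUniqueHom (fun r => eqToHom (by
    obtain ⟨j, w, hw⟩ := q
    obtain ⟨i, w', hw'⟩ := r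
    cases h ⟨i, w', hw'⟩
    rfl)) fun r m => Subtype.ext (Subsingleton.elim _ _)

theorem isIso_leg (hc : IsColimit c) (j : Discrete J) (a b : (F.obj j).obj) :
    IsIso ((leg c j).onHom a b) := by
  obtain ⟨h⟩ := isColimit_homAt hc ((leg c j).onObj a, (leg c j).onObj b)
  have := h.isIso_ι_app_of_isTerminal ⟨j, (a, b), rfl⟩ (isTerminalFib _ (by
    rintro ⟨i, ⟨x, y⟩, h⟩
    cases node_injective hc (congrArg Prod.fst h)
    cases node_injective hc (congrArg Prod.snd h)
    rfl))
  have e := homAt_map_push (leg c j) a b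
  exact e ▸ this

/-- If the tail lifts but the whole does not, the first step cannot lift either, since such a lift
would join up with that of the tail. Its hom is then a colimit of an empty diagram. -/
theorem hasInitialMember_of_isEmpty (hc : IsColimit c) (t : walks.carrier c.pt.obj)
    (ht : IsEmpty (Fib c t)) : HasInitialMember (c.pt.homs t.2.2) := by
  induction t using walks_rec with
  | nil a =>
    obtain ⟨j, x, rfl⟩ := exists_node hc a
    exact ht.elim ⟨j, nilT x, rfl⟩
  | cons a t ih =>
    obtain h | ⟨⟨j, w, rfl⟩⟩ := isEmpty_or_nonempty (Fib c t)
    · exact Or.inr (ih h)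
    · refine Or.inl ?_
      obtain h | ⟨⟨i, ⟨x, y⟩, h⟩⟩ :=
        isEmpty_or_nonempty (Fib (P := pairs) c (a, (leg c j).onObj w.1))
      · obtain ⟨h'⟩ := isColimit_homAt hc (a, (leg c j).onObj w.1)
        exact isInitial_of_isEmpty h'
      · cases node_injective hc (congrArg Prod.snd h)
        have e : (leg c _).onObj x = a := congrArg Prod.fst h
        subst e
        exact ht.elim ⟨_, consT x w, rfl⟩

/-- A sequence in a coproduct lies in exactly one summand, where the leg is invertible on homs, or
passes through an initial hom, where distributivity makes the value of E initial. -/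
theorem gamma_preservesCoproducts [HasCoproducts.{v} V] {E : FreeMon V ⥤ V}
    (hE : PreservesCoproductsInEachVariable E) : PreservesCoproducts (Gamma.functor E) := by
  refine fun J => ⟨fun {F} => ⟨fun {c} hc => isColimit_gamma hc fun t => ?_⟩⟩
  obtain h | ⟨⟨q⟩⟩ := isEmpty_or_nonempty (Fib c t)
  · obtain ⟨h'⟩ := (hasInitialMember_of_isEmpty hc t h).isInitial hE
    exact ⟨isColimitOfIsEmpty _ h'⟩
  · refine isColimit_of_isTerminal _ (isTerminalFib q fun r =>
      walk_injective hc _ _ (r.map_elt.trans q.map_elt.symm)) ?_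
    obtain ⟨j, w, rfl⟩ := q
    have := isIso_homsAt_push (leg c j) (isIso_leg hc j) w
    exact inferInstanceAs (IsIso (E.map (homsAt.map (Shape.El.push (P := walks) (leg c j) w))))

end Coproducts

/-! ### Accessibility of ΓE from that of E. -/

section Filtered

variable {V : Type u} [Category.{v} V] {J : Type v} [SmallCategory J] {F : J ⥤ EnrichedGraph V}
  {c : Cocone F} {P : Shape.{v}}

theorem shape_map_comp {i j k : J} (f : i ⟶ j) (g : j ⟶ k) (w : P.carrier (F.obj i).obj) :
    P.map (F.map (f ≫ g)).onObj w = P.map (F.map g).onObj (P.map (F.map f).onObj w) :=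
  (congrArg (fun m : F.obj i ⟶ F.obj k => P.map m.onObj w) (F.map_comp f g)).trans
    (P.map_comp (F.map f).onObj (F.map g).onObj w)

theorem shape_map_leg {i j : J} (f : i ⟶ j) (w : P.carrier (F.obj i).obj) :
    P.map (leg c j).onObj (P.map (F.map f).onObj w) = P.map (leg c i).onObj w :=
  (P.map_comp (F.map f).onObj (leg c j).onObj w).symm.trans
    (congrArg (fun m : F.obj i ⟶ c.pt => P.map m.onObj w) (map_leg c f))

/-- Elements of the graphs of a diagram with the same image in a cocone become equal in the
diagram. -/
def Separates (P : Shape.{v}) (c : Cocone F) : Prop :=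
  ∀ (j : J) (w w' : P.carrier (F.obj j).obj), P.map (leg c j).onObj w = P.map (leg c j).onObj w' →
    ∃ (k : J) (f : j ⟶ k), P.map (F.map f).onObj w = P.map (F.map f).onObj w'

/-- The diagram under an element, as a diagram of elements over its image. -/
def underFib (c : Cocone F) (j : J) (w : P.carrier (F.obj j).obj) :
    Under j ⥤ Fib c (P.map (leg c j).onObj w) where
  obj f := ⟨f.right, P.map (F.map f.hom).onObj w, shape_map_leg f.hom w⟩
  map {f f'} g := ⟨g.right, (shape_map_comp _ _ _).symm.trans
    (congrArg (fun k : j ⟶ f'.right => P.map (F.map k).onObj w) (Under.w g))⟩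

theorem fib_coequalize [IsFiltered J] {t : P.carrier c.pt.obj} {q r : Fib c t} (s s' : q ⟶ r) :
    ∃ (k : J) (f : r.index ⟶ k), s.1 ≫ f = s'.1 ≫ f :=
  ⟨_, IsFiltered.coeqHom s.1 s'.1, IsFiltered.coeq_condition s.1 s'.1⟩

/-- Another lift of the same element and the given one agree at a later stage, which gives the
morphisms needed; parallel ones are coequalized in `J`. Colimits over all lifts may thus be computed
under a single lift. -/
theorem Separates.final_underFib [IsFiltered J] (h : Separates P c) (j : J)
    (w : P.carrier (F.obj j).obj) : (underFib c j w).Final := by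
  refine Functor.final_of_exists_of_isFiltered _ (fun d => ?_) fun {d f} s s' => ?_
  · obtain ⟨i, w', hw'⟩ := d
    obtain ⟨k, f, e⟩ := h _ (P.map (F.map (IsFiltered.leftToMax i j)).onObj w')
      (P.map (F.map (IsFiltered.rightToMax i j)).onObj w)
      ((shape_map_leg _ _).trans (hw'.trans (shape_map_leg _ _).symm))
    exact ⟨Under.mk (IsFiltered.rightToMax i j ≫ f), ⟨⟨IsFiltered.leftToMax i j ≫ f,
      (shape_map_comp _ _ _).trans (e.trans (shape_map_comp _ _ _).symm)⟩⟩⟩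
  · obtain ⟨k, g, e⟩ := fib_coequalize s s'
    exact ⟨Under.mk (f.hom ≫ g), Under.homMk g, Subtype.ext e⟩

/-- A compatible choice of elements over a given one. -/
def sectionFib {t : P.carrier c.pt.obj}
    (w : ∀ j, P.carrier (F.obj j).obj)
    (hw : ∀ {i j : J} (f : i ⟶ j), P.map (F.map f).onObj (w i) = w j)
    (h : ∀ j, P.map (leg c j).onObj (w j) = t) : J ⥤ Fib c t where
  obj j := ⟨j, w j, h j⟩
  map f := ⟨f, hw f⟩

theorem Separates.final_sectionFib [IsFiltered J] (H : Separates P c) {t : P.carrier c.pt.obj} (w : ∀ j, P.carrier (F.obj j).obj)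
    (hw : ∀ {i j : J} (f : i ⟶ j), P.map (F.map f).onObj (w i) = w j)
    (h : ∀ j, P.map (leg c j).onObj (w j) = t) : (sectionFib (c := c) w hw h).Final := by
  refine Functor.final_of_exists_of_isFiltered _ (fun d => ?_) fun {d j} s s' => ?_
  · obtain ⟨k, f, e⟩ := H d.index d.elt (w d.index) (d.map_elt.trans (h d.index).symm)
    exact ⟨k, ⟨⟨f, e.trans (hw f)⟩⟩⟩
  · obtain ⟨k, g, e⟩ := fib_coequalize s s'
    exact ⟨k, g, Subtype.ext e⟩

/-- The functor sending an enriched graph to its set of objects. -/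
def nodes : EnrichedGraph V ⥤ Type v where
  obj X := X.obj
  map f := TypeCat.ofHom f.onObj
  map_id _ := rfl
  map_comp _ _ := rfl

theorem isColimit_nodes (hc : IsColimit c) : Nonempty (IsColimit (nodes.mapCocone c)) := by
  have ex (s : Cocone (F ⋙ nodes)) : ∃ d : c.pt.obj → s.pt,
      ∀ j x, d ((leg c j).onObj x) = s.ι.app j x :=
    exists_nodes_desc hc _ fun {i j} f x => congrArg (fun m => m x) (s.w f)
  choose d hd using ex
  refine ⟨⟨fun s => TypeCat.ofHom (d s), fun s j => ?_, fun s m hm => ?_⟩⟩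
  · ext x
    exact hd s j x
  · ext x
    exact congrFun (nodes_hom_ext hc (fun x => m x) (d s) fun j y =>
      (congrArg (fun m => m y) (hm j)).trans (hd s j y).symm) x

theorem exists_map_eq [IsFiltered J] (hc : IsColimit c) {j : J} {x y : (F.obj j).obj}
    (h : (leg c j).onObj x = (leg c j).onObj y) :
    ∃ (k : J) (f : j ⟶ k), (F.map f).onObj x = (F.map f).onObj y := by
  obtain ⟨hn⟩ := isColimit_nodes hc
  exact (Types.FilteredColimit.isColimit_eq_iff' hn (i := j) x y).1 h

theorem separates_pairs [IsFiltered J] (hc : IsColimit c) : Separates pairs c := by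
  rintro j ⟨a, b⟩ ⟨a', b'⟩ h
  obtain ⟨k, f, e⟩ := exists_map_eq hc (congrArg Prod.fst h)
  obtain ⟨k', f', e'⟩ := exists_map_eq hc (congrArg Prod.snd h)
  obtain ⟨l, g, g', w⟩ := IsFiltered.span f f'
  refine ⟨l, f ≫ g, ?_⟩
  have h1 := congrArg (F.map g).onObj e
  have h2 := congrArg (F.map g').onObj e'
  have h3 (x : (F.obj j).obj) : (F.map (f ≫ g)).onObj x = (F.map g).onObj ((F.map f).onObj x) :=
    congrArg (fun m : F.obj j ⟶ F.obj l => m.onObj x) (F.map_comp f g)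
  have h4 (x : (F.obj j).obj) : (F.map (f ≫ g)).onObj x = (F.map g').onObj ((F.map f').onObj x) :=
    congrArg (fun m : F.obj j ⟶ F.obj l => m.onObj x)
      ((congrArg F.map w).trans (F.map_comp f' g'))
  exact congrArg₂ Prod.mk ((h3 a).trans (h1.trans (h3 a').symm))
    ((h4 b).trans (h2.trans (h4 b').symm))

/-- A sequence involves finitely many objects, so finitely many identifications must be reached, and
a filtered category has a stage beyond all of them. -/
theorem separates_walks [IsFiltered J] (hc : IsColimit c) : Separates walks c := by
  intro j w w' h
  induction w using walks_rec generalizing w' with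
  | nil a =>
    induction w' using walks_rec with
    | nil b =>
      obtain ⟨k, f, e⟩ := exists_map_eq hc (nilT_inj h)
      exact ⟨k, f, congrArg nilT e⟩
    | cons b w' => exact absurd h map_nilT_ne
  | cons a w ih =>
    induction w' using walks_rec with
    | nil b => exact absurd h.symm map_nilT_ne
    | cons b w' =>
      obtain ⟨k, f, e⟩ := exists_map_eq hc (map_consT_inj h).1
      obtain ⟨k', f', e'⟩ := ih w' (map_consT_inj h).2
      obtain ⟨l, g, g', r⟩ := IsFiltered.span f f'
      have h3 (x : (F.obj j).obj) :
          (F.map (f ≫ g)).onObj x = (F.map g).onObj ((F.map f).onObj x) :=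
        congrArg (fun m : F.obj j ⟶ F.obj l => m.onObj x) (F.map_comp f g)
      have h4 (x : walks.carrier (F.obj j).obj) : walks.map (F.map (f ≫ g)).onObj x =
          walks.map (F.map g').onObj (walks.map (F.map f').onObj x) :=
        (congrArg (fun k : j ⟶ l => walks.map (F.map k).onObj x) r).trans (shape_map_comp _ _ _)
      exact ⟨l, f ≫ g, congrArg₂ consT ((h3 a).trans ((congrArg (F.map g).onObj e).trans (h3 b).symm))
        ((h4 w).trans ((congrArg (walks.map (F.map g').onObj) e').trans (h4 w').symm))⟩

theorem exists_fib_walks [IsFiltered J] (hc : IsColimit c) (t : walks.carrier c.pt.obj) :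
    Nonempty (Fib c t) := by
  induction t using walks_rec with
  | nil a =>
    obtain ⟨j, x, rfl⟩ := exists_node hc a
    exact ⟨⟨j, nilT x, rfl⟩⟩
  | cons a t ih =>
    obtain ⟨⟨i, w, rfl⟩⟩ := ih
    obtain ⟨j, x, rfl⟩ := exists_node hc a
    have e : (leg c _).onObj ((F.map (IsFiltered.rightToMax i j)).onObj x) = (leg c j).onObj x :=
      congrArg (fun m : F.obj j ⟶ c.pt => m.onObj x) (map_leg c _)
    have e' := shape_map_leg (P := walks) (c := c) (IsFiltered.leftToMax i j) w
    exact ⟨⟨IsFiltered.max i j, consT ((F.map (IsFiltered.rightToMax i j)).onObj x)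
      (walks.map (F.map (IsFiltered.leftToMax i j)).onObj w), congrArg₂ consT e e'⟩⟩

theorem isColimit_homAt_under [IsFiltered J] (hc : IsColimit c) (j : J)
    (w : pairs.carrier (F.obj j).obj) : Nonempty (IsColimit
      ((homAt.mapCocone (fibCocone c (pairs.map (leg c j).onObj w))).whisker (underFib c j w))) := by
  obtain ⟨h⟩ := isColimit_homAt hc (pairs.map (leg c j).onObj w)
  have := (separates_pairs hc).final_underFib j w
  exact ⟨(Functor.Final.isColimitWhiskerEquiv (underFib c j w) _).symm h⟩

theorem consHom_fst_comp {X Y Z : V} {l m n : FreeMon V} (f : X ⟶ Y) (g : l ⟶ m)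
    (k : cons Y m ⟶ cons Z n) {k' : cons X l ⟶ cons Z n} (h : consHom f g ≫ k = k') :
    f ≫ k.1 = k'.1 ∧ g ≫ (k.2 : m ⟶ n) = k'.2 :=
  ⟨congrArg Prod.fst h, congrArg Prod.snd h⟩

/-- A cocone of sequences is a cocone in each member, and each member is a hom of the colimit,
computed under one lift by `isColimit_homAt_under`. The induction runs through the members. -/
theorem exists_homs_desc [IsFiltered J] (hc : IsColimit c) (j : J)
    (w : walks.carrier (F.obj j).obj) : ∀ (l : FreeMon V)
    (m : ∀ f : Under j, homsAt.obj ((underFib c j w ⋙ fibEl c _).obj f) ⟶ l)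
    (_ : ∀ {f f' : Under j} (g : f ⟶ f'),
      homsAt.map ((underFib c j w ⋙ fibEl c _).map g) ≫ m f' = m f),
    ∃ d : homsAt.obj ⟨c.pt, walks.map (leg c j).onObj w⟩ ⟶ l,
      ∀ f, homsAt.map ((fibCocone c _).ι.app ((underFib c j w).obj f)) ≫ d = m f := by
  induction w using walks_rec with
  -- Any component serves, since morphisms out of the empty sequence are unique.
  | nil a => exact fun l m _ => ⟨m (Under.mk (𝟙 j)), fun f => nil_hom_ext _ _⟩
  | cons a w ih =>
    intro l m hm
    cases l with
    | nil => exact PEmpty.elim (m (Under.mk (𝟙 j)))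
    | cons y l =>
      have hm' {f f' : Under j} (g : f ⟶ f') := consHom_fst_comp _ _ _ ((congrArg (· ≫ m f')
        (homsAt_map_consT (F.map g.right)
          (congrArg (fun k : pairs.carrier _ => k.1) ((underFib (P := pairs) c j (a, w.1)).map g).2)
          ((underFib (P := walks) c j w).map g).2)).symm.trans (hm g))
      obtain ⟨hd⟩ := isColimit_homAt_under hc j (a, w.1)
      let s : Cocone (underFib (P := pairs) c j (a, w.1) ⋙ fibEl c _ ⋙ homAt) :=
        { pt := y
          ι :=
            { app := fun f => (m f).1
              naturality := fun _ _ g => (hm' g).1.trans (Category.comp_id _).symm } }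
      obtain ⟨d', hd'⟩ := ih l (fun f => (m f).2) fun g => (hm' g).2
      refine ⟨consHom (hd.desc s) d', fun f => ?_⟩
      refine (congrArg (· ≫ consHom (hd.desc s) d') (homsAt_map_consT (leg c f.right)
        (congrArg (fun k : pairs.carrier _ => k.1) ((underFib (P := pairs) c j (a, w.1)).obj f).map_elt)
        ((underFib (P := walks) c j w).obj f).map_elt)).trans ?_
      exact Prod.ext (hd.fac s f) (hd' f)

theorem homs_hom_ext [IsFiltered J] (hc : IsColimit c) (j : J)
    (w : walks.carrier (F.obj j).obj) : ∀ {l : FreeMon V}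
    (d d' : homsAt.obj ⟨c.pt, walks.map (leg c j).onObj w⟩ ⟶ l)
    (_ : ∀ f, homsAt.map ((fibCocone c _).ι.app ((underFib c j w).obj f)) ≫ d =
      homsAt.map ((fibCocone c _).ι.app ((underFib c j w).obj f)) ≫ d'), d = d' := by
  induction w using walks_rec with
  | nil a => exact fun d d' _ => nil_hom_ext _ _
  | cons a w ih =>
    intro l d d' h
    cases l with
    | nil => exact PEmpty.elim d
    | cons y l =>
      have h' (f : Under j) := (congrArg (· ≫ d) (homsAt_map_consT (leg c f.right)
        (congrArg (fun k : pairs.carrier _ => k.1) ((underFib (P := pairs) c j (a, w.1)).obj f).map_elt)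
        ((underFib (P := walks) c j w).obj f).map_elt)).symm.trans ((h f).trans
        (congrArg (· ≫ d') (homsAt_map_consT (leg c f.right)
        (congrArg (fun k : pairs.carrier _ => k.1) ((underFib (P := pairs) c j (a, w.1)).obj f).map_elt)
        ((underFib (P := walks) c j w).obj f).map_elt)))
      obtain ⟨hd⟩ := isColimit_homAt_under hc j (a, w.1)
      exact Prod.ext (hd.hom_ext fun f => congrArg Prod.fst (h' f))
        (ih d.2 d'.2 fun f => congrArg Prod.snd (h' f))

theorem isColimit_homsAt_under [IsFiltered J] (hc : IsColimit c) (j : J)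
    (w : walks.carrier (F.obj j).obj) : Nonempty (IsColimit
      (homsAt.mapCocone ((fibCocone c (walks.map (leg c j).onObj w)).whisker (underFib c j w)))) := by
  choose d hd using fun s : Cocone ((underFib c j w ⋙ fibEl c _) ⋙ homsAt) =>
    exists_homs_desc hc j w s.pt s.ι.app fun g => s.w g
  exact ⟨⟨d, hd, fun s m hm => homs_hom_ext hc j w _ _ fun f => (hm f).trans (hd s f).symm⟩⟩

/-- Every sequence of objects of the colimit lifts to some stage. The diagram under that lift is
final among the lifts, and along it the homs form a colimit of the kind which E preserves. -/
theorem gamma_isCardinalAccessible [HasCoproducts.{v} V] {E : FreeMon V ⥤ V} {κ : Cardinal.{v}}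
    [Fact κ.IsRegular] (hE : E.IsCardinalAccessible κ) :
    (Gamma.functor E).IsCardinalAccessible κ := by
  refine ⟨fun J _ _ => ⟨fun {F} => ⟨fun {c} hc => isColimit_gamma hc fun t => ?_⟩⟩⟩
  have := isFiltered_of_isCardinalFiltered J κ
  obtain ⟨⟨j, w, rfl⟩⟩ := exists_fib_walks hc t
  obtain ⟨h⟩ := isColimit_homsAt_under hc j w
  have := (separates_walks hc).final_underFib j w
  -- The category of objects under `j` inherits the filteredness of `J`.
  have := hE.preservesColimitOfShape (Under j)
  have h' := isColimitOfPreserves E h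
  exact ⟨Functor.Final.isColimitWhiskerEquiv (underFib c j w) _ h'⟩

end Filtered

/-! ### Accessibility of E from that of ΓE. -/

section PathFunctor

variable {V : Type u} [Category.{v} V] [HasCoproducts.{v} V]

/-- The action on morphisms of the free graph with a sequence of objects. -/
noncomputable def pathMap {Z Z' : FreeMon V} (h : Z ⟶ Z') : path Z ⟶ path Z' :=
  pathDesc (h ≫ pathUnit Z')

theorem pathUnit_pathMap {Z Z' : FreeMon V} (h : Z ⟶ Z') :
    pathUnit Z ≫ homsAt.map (pathMap h) = h ≫ pathUnit Z' := pathUnit_desc _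

theorem pathUnit_pathMap_comp {Z Z' : FreeMon V} (h : Z ⟶ Z') {x : walks.El V} (r : path Z' ⟶ x) :
    pathUnit Z ≫ homsAt.map (pathMap h ≫ r) = h ≫ pathUnit Z' ≫ homsAt.map r := by
  rw [homsAt.map_comp, ← Category.assoc, pathUnit_pathMap, Category.assoc]

/-- The graph with a sequence of objects freely generated by a sequence, as a functor. -/
noncomputable def pathFunctor (V : Type u) [Category.{v} V] [HasCoproducts.{v} V] :
    FreeMon V ⥤ walks.El V where
  obj Z := path Z
  map h := pathMap h
  map_id Z := path_hom_ext (by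
    rw [pathUnit_pathMap, homsAt.map_id, Category.id_comp, Category.comp_id])
  map_comp f g := path_hom_ext (by
    rw [pathUnit_pathMap_comp, pathUnit_pathMap, pathUnit_pathMap, Category.assoc])

/-- The underlying graph of a graph with a sequence of objects. -/
def graphFunctor (V : Type u) [Category.{v} V] : walks.El V ⥤ EnrichedGraph V where
  obj x := x.graph
  map f := f.1

/-- A sequence is the sequence of homs of the graph which it freely generates. -/
noncomputable def pathUnitIso (V : Type u) [Category.{v} V] [HasCoproducts.{v} V] :
    𝟭 (FreeMon V) ≅ pathFunctor V ⋙ homsAt :=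
  NatIso.ofComponents (fun Z => @asIso _ _ _ _ (pathUnit Z) (isPath_path Z).isIso)
    fun h => (pathUnit_pathMap h).symm

theorem isIso_inj_of_isInitial {C : Type*} [Category* C] {K : Type*} {Y : K → C} {X : C}
    {i : ∀ k, Y k ⟶ X} (h : IsColimit (Cofan.mk X i)) (k : K)
    (hk : ∀ k', k' ≠ k → Nonempty (IsInitial (Y k'))) : IsIso (i k) := by
  classical
  let d : X ⟶ Y k := Cofan.IsColimit.desc h fun k' =>
    if e : k' = k then eqToHom (congrArg Y e) else (hk k' e).some.to _
  have hd : i k ≫ d = 𝟙 _ := (Cofan.IsColimit.fac h _ k).trans (by simp)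
  refine ⟨d, hd, Cofan.IsColimit.hom_ext h _ _ fun k' => ?_⟩
  by_cases e : k' = k
  · subst e
    exact (Category.assoc _ _ _).symm.trans ((congrArg (· ≫ i k') hd).trans
      ((Category.id_comp _).trans (Category.comp_id _).symm))
  · exact (hk k' e).some.hom_ext _ _

/-- Every other sequence with the same ends passes through an initial hom, so its summand is initial
by distributivity and only the summand of the line itself contributes. -/
theorem isIso_gammaι_path {E : FreeMon V ⥤ V} (hE : PreservesCoproductsInEachVariable E)
    (Z : FreeMon V) : IsIso ((gammaι E).app (path Z)) := by
  obtain ⟨h⟩ := Gamma.isColimit_ι E (path Z).graph (path Z).elt.1 (path Z).elt.2.1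
  refine isIso_inj_of_isInitial h (path Z).elt.2.2 fun p hp =>
    ((isPath_path Z).other ⟨_, _, p⟩ rfl fun e => hp ?_).isInitial hE
  exact eq_of_heq (Sigma.mk.inj (eq_of_heq (Sigma.mk.inj e).2)).2

/-- The tensor product of a sequence is the hom of `ΓE` at the ends of the graph which it freely
generates. -/
noncomputable def tensorIso {E : FreeMon V ⥤ V} (hE : PreservesCoproductsInEachVariable E) :
    E ≅ pathFunctor V ⋙ gammaEnds E ⋙ homAt :=
  Functor.isoWhiskerRight (pathUnitIso V) E ≪≫
    NatIso.ofComponents (F := pathFunctor V ⋙ tensorAt E)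
      (fun Z => @asIso _ _ _ _ _ (isIso_gammaι_path hE Z))
      fun h => (gammaι E).naturality ((pathFunctor V).map h)

variable {J : Type v} [SmallCategory J] {G : J ⥤ FreeMon V} {c : Cocone G}

/-- A cocone of graphs under the path graphs sends all the lines to one sequence, as any two stages
map to a common one. It is therefore a cocone of graphs with a sequence, where the free construction
applies. -/
theorem isColimit_path [IsFiltered J] (hc : IsColimit c) :
    Nonempty (IsColimit ((pathFunctor V ⋙ graphFunctor V).mapCocone c)) := by
  have ex (s : Cocone (G ⋙ pathFunctor V ⋙ graphFunctor V)) :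
      ∃ d : (path c.pt).graph ⟶ s.pt, ∀ j, (pathMap (Z' := c.pt) (c.ι.app j)).1 ≫ d = s.ι.app j := by
    let σ (j : J) : (path (G.obj j)).graph ⟶ s.pt := s.ι.app j
    have hσ {i j : J} (f : i ⟶ j) : (pathMap (G.map f)).1 ≫ σ j = σ i := s.w f
    have step {i j : J} (f : i ⟶ j) : walks.map (σ j).onObj (path (G.obj j)).elt =
        walks.map (σ i).onObj (path (G.obj i)).elt := by
      refine Eq.trans ?_ (congrArg (fun m : (path (G.obj i)).graph ⟶ s.pt =>
        walks.map m.onObj (path (G.obj i)).elt) (hσ f))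
      exact (congrArg (walks.map (σ j).onObj) (pathMap (G.map f)).2.symm).trans
        (walks.map_comp _ _ _).symm
    obtain ⟨j₀⟩ := IsFiltered.nonempty (C := J)
    have ht (j : J) : walks.map (σ j).onObj (path (G.obj j)).elt =
        walks.map (σ j₀).onObj (path (G.obj j₀)).elt :=
      (step (IsFiltered.leftToMax j j₀)).symm.trans (step (IsFiltered.rightToMax j j₀))
    let x : walks.El V := ⟨s.pt, walks.map (σ j₀).onObj (path (G.obj j₀)).elt⟩
    let r (j : J) : path (G.obj j) ⟶ x := ⟨σ j, ht j⟩
    have hr {i j : J} (f : i ⟶ j) : pathMap (G.map f) ≫ r j = r i :=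
      Shape.El.hom_ext (hσ f)
    let k : Cocone G :=
      { pt := homsAt.obj x
        ι :=
          { app := fun j => pathUnit _ ≫ homsAt.map (r j)
            naturality := fun i j f => (pathUnit_pathMap_comp (G.map f) (r j)).symm.trans
              ((congrArg (fun m => pathUnit _ ≫ homsAt.map m) (hr f)).trans
                (Category.comp_id _).symm) } }
    refine ⟨(pathDesc (hc.desc k)).1, fun j => ?_⟩
    have : pathMap (Z' := c.pt) (c.ι.app j) ≫ pathDesc (hc.desc k) = r j := path_hom_ext
      ((pathUnit_pathMap_comp (Z' := c.pt) (c.ι.app j) (pathDesc (hc.desc k))).trans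
        ((congrArg (c.ι.app j ≫ ·) (pathUnit_desc (hc.desc k))).trans (hc.fac k j)))
    exact congrArg (fun m => m.1) this
  have un {W : EnrichedGraph V} (m m' : (path c.pt).graph ⟶ W)
      (h : ∀ j, (pathMap (Z' := c.pt) (c.ι.app j)).1 ≫ m = (pathMap (Z' := c.pt) (c.ι.app j)).1 ≫ m') :
      m = m' := by
    obtain ⟨j₀⟩ := IsFiltered.nonempty (C := J)
    -- The line of the colimit is the image of the line at one stage, so its images under `m` and
    -- `m'` agree.
    have e : walks.map m.onObj (path c.pt).elt = walks.map m'.onObj (path c.pt).elt := by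
      have e' (m : (path c.pt).graph ⟶ W) : walks.map m.onObj (path c.pt).elt =
          walks.map ((pathMap (Z' := c.pt) (c.ι.app j₀)).1 ≫ m).onObj (path (G.obj j₀)).elt :=
        (congrArg (walks.map m.onObj) (pathMap (Z' := c.pt) (c.ι.app j₀)).2.symm).trans
          (walks.map_comp _ _ _).symm
      exact (e' m).trans ((congrArg (fun m : (path (G.obj j₀)).graph ⟶ W =>
        walks.map m.onObj (path (G.obj j₀)).elt) (h j₀)).trans (e' m').symm)
    let x : walks.El V := ⟨W, walks.map m'.onObj (path c.pt).elt⟩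
    let r : path c.pt ⟶ x := ⟨m, e⟩
    let r' : path c.pt ⟶ x := ⟨m', rfl⟩
    have hr : r = r' := path_hom_ext (hc.hom_ext fun j => by
      refine (pathUnit_pathMap_comp (Z' := c.pt) (c.ι.app j) r).symm.trans
        (Eq.trans ?_ (pathUnit_pathMap_comp (Z' := c.pt) (c.ι.app j) r'))
      exact congrArg (fun m => pathUnit (G.obj j) ≫ homsAt.map m) (Shape.El.hom_ext (h j)))
    exact congrArg (fun m => m.1) hr
  choose d hd using ex
  exact ⟨⟨d, hd, fun s m hm => un _ _ fun j => (hm j).trans (hd s j).symm⟩⟩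

/-- By `tensorIso` it is enough to preserve the colimit by path graphs, by ΓE and by taking the hom
at the ends. The last holds because the ends are chosen compatibly at all stages, and such a choice
is final among the lifts of the ends of the colimit. -/
theorem tensor_isCardinalAccessible {E : FreeMon V ⥤ V} (hE : PreservesCoproductsInEachVariable E)
    {κ : Cardinal.{v}} [Fact κ.IsRegular] (hT : (Gamma.functor E).IsCardinalAccessible κ) :
    E.IsCardinalAccessible κ := by
  refine ⟨fun J _ _ => ?_⟩
  suffices PreservesColimitsOfShape J (pathFunctor V ⋙ gammaEnds E ⋙ homAt) from
    preservesColimitsOfShape_of_natIso (tensorIso hE).symm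
  refine ⟨fun {G} => ⟨fun {c} hc => ?_⟩⟩
  have := isFiltered_of_isCardinalFiltered J κ
  have := hT.preservesColimitOfShape J
  obtain ⟨hp⟩ := isColimit_path hc
  have hp' := isColimitOfPreserves (Gamma.functor E) hp
  obtain ⟨h⟩ := isColimit_homAt hp' (ends (path c.pt).elt)
  have hF := (separates_pairs hp').final_sectionFib (t := ends (path c.pt).elt)
    (fun j => ends (path (G.obj j)).elt) (fun f => congrArg ends (pathMap (G.map f)).2)
    (fun j => congrArg ends (pathMap (Z' := c.pt) (c.ι.app j)).2)
  exact ⟨(@Functor.Final.isColimitWhiskerEquiv _ _ _ _ _ hF _ _ _ _).symm h⟩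

end PathFunctor

end EnrichedGraphMonad

theorem mainTheorem1 {V : Type u} [Category.{v} V] [HasCoproducts.{v} V]
    (E : EnrichedGraphMonad.Multitensor V) (hE : E.IsDistributive)
    (κ : Cardinal.{v}) [Fact κ.IsRegular] :
    EnrichedGraphMonad.PreservesCoproducts (E.gamma hE).toFunctor ∧
    (HasCardinalFilteredColimits V κ →
      (E.tensor.IsCardinalAccessible κ ↔ (E.gamma hE).toFunctor.IsCardinalAccessible κ)) ∧
    (HasPullbacks V → EnrichedGraphMonad.HasConnectedDecompositions V →
      (E.IsCartesian ↔ EnrichedGraphMonad.IsCartesianMonad (E.gamma hE))) ∧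
    (EnrichedGraphMonad.IsLocallyCPresentable V κ →
      (E.IsLRA ↔ EnrichedGraphMonad.IsLRAMonad (E.gamma hE))) := by
  refine ⟨EnrichedGraphMonad.gamma_preservesCoproducts hE, fun _ =>
    ⟨EnrichedGraphMonad.gamma_isCardinalAccessible,
      EnrichedGraphMonad.tensor_isCardinalAccessible hE⟩, fun _ hV => EnrichedGraphMonad.isCartesian_iff hE hV, fun h =>
    EnrichedGraphMonad.isLRA_iff hE
      (EnrichedGraphMonad.hasConnectedDecompositions_of_isLocallyCPresentable h)⟩
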